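/- Let $\xi=(\xi_t)_{t\ge 0}$ be a subordinator, possibly killed: a $[0,\infty]$-valued process with $\xi_0=0$ and a.s. non-decreasing right-continuous paths (so that $\infty$ is absorbing) such that, for all $s,t\ge 0$, on $\{\xi_s<\infty\}$ the increment $\xi_{s+t}-\xi_s$ is independent of $(\xi_r)_{r\le s}$ and distributed as $\xi_t$. Assume that $\xi$ is not almost surely identically $0$. Let $\phi(q)=-\log\mathbb E[e^{-q\xi_1}]$, $q\ge 0$ (with $e^{-q\infty}=0$ for all $q \geq 0$), be its Laplace exponent, let $\Phi(q)=\int_0^q\phi(s)\,\mathrm ds$, and for $t\ge 0$ let $\rho(t)=\inf\{u\ge 0:\int_0^u\xi_r\,\mathrm dr>t\}$, with the conventions $\inf\emptyset=\infty$ and $\xi_\infty=\infty$. Then $\Phi$ is a bijection from $[0,\infty)$ onto $[0,\infty)$, and its inverse $\Phi^{-1}$ is the Laplace exponent of a subordinator. Denote by $L$ the Lévy measure of the latter, i.e. the measure on $(0,\infty)$ with $\int_0^\infty(1\wedge x)\,L(\mathrm dx)<\infty$ such that $\Phi^{-1}(q)=k+dq+\int_0^\infty(1-e^{-qx})\,L(\mathrm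 dx)$ for all $q\ge 0$ and some constants $k,d\ge 0$. Then for all $q>0$ and $t\ge 0$, $$\mathbb E\left[e^{-q\xi_{\rho(t)}}\right]=\phi(q)\int_0^\infty e^{-\Phi(q)x-\frac tx}\,x\,L(\mathrm dx),$$ where the integral on the right-hand side is finite. -/

import Mathlib

open MeasureTheory Set
open scoped NNReal ENNReal

/-- A (possibly killed) subordinator: a `[0,∞]`-valued process started from `0`, with almost surely
non-decreasing right-continuous paths (`∞` is then absorbing), such that for all times `s, t`,
on the event that the process is still alive at time `s`, the increment `ξ (s + t) - ξ s`
is independent of the past up to time `s` and has the law of `ξ t`. -/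
structure IsSubordinator {Ω : Type*} [MeasurableSpace Ω] (ξ : ℝ≥0 → Ω → ℝ≥0∞)
    (P : Measure Ω) : Prop where
  measurable : ∀ t, Measurable (ξ t)
  zero : ∀ᵐ ω ∂P, ξ 0 ω = 0
  mono : ∀ᵐ ω ∂P, Monotone (fun t => ξ t ω)
  right_cont : ∀ᵐ ω ∂P, ∀ t, ContinuousWithinAt (fun s => ξ s ω) (Ici t) t
  increments : ∀ (s t : ℝ≥0) (A : Set Ω) (B : Set ℝ≥0∞),
    MeasurableSet[⨆ r : {r : ℝ≥0 // r ≤ s},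
      MeasurableSpace.comap (ξ r) (inferInstance : MeasurableSpace ℝ≥0∞)] A →
    MeasurableSet B →
    P (A ∩ {ω | ξ s ω < ∞} ∩ {ω | ξ (s + t) ω - ξ s ω ∈ B}) =
      P (A ∩ {ω | ξ s ω < ∞}) * P {ω | ξ t ω ∈ B}

/-- `e^{-q x}` for `q ≥ 0` and `x ∈ [0,∞]`, with the convention `e^{-q ∞} = 0` (also for
`q = 0`). -/
noncomputable def expNeg (q : ℝ) (x : ℝ≥0∞) : ℝ :=
  if x = ∞ then 0 else Real.exp (-(q * x.toReal))

/-- The Laplace exponent `q ↦ -log E[e^{-q ξ_1}]`. -/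
noncomputable def laplaceExponent {Ω : Type*} [MeasurableSpace Ω] (ξ : ℝ≥0 → Ω → ℝ≥0∞)
    (P : Measure Ω) (q : ℝ) : ℝ :=
  -Real.log (∫ ω, expNeg q (ξ 1 ω) ∂P)

/-- `L`, a measure on `(0,∞)` (encoded as a measure on `ℝ` giving no mass to `(-∞,0]`) with
`∫ (1 ∧ x) L(dx) < ∞`, is the Lévy measure in the representation
`κ + c q + ∫ (1 - e^{-q x}) L(dx)`, `q ≥ 0`, of the Laplace exponent of the process. -/
def HasLevyMeasure {Ω : Type*} [MeasurableSpace Ω] (ξ : ℝ≥0 → Ω → ℝ≥0∞)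
    (P : Measure Ω) (L : Measure ℝ) : Prop :=
  L (Iic 0) = 0 ∧ ∫⁻ x in Ioi (0 : ℝ), ENNReal.ofReal (min 1 x) ∂L < ∞ ∧
    ∃ κ c : ℝ, 0 ≤ κ ∧ 0 ≤ c ∧ ∀ q : ℝ, 0 ≤ q →
      laplaceExponent ξ P q = κ + c * q + ∫ x in Ioi (0 : ℝ), (1 - Real.exp (-(q * x))) ∂L

/-- The primitive `Φ(q) = ∫_0^q φ(s) ds` of `φ` vanishing at `0`. -/
noncomputable def primitive (φ : ℝ → ℝ) (q : ℝ) : ℝ :=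
  ∫ s in (0 : ℝ)..q, φ s

/-- The time change `ρ(t) = inf {u ≥ 0 : ∫_0^u ξ_r dr > t}`, with `inf ∅ = ∞`. -/
noncomputable def timeChange {Ω : Type*} (ξ : ℝ≥0 → Ω → ℝ≥0∞) (t : ℝ≥0) (ω : Ω) : ℝ≥0∞ :=
  ⨅ (u : ℝ≥0) (_ : (t : ℝ≥0∞) < ∫⁻ r in Icc (0 : ℝ) u, ξ r.toNNReal ω), (u : ℝ≥0∞)

/-- The time-changed process `ξ_{ρ(t)}`, with `ξ_∞ = ∞`. -/
noncomputable def timeChanged {Ω : Type*} (ξ : ℝ≥0 → Ω → ℝ≥0∞) (t : ℝ≥0) (ω : Ω) : ℝ≥0∞ :=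
  if timeChange ξ t ω = ∞ then ∞ else ξ (timeChange ξ t ω).toNNReal ω

/-! The formula is proved by computing the Laplace transform in t of both sides. Write A_u for the
area ∫_0^u ξ_r dr. Changing variables t = A_u along each path
(`IsMonotoneCadlag.lintegral_expNeg_areaChanged`) gives ∫ a e^{-at} E[e^{-qξ_{ρ(t)}}] dt = ∫ E[a ξ_u
e^{-aA_u - qξ_u}] du. The pair (A_u, ξ_u) has an explicit joint transform, E[e^{-aA_u - qξ_u}] =
exp(-∫_0^u φ(q+as) ds), obtained from Riemann sums and independent increments. Differentiating in q
turns the right-hand side into ∫ (φ(q+au) - φ(q)) e^{-s(u)} du with s(u) = (Φ(q+au) - Φ(q))/a.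

Since ds = φ(q+au) du, this is φ(q) ∫ (1/φ(q) - 1/φ(q+au)) e^{-s} ds. Now 1/φ is the derivative of
Φ^{-1} evaluated at Φ, hence 1/φ(q) = d + ∫ x e^{-xΦ(q)} L(dx). The drift cancels in the difference,
and integrating in s leaves φ(q) ∫ x e^{-xΦ(q)} (ax/(1+ax)) L(dx). As ax/(1+ax) = ∫ a e^{-at}
e^{-t/x} dt, this is the transform of the claimed expression. Uniqueness gives equality for almost
every t, and right-continuity in t gives it everywhere, including t = 0.

It remains to see that Φ^{-1} is the exponent of a subordinator. If φ ≤ c, then Φ^{-1}(w) is the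
increasing limit of the iterates, from 0, of y ↦ w/c + ∫_0^y (1 - φ(s)/c) ds, and each iterate is a
Bernstein function of w. The general case follows by approximating φ by n(1 - e^{-φ/n})
(`isBernstein_primitiveInv`). Then 1/φ(Φ^{-1}(w)) = ∫_0^∞ e^{-tφ(Φ^{-1}(w))} dt is completely
monotone, so by Bernstein's theorem (derived here from Hausdorff's moment theorem) it is a Laplace
transform. Its antiderivative Φ^{-1} then has a Lévy-Khintchine form, and a Poisson point process
realises the corresponding subordinator (`exists_subordinator`). -/

open Filter Topology

/-! ### Completely monotone and Bernstein functions through finite differences -/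

/-- The backward difference operator `f ↦ f - f (· + h)`. -/
def diffOp (h : ℝ) (f : ℝ → ℝ) : ℝ → ℝ := fun x => f x - f (x + h)

/-- All iterated backward differences of step `h` are nonnegative on `(0, ∞)`. -/
def CMStep (h : ℝ) (f : ℝ → ℝ) : Prop :=
  ∀ (n : ℕ) (x : ℝ), 0 < x → 0 ≤ (diffOp h)^[n] f x

/-- Complete monotonicity on `(0, ∞)`, in terms of finite differences. -/
def CompletelyMonotone (f : ℝ → ℝ) : Prop := ∀ h : ℝ, 0 < h → CMStep h f

/-- Bernstein functions, characterised by complete monotonicity of their exponentials. -/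
def IsBernstein (b : ℝ → ℝ) : Prop :=
  ∀ t : ℝ, 0 ≤ t → CompletelyMonotone (fun w => Real.exp (-(t * b w)))

namespace CMStep

variable {h : ℝ} {f g : ℝ → ℝ}

theorem nonneg (hf : CMStep h f) {x : ℝ} (hx : 0 < x) : 0 ≤ f x := hf 0 x hx

theorem diff (hf : CMStep h f) : CMStep h (diffOp h f) := fun n x hx => hf (n + 1) x hx

theorem iterate_shift (h a : ℝ) (f : ℝ → ℝ) (n : ℕ) (x : ℝ) :
    (diffOp h)^[n] (fun y => f (y + a)) x = (diffOp h)^[n] f (x + a) := by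
  induction n generalizing f x with
  | zero => rfl
  | succ n ih =>
    rw [Function.iterate_succ_apply, Function.iterate_succ_apply, ← ih]
    refine congrFun (congrArg _ (funext fun y => ?_)) x
    simp only [diffOp]
    ring_nf

theorem shift (hf : CMStep h f) {a : ℝ} (ha : 0 ≤ a) : CMStep h (fun x => f (x + a)) := by
  intro n x hx
  rw [iterate_shift]
  exact hf n _ (by linarith)

theorem iterate_congr (hh : 0 < h) (hfg : ∀ x, 0 < x → f x = g x) (n : ℕ) {x : ℝ} (hx : 0 < x) :
    (diffOp h)^[n] f x = (diffOp h)^[n] g x := by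
  induction n generalizing f g with
  | zero => exact hfg x hx
  | succ n ih =>
    refine ih fun y hy => ?_
    simp only [diffOp]
    rw [hfg y hy, hfg (y + h) (by linarith)]

theorem congr (hh : 0 < h) (hf : CMStep h f) (hfg : ∀ x, 0 < x → f x = g x) : CMStep h g :=
  fun n x hx => (iterate_congr hh hfg n hx) ▸ hf n x hx

theorem add (hf : CMStep h f) (hg : CMStep h g) : CMStep h (fun x => f x + g x) := by
  intro n
  induction n generalizing f g with
  | zero => exact fun x hx => add_nonneg (hf.nonneg hx) (hg.nonneg hx)
  | succ n ih =>
    intro x hx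
    have := ih hf.diff hg.diff x hx
    rw [Function.iterate_succ_apply]
    convert this using 2
    funext y
    simp only [diffOp]
    ring

theorem const (h : ℝ) {c : ℝ} (hc : 0 ≤ c) : CMStep h (fun _ => c) := by
  intro n
  induction n generalizing c with
  | zero => exact fun x _ => hc
  | succ n ih =>
    intro x hx
    have e : diffOp h (fun _ => c) = fun _ => 0 := funext fun _ => sub_self c
    rw [Function.iterate_succ_apply, e]
    exact ih le_rfl x hx

/-- Discrete Leibniz rule: the difference of f g is (Δf) g + f(· + h) Δg, and both products again
have factors of the same class, so induction on the order of the difference applies. -/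
theorem mul (hf : CMStep h f) (hg : CMStep h g) (hh : 0 < h) :
    CMStep h (fun x => f x * g x) := by
  intro n
  have key : ∀ (n : ℕ) (f g : ℝ → ℝ), CMStep h f → CMStep h g → ∀ x, 0 < x →
      0 ≤ (diffOp h)^[n] (fun x => f x * g x) x := by
    intro n
    induction n with
    | zero => exact fun f g hf hg x hx => mul_nonneg (hf.nonneg hx) (hg.nonneg hx)
    | succ n ih =>
      intro f g hf hg x hx
      have h1 := ih _ _ hf.diff hg x hx
      have h2 := ih _ _ (hf.shift hh.le) hg.diff x hx
      have hadd : ∀ (n : ℕ) (a b : ℝ → ℝ) (x : ℝ), (diffOp h)^[n] (fun x => a x + b x) x =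
          (diffOp h)^[n] a x + (diffOp h)^[n] b x := by
        intro n
        induction n with
        | zero => exact fun a b x => rfl
        | succ n ih2 =>
          intro a b x
          rw [Function.iterate_succ_apply, Function.iterate_succ_apply,
            Function.iterate_succ_apply, ← ih2]
          refine congrFun (congrArg _ (funext fun y => ?_)) x
          simp only [diffOp]
          ring
      rw [Function.iterate_succ_apply]
      have e : diffOp h (fun x => f x * g x) =
          fun x => diffOp h f x * g x + f (x + h) * diffOp h g x := by
        funext y
        simp only [diffOp]
        ring
      rw [e, hadd]
      exact add_nonneg h1 h2
  exact key n f g hf hg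

theorem pow (hf : CMStep h f) (hh : 0 < h) (k : ℕ) : CMStep h (fun x => f x ^ k) := by
  induction k with
  | zero => simpa using const h zero_le_one
  | succ k ih => simpa [pow_succ] using ih.mul hf hh

theorem sum {ι : Type*} (s : Finset ι) {F : ι → ℝ → ℝ} (hF : ∀ i ∈ s, CMStep h (F i)) :
    CMStep h (fun x => ∑ i ∈ s, F i x) := by
  classical
  induction s using Finset.induction_on with
  | empty => simpa using const h le_rfl
  | insert i s hi ih =>
    simp only [Finset.sum_insert hi]
    exact (hF i (by simp)).add (ih fun j hj => hF j (by simp [hj]))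

theorem of_tendsto {ι : Type*} {l : Filter ι} [l.NeBot] {F : ι → ℝ → ℝ} (hh : 0 < h)
    (hF : ∀ᶠ i in l, CMStep h (F i))
    (hlim : ∀ x, 0 < x → Tendsto (fun i => F i x) l (𝓝 (f x))) : CMStep h f := by
  have key : ∀ (n : ℕ) (F : ι → ℝ → ℝ) (f : ℝ → ℝ),
      (∀ x, 0 < x → Tendsto (fun i => F i x) l (𝓝 (f x))) → ∀ x, 0 < x →
      Tendsto (fun i => (diffOp h)^[n] (F i) x) l (𝓝 ((diffOp h)^[n] f x)) := by
    intro n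
    induction n with
    | zero => exact fun F f H x hx => H x hx
    | succ n ih =>
      intro F f H x hx
      exact ih _ _ (fun y hy => (H y hy).sub (H (y + h) (by linarith))) x hx
  intro n x hx
  exact ge_of_tendsto (key n F f hlim x hx) (hF.mono fun i hi => hi n x hx)

/-- The partial sums of the exponential series are nonnegative combinations of powers, and the class
is closed under products, sums and pointwise limits. -/
theorem exp (hf : CMStep h f) (hh : 0 < h) : CMStep h (fun x => Real.exp (f x)) := by
  refine of_tendsto (l := atTop) (F := fun n x => ∑ k ∈ Finset.range n, f x ^ k / k.factorial) hh
    (Eventually.of_forall fun n => sum _ fun k _ => ?_) fun x _ => ?_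
  · simpa [div_eq_mul_inv] using (hf.pow hh k).mul (const h (c := ((k.factorial : ℝ))⁻¹)
      (by positivity)) hh
  · rw [Real.exp_eq_exp_ℝ]
    exact (NormedSpace.expSeries_div_hasSum_exp (f x)).tendsto_sum_nat

theorem integral {Ω : Type*} [MeasurableSpace Ω] {μ : Measure Ω} {F : Ω → ℝ → ℝ} (hh : 0 < h)
    (hF : ∀ ω, CMStep h (F ω)) (hint : ∀ x, 0 < x → Integrable (fun ω => F ω x) μ) :
    CMStep h (fun x => ∫ ω, F ω x ∂μ) := by
  have key : ∀ (n : ℕ) (F : Ω → ℝ → ℝ), (∀ x, 0 < x → Integrable (fun ω => F ω x) μ) →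
      ∀ x, 0 < x → (diffOp h)^[n] (fun x => ∫ ω, F ω x ∂μ) x =
        ∫ ω, (diffOp h)^[n] (F ω) x ∂μ := by
    intro n
    induction n with
    | zero => exact fun F H x hx => rfl
    | succ n ih =>
      intro F H x hx
      have e := ih (fun ω => diffOp h (F ω))
        (fun y hy => (H y hy).sub (H (y + h) (by linarith))) x hx
      rw [Function.iterate_succ_apply]
      simp only [Function.iterate_succ_apply]
      rw [← e]
      refine iterate_congr hh (fun y hy => ?_) n hx
      exact (integral_sub (H y hy) (H (y + h) (by linarith))).symm
  intro n x hx
  rw [key n F hint x hx]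
  exact integral_nonneg fun ω => hF ω n x hx

/-- The exponential is an eigenfunction of the difference operator, with eigenvalue 1 - e^{-ah} ≥ 0.
-/
theorem exp_neg_mul (hh : 0 < h) {a : ℝ} (ha : 0 ≤ a) :
    CMStep h (fun x => Real.exp (-(a * x))) := by
  have key : ∀ n x, (diffOp h)^[n] (fun x => Real.exp (-(a * x))) x =
      (1 - Real.exp (-(a * h))) ^ n * Real.exp (-(a * x)) := by
    intro n
    induction n with
    | zero => simp
    | succ n ih =>
      intro x
      rw [Function.iterate_succ_apply']
      simp only [diffOp]
      rw [ih, ih, mul_add a x h, neg_add, Real.exp_add]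
      ring
  intro n x _
  rw [key]
  have : Real.exp (-(a * h)) ≤ 1 := Real.exp_le_one_iff.2 (by nlinarith)
  exact mul_nonneg (pow_nonneg (by linarith) _) (Real.exp_pos _).le

end CMStep

namespace IsBernstein

variable {a b : ℝ → ℝ}

theorem id : IsBernstein (fun w => w) := fun _ ht _ hh => CMStep.exp_neg_mul hh ht

theorem zero : IsBernstein (fun _ => 0) := fun t _ h _ => by
  simpa using CMStep.const h zero_le_one

theorem add (ha : IsBernstein a) (hb : IsBernstein b) : IsBernstein (fun w => a w + b w) := by
  intro t ht h hh
  refine (((ha t ht h hh).mul (hb t ht h hh) hh)).congr hh fun x _ => ?_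
  rw [← Real.exp_add]
  ring_nf

theorem const_mul (hb : IsBernstein b) {c : ℝ} (hc : 0 ≤ c) :
    IsBernstein (fun w => c * b w) := by
  intro t ht h hh
  refine (hb (t * c) (mul_nonneg ht hc) h hh).congr hh fun x _ => ?_
  ring_nf

theorem of_tendsto {ι : Type*} {l : Filter ι} [l.NeBot] {F : ι → ℝ → ℝ}
    (hF : ∀ᶠ i in l, IsBernstein (F i))
    (hlim : ∀ x, 0 < x → Tendsto (fun i => F i x) l (𝓝 (b x))) : IsBernstein b := by
  intro t ht h hh
  refine CMStep.of_tendsto hh (hF.mono fun i hi => hi t ht h hh) fun x hx => ?_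
  exact (Real.continuous_exp.tendsto _).comp (((hlim x hx).const_mul t).neg)

/-- e^{-t(c - f)} is the positive constant e^{-tc} times e^{tf}, and exponentials preserve complete
monotonicity. -/
theorem const_sub {f : ℝ → ℝ} (hf : CompletelyMonotone f) (c : ℝ) :
    IsBernstein (fun w => c - f w) := by
  intro t ht h hh
  have h1 := (((hf h hh).mul (CMStep.const h ht) hh).exp hh).mul
    (CMStep.const h (Real.exp_pos (-(t * c))).le) hh
  refine h1.congr hh fun x _ => ?_
  rw [← Real.exp_add]
  ring_nf

theorem congr (ha : IsBernstein a) (hab : ∀ x, 0 < x → a x = b x) : IsBernstein b :=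
  fun t ht h hh => (ha t ht h hh).congr hh fun x hx => by rw [hab x hx]

/-- A primitive of a bounded monotone function composed with a Bernstein function. -/
theorem primitive_comp {f : ℝ → ℝ} (hanti : AntitoneOn f (Ici 0)) (hnn : ∀ s, 0 ≤ s → 0 ≤ f s)
    (hb : IsBernstein b) (hb0 : ∀ w, 0 < w → 0 ≤ b w)
    (hcm : ∀ s, 0 ≤ s → CompletelyMonotone (fun w => f (s + b w))) :
    IsBernstein (fun w => ∫ s in (0 : ℝ)..(b w), f s) := by
  have hint : ∀ x y, 0 ≤ x → 0 ≤ y → IntervalIntegrable f volume x y := by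
    intro x y hx hy
    refine AntitoneOn.intervalIntegrable (hanti.mono fun z hz => ?_)
    exact (le_min hx hy).trans hz.1
  obtain ⟨c, hc⟩ : ∃ c, Tendsto f atTop (𝓝 c) := by
    let f' : ℝ → ℝ := fun x => f (max x 0)
    have h1 : Antitone f' := fun x y hxy =>
      hanti (mem_Ici.2 (le_max_right _ _)) (mem_Ici.2 (le_max_right _ _)) (max_le_max hxy le_rfl)
    have h2 : BddBelow (range f') := ⟨0, by rintro _ ⟨x, rfl⟩; exact hnn _ (le_max_right _ _)⟩
    refine ⟨_, (tendsto_atTop_ciInf h1 h2).congr' ?_⟩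
    filter_upwards [eventually_ge_atTop 0] with x hx
    simp [f', hx]
  have hc0 : 0 ≤ c := ge_of_tendsto hc ((eventually_ge_atTop 0).mono fun s hs => hnn s hs)
  -- Here ∫_0^b f is the limit as R → ∞ of c b + ∫_0^R f(s) ds - ∫_0^R f(s + b) ds, where c is the
  -- limit of f at infinity. Each approximant is a multiple of b plus a constant minus a completely
  -- monotone function.
  have hB : ∀ R : ℝ, 0 ≤ R → IsBernstein (fun w => c * b w +
      ((∫ s in (0 : ℝ)..R, f s) - ∫ s in (0 : ℝ)..R, f (s + b w))) := by
    intro R hR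
    refine (hb.const_mul hc0).add (const_sub ?_ _)
    intro h hh
    -- `CMStep.integral` asks for every parameter value, hence the truncation `max s 0`, which
    -- changes nothing on (0, R].
    have := CMStep.integral (h := h) (μ := volume.restrict (Ioc 0 R))
      (F := fun s w => f (max s 0 + b w)) hh (fun s => hcm _ (le_max_right _ _) h hh) ?_
    · refine this.congr hh fun x _ => ?_
      rw [intervalIntegral.integral_of_le hR]
      refine setIntegral_congr_fun measurableSet_Ioc fun s hs => ?_
      simp [max_eq_left hs.1.le]
    · intro x hx
      have h2 : AntitoneOn (fun s => f (max s 0 + b x)) (uIcc 0 R) := by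
        intro s _ t _ hst
        have := hb0 x hx
        exact hanti (add_nonneg (le_max_right _ _) this) (add_nonneg (le_max_right _ _) this)
          (by gcongr)
      exact (intervalIntegrable_iff_integrableOn_Ioc_of_le hR).1 h2.intervalIntegrable
  refine of_tendsto (l := atTop) ((eventually_ge_atTop 0).mono hB) fun x hx => ?_
  have hbx := hb0 x hx
  have e : ∀ R : ℝ, 0 ≤ R → c * b x +
      ((∫ s in (0 : ℝ)..R, f s) - ∫ s in (0 : ℝ)..R, f (s + b x)) =
      c * b x + ((∫ s in (0 : ℝ)..(b x), f s) - ∫ s in (0 : ℝ)..(b x), f (s + R)) := by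
    intro R hR
    rw [intervalIntegral.integral_comp_add_right, intervalIntegral.integral_comp_add_right,
      zero_add, zero_add, add_comm (b x) R]
    have h1 := intervalIntegral.integral_add_adjacent_intervals (hint 0 R le_rfl hR)
      (hint R (R + b x) hR (by linarith))
    have h2 := intervalIntegral.integral_add_adjacent_intervals (hint 0 (b x) le_rfl hbx)
      (hint (b x) (R + b x) hbx (by linarith))
    linarith
  have hlim : Tendsto (fun R => ∫ s in (0 : ℝ)..(b x), f (s + R)) atTop
      (𝓝 (∫ s in (0 : ℝ)..(b x), c)) := by
    refine intervalIntegral.tendsto_integral_filter_of_dominated_convergence (fun _ => f 0)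
      ?_ ?_ ?_ ?_
    · filter_upwards [eventually_ge_atTop 0] with R hR
      have : IntervalIntegrable (fun s => f (s + R)) volume 0 (b x) := by
        refine AntitoneOn.intervalIntegrable fun s hs t ht hst => ?_
        rw [uIcc_of_le hbx] at hs ht
        exact hanti (add_nonneg hs.1 hR) (add_nonneg ht.1 hR) (by gcongr)
      exact this.def'.aestronglyMeasurable
    · filter_upwards [eventually_ge_atTop 0] with R hR
      refine ae_of_all _ fun s hs => ?_
      rw [uIoc_of_le hbx] at hs
      have h0 : 0 ≤ s + R := by linarith [hs.1]
      rw [Real.norm_of_nonneg (hnn _ h0)]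
      exact hanti self_mem_Ici h0 h0
    · exact intervalIntegrable_const
    · exact ae_of_all _ fun s _ => hc.comp (tendsto_atTop_add_const_left _ s tendsto_id)
  have h3 := ((tendsto_const_nhds (x := ∫ s in (0 : ℝ)..(b x), f s)).sub hlim).const_add (c * b x)
  have h4 : c * b x + ((∫ s in (0 : ℝ)..(b x), f s) - ∫ s in (0 : ℝ)..(b x), c) =
      ∫ s in (0 : ℝ)..(b x), f s := by
    rw [intervalIntegral.integral_const, smul_eq_mul]
    ring
  rw [h4] at h3
  refine h3.congr' ?_
  filter_upwards [eventually_ge_atTop 0] with R hR using (e R hR).symm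

end IsBernstein

/-! ### Determining classes, weak compactness and Hausdorff's moment theorem -/

section

open scoped BoundedContinuousFunction unitInterval

/-- Finite measures are determined by a point-separating multiplicative family of bounded
continuous functions. -/
theorem MeasureTheory.Measure.ext_of_submonoid {E : Type*} [TopologicalSpace E] [PolishSpace E]
    [MeasurableSpace E] [BorelSpace E] {μ ν : Measure E} [IsFiniteMeasure μ] [IsFiniteMeasure ν]
    (M : Submonoid (E →ᵇ ℝ)) (hsep : ∀ x y, x ≠ y → ∃ f ∈ M, f x ≠ f y)
    (h : ∀ f ∈ M, ∫ x, f x ∂μ = ∫ x, f x ∂ν) : μ = ν := by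
  let A : StarSubalgebra ℝ (E →ᵇ ℝ) :=
    { Algebra.adjoin ℝ (M : Set (E →ᵇ ℝ)) with
      star_mem' := fun {a} ha => by
        have : star a = a := by ext x; simp
        rw [this]
        exact ha }
  have hA : ∀ f, f ∈ A ↔ f ∈ Algebra.adjoin ℝ (M : Set (E →ᵇ ℝ)) := fun f => Iff.rfl
  refine ext_of_forall_mem_subalgebra_integral_eq_of_polish (𝕜 := ℝ) (A := A) ?_ ?_
  · intro x y hxy
    obtain ⟨f, hf, hfxy⟩ := hsep x y hxy
    refine ⟨f, ⟨f.toContinuousMap, ⟨f, ?_, rfl⟩, rfl⟩, hfxy⟩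
    exact Algebra.subset_adjoin hf
  · intro f hf
    -- The algebra generated by a multiplicative family is its linear span, so linearity of the
    -- integral suffices.
    rw [hA, ← Subalgebra.mem_toSubmodule, Algebra.adjoin_eq_span, Submonoid.closure_eq] at hf
    refine Submodule.span_induction (p := fun f _ => ∫ x, f x ∂μ = ∫ x, f x ∂ν) ?_ ?_ ?_ ?_ hf
    · exact fun f hf => h f hf
    · simp
    · intro f g _ _ hf hg
      have e : ∀ κ : Measure E, IsFiniteMeasure κ →
          ∫ x, (f + g) x ∂κ = ∫ x, f x ∂κ + ∫ x, g x ∂κ := fun κ _ =>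
        integral_add (f.integrable κ) (g.integrable κ)
      rw [e μ inferInstance, e ν inferInstance, hf, hg]
    · intro c f _ hf
      have e : ∀ κ : Measure E, ∫ x, (c • f) x ∂κ = c * ∫ x, f x ∂κ := fun κ =>
        integral_const_mul c f
      rw [e, e, hf]

/-- Finite measures of mass at most C on a compact space form a compact set. Taking the limit along
an ultrafilter finer than `atTop` replaces the extraction of a subsequence. -/
theorem FiniteMeasure.exists_tendsto_subfilter {E : Type*} [TopologicalSpace E] [CompactSpace E]
    [MeasurableSpace E] [BorelSpace E] [T2Space E] (μ : ℕ → FiniteMeasure E) (C : ℝ≥0)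
    (hC : ∀ n, (μ n).mass ≤ C) :
    ∃ (ν : FiniteMeasure E) (l : Filter ℕ), l.NeBot ∧ l ≤ atTop ∧ Tendsto μ l (𝓝 ν) := by
  have hK := isCompact_setOfPred_finiteMeasure_le_of_compactSpace E C
  have hle : ((hyperfilter ℕ).map μ : Filter (FiniteMeasure E)) ≤
      𝓟 {ν : FiniteMeasure E | ν.mass ≤ C} := by
    rw [le_principal_iff]
    exact Filter.Eventually.of_forall (f := (hyperfilter ℕ : Filter ℕ)) hC
  obtain ⟨ν, -, hν⟩ := hK.ultrafilter_le_nhds ((hyperfilter ℕ).map μ) hle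
  exact ⟨ν, hyperfilter ℕ, inferInstance, Nat.hyperfilter_le_atTop, hν⟩

/-- The shift of a real sequence, as a linear map. -/
def seqShift : Module.End ℝ (ℕ → ℝ) where
  toFun a n := a (n + 1)
  map_add' _ _ := rfl
  map_smul' _ _ := rfl

theorem seqShift_pow_apply (k n : ℕ) (a : ℕ → ℝ) : (seqShift ^ k) a n = a (n + k) := by
  induction k generalizing n with
  | zero => rfl
  | succ k ih =>
    rw [pow_succ', Module.End.mul_apply]
    change (seqShift ^ k) a (n + 1) = _
    rw [ih]
    congr 1
    ring

/-- With S the shift, this is the binomial expansion of 1 = (S + (1 - S))^m. -/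
theorem sum_choose_diff (a : ℕ → ℝ) (m j : ℕ) :
    ∑ i ∈ Finset.range (m + 1), (m.choose i : ℝ) * ((1 - seqShift) ^ (m - i)) a (j + i) = a j := by
  have hc : Commute seqShift (1 - seqShift) := (Commute.one_right _).sub_right (Commute.refl _)
  have h := hc.add_pow m
  rw [add_sub_cancel, one_pow] at h
  have h2 := congrArg (fun T : Module.End ℝ (ℕ → ℝ) => T a j) h
  simp only [Module.End.one_apply] at h2
  rw [h2]
  simp only [LinearMap.sum_apply, Finset.sum_apply]
  refine Finset.sum_congr rfl fun i _ => ?_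
  rw [← (Nat.cast_commute (m.choose i) (seqShift ^ i * (1 - seqShift) ^ (m - i))).eq,
    Module.End.mul_apply, Module.End.mul_apply]
  have : ∀ (c : ℕ) (b : ℕ → ℝ), ((c : Module.End ℝ (ℕ → ℝ)) b) j = c * b j := by
    intro c b
    rw [← nsmul_one c, LinearMap.smul_apply]
    simp
  rw [this, seqShift_pow_apply]

/-- The weights C(N,k) (1 - S)^{N-k} a_k reproduce a_j exactly when integrated against
C(k,j)/C(N,j), a stand-in for (k/N)^j. The identity C(N,k) C(k,j) = C(N,j) C(N-j,k-j) reduces this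
to `sum_choose_diff`, the terms with k < j being zero. -/
theorem sum_choose_choose_diff (a : ℕ → ℝ) (N j : ℕ) (hj : j ≤ N) :
    ∑ k ∈ Finset.range (N + 1), (N.choose k : ℝ) * ((1 - seqShift) ^ (N - k)) a k *
      ((k.choose j : ℝ) / N.choose j) = a j := by
  have hN : (N.choose j : ℝ) ≠ 0 := by exact_mod_cast (Nat.choose_pos hj).ne'
  obtain ⟨m, rfl⟩ := Nat.exists_eq_add_of_le hj
  rw [add_assoc, Finset.sum_range_add]
  rw [Finset.sum_eq_zero, zero_add]
  · rw [← sum_choose_diff a m j]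
    refine Finset.sum_congr rfl fun i hi => ?_
    have hi' : i ≤ m := by simpa [Nat.lt_succ_iff] using hi
    have h1 := Nat.choose_mul (n := j + m) (k := j + i) (s := j) (by omega)
    rw [Nat.add_sub_cancel_left, Nat.add_sub_cancel_left] at h1
    have h2 : ((j + m).choose (j + i) : ℝ) * (j + i).choose j =
        (j + m).choose j * m.choose i := by exact_mod_cast h1
    rw [Nat.add_sub_add_left]
    field_simp
    linear_combination ((1 - seqShift) ^ (m - i)) a (j + i) * h2
  · intro k hk
    rw [Nat.choose_eq_zero_of_lt (Finset.mem_range.1 hk)]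
    simp

/-- The quotient is built from the factors (k - i)/(N - i), each at distance at most i/(N - i) from
k/N, and the errors add up. The bound does not depend on k and vanishes as N → ∞. -/
theorem abs_choose_div_sub_pow_le (N k j : ℕ) (hj : j ≤ N) (hk : k ≤ N) :
    |(k.choose j : ℝ) / N.choose j - ((k : ℝ) / N) ^ j| ≤
      ∑ i ∈ Finset.range j, (i : ℝ) / (N - i) := by
  induction j with
  | zero => simp
  | succ j ih =>
    have hjN : (j : ℝ) < N := by exact_mod_cast hj
    have hN : (0 : ℝ) < N := (Nat.cast_nonneg j).trans_lt hjN
    have hkN : (k : ℝ) ≤ N := by exact_mod_cast hk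
    have hd : (0 : ℝ) < N - j := by linarith
    have hpos : ∀ i, i ≤ N → (0 : ℝ) < N.choose i := fun i hi => by
      exact_mod_cast Nat.choose_pos hi
    have hrec : ∀ n : ℕ, (n.choose (j + 1) : ℝ) * (j + 1) = n.choose j * (n - j) := by
      intro n
      rcases le_or_gt j n with h | h
      · rw [← Nat.cast_sub h]
        exact_mod_cast Nat.choose_succ_right_eq n j
      · rw [Nat.choose_eq_zero_of_lt h, Nat.choose_eq_zero_of_lt (by omega)]
        simp
    set r : ℝ := (k.choose j : ℝ) / N.choose j with hr
    set y : ℝ := (k : ℝ) / N with hy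
    have hr0 : 0 ≤ r := by positivity
    have hr1 : r ≤ 1 := by
      rw [hr, div_le_one (hpos j (by omega))]
      exact_mod_cast Nat.choose_le_choose j hk
    have hy0 : 0 ≤ y := by positivity
    have hy1 : y ≤ 1 := by rw [hy, div_le_one hN]; exact hkN
    have hstep : (k.choose (j + 1) : ℝ) / N.choose (j + 1) = r * ((k - j) / (N - j)) := by
      have h1 := hrec k
      have h2 := hrec N
      have h3 := (hpos (j + 1) hj).ne'
      have h4 := (hpos j (by omega)).ne'
      have h5 : (j : ℝ) + 1 ≠ 0 := by positivity
      rw [hr, div_mul_div_comm, div_eq_div_iff h3 (by positivity), ← h2, ← h1]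
      ring
    have hdiff : |(k - j) / (N - j) - y| ≤ (j : ℝ) / (N - j) := by
      have e : ((k : ℝ) - j) / (N - j) - y = j / (N - j) * (y - 1) := by
        rw [hy]
        field_simp
        ring
      rw [e, abs_mul, abs_of_nonneg (by positivity)]
      have : |y - 1| ≤ 1 := by rw [abs_le]; constructor <;> linarith
      exact mul_le_of_le_one_right (by positivity) this
    rw [hstep, Finset.sum_range_succ]
    have e : r * ((k - j) / (N - j)) - y ^ (j + 1) =
        r * ((k - j) / (N - j) - y) + (r - y ^ j) * y := by ring
    rw [e]
    refine (abs_add_le _ _).trans ?_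
    rw [abs_mul, abs_mul, abs_of_nonneg hr0, abs_of_nonneg hy0]
    have h1 := ih (by omega)
    have h2 : r * |(k - j) / (N - j) - y| ≤ j / (N - j) :=
      (mul_le_of_le_one_left (abs_nonneg _) hr1).trans hdiff
    have h3 : |r - y ^ j| * y ≤ |r - y ^ j| := mul_le_of_le_one_right (abs_nonneg _) hy1
    linarith

/-- **Hausdorff moment theorem**: completely monotone sequences are moment sequences on `[0,1]`. -/
theorem exists_measure_moments_eq (a : ℕ → ℝ)
    (ha : ∀ k n, 0 ≤ ((1 - seqShift : Module.End ℝ (ℕ → ℝ)) ^ k) a n) :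
    ∃ μ : FiniteMeasure I, ∀ n : ℕ, ∫ y : I, (y : ℝ) ^ n ∂(μ : Measure I) = a n := by
  let pt : ℕ → ℕ → I := fun N k => projIcc 0 1 zero_le_one ((k : ℝ) / N)
  let c : ℕ → ℕ → ℝ := fun N k => (N.choose k : ℝ) * ((1 - seqShift) ^ (N - k)) a k
  have hc : ∀ N k, 0 ≤ c N k := fun N k => mul_nonneg (Nat.cast_nonneg _) (ha _ _)
  -- Point masses C(N,k) (1 - S)^{N-k} a_k at k/N: nonnegative by hypothesis, of total mass a 0,
  -- with j-th moments tending to a j.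
  let μ : ℕ → Measure I := fun N =>
    ∑ k ∈ Finset.range (N + 1), ENNReal.ofReal (c N k) • Measure.dirac (pt N k)
  have hfin : ∀ N, IsFiniteMeasure (μ N) := by
    intro N
    refine ⟨?_⟩
    simp [μ, Measure.finsetSum_apply]
  have hint : ∀ N (f : I → ℝ), ∫ y, f y ∂(μ N) =
      ∑ k ∈ Finset.range (N + 1), c N k * f (pt N k) := by
    intro N f
    simp only [μ]
    rw [integral_finsetSum_measure]
    · refine Finset.sum_congr rfl fun k _ => ?_
      rw [integral_smul_measure, integral_dirac, ENNReal.toReal_ofReal (hc N k), smul_eq_mul]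
    · intro k _
      exact (integrable_dirac (by simp)).smul_measure (by simp)
  have hc_sum : ∀ N, ∑ k ∈ Finset.range (N + 1), c N k = a 0 := by
    intro N
    have := sum_choose_choose_diff a N 0 (Nat.zero_le _)
    simpa [c] using this
  let μ' : ℕ → FiniteMeasure I := fun N => ⟨μ N, hfin N⟩
  have ha0 : 0 ≤ a 0 := ha 0 0
  have hmass : ∀ N, (μ' N).mass ≤ (a 0).toNNReal := by
    intro N
    have h1 := hint N (fun _ => 1)
    simp only [mul_one, hc_sum] at h1
    rw [integral_const, smul_eq_mul, mul_one] at h1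
    rw [← NNReal.coe_le_coe, Real.coe_toNNReal _ ha0]
    exact h1.le
  obtain ⟨ν, l, hl, hl', hν⟩ := FiniteMeasure.exists_tendsto_subfilter μ' _ hmass
  refine ⟨ν, fun j => ?_⟩
  have h1 : Tendsto (fun N => ∫ y, ((y : ℝ) ^ j) ∂(μ N)) l
      (𝓝 (∫ y : I, (y : ℝ) ^ j ∂(ν : Measure I))) := by
    let f : I →ᵇ ℝ := BoundedContinuousFunction.mkOfCompact ⟨fun y : I => (y : ℝ) ^ j, by fun_prop⟩
    exact (FiniteMeasure.tendsto_iff_forall_integral_tendsto.1 hν f)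
  refine tendsto_nhds_unique h1 (Tendsto.mono_left ?_ hl')
  have h2 : Tendsto (fun N : ℕ => a 0 * ∑ i ∈ Finset.range j, (i : ℝ) / (N - i)) atTop (𝓝 0) := by
    have : Tendsto (fun N : ℕ => ∑ i ∈ Finset.range j, (i : ℝ) / (N - i)) atTop
        (𝓝 (∑ i ∈ Finset.range j, (0 : ℝ))) := by
      refine tendsto_finsetSum _ fun i _ => ?_
      refine Tendsto.div_atTop tendsto_const_nhds ?_
      exact tendsto_atTop_add_const_right _ _ tendsto_natCast_atTop_atTop
    simpa using this.const_mul (a 0)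
  rw [tendsto_iff_dist_tendsto_zero]
  refine squeeze_zero' (Eventually.of_forall fun _ => dist_nonneg) ?_ h2
  filter_upwards [eventually_ge_atTop j] with N hN
  rw [Real.dist_eq, hint, ← sum_choose_choose_diff a N j hN, ← Finset.sum_sub_distrib,
    ← hc_sum N, Finset.sum_mul]
  refine (Finset.abs_sum_le_sum_abs _ _).trans (Finset.sum_le_sum fun k hk => ?_)
  have hk' : k ≤ N := by simpa [Nat.lt_succ_iff] using hk
  have hpt : ((pt N k : I) : ℝ) = (k : ℝ) / N := by
    simp only [pt]
    rw [coe_projIcc, min_eq_right, max_eq_right (by positivity)]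
    rcases Nat.eq_zero_or_pos N with h | h
    · simp [h]
    · rw [div_le_one (by exact_mod_cast h)]
      exact_mod_cast hk'
  rw [hpt]
  change |c N k * _ - c N k * _| ≤ _
  rw [← mul_sub, abs_mul, abs_of_nonneg (hc N k), abs_sub_comm]
  exact mul_le_mul_of_nonneg_left (abs_choose_div_sub_pow_le N k j hN hk') (hc N k)

end

/-! ### Bernstein's theorem -/

section

open scoped BoundedContinuousFunction unitInterval

/-- Sampling f along an arithmetic progression turns its differences into those of a sequence, as
Hausdorff's theorem requires. -/
theorem one_sub_seqShift_pow_apply (h x : ℝ) (f : ℝ → ℝ) (k n : ℕ) :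
    ((1 - seqShift : Module.End ℝ (ℕ → ℝ)) ^ k) (fun m : ℕ => f (x + m * h)) n =
      (diffOp h)^[k] f (x + n * h) := by
  induction k generalizing f with
  | zero => rfl
  | succ k ih =>
    rw [pow_succ, Module.End.mul_apply, Function.iterate_succ_apply, ← ih]
    refine congrFun (congrArg _ (funext fun m => ?_)) n
    change f (x + m * h) - f (x + ((m + 1 : ℕ) : ℝ) * h) = _
    simp only [diffOp]
    push_cast
    ring_nf

theorem continuousOn_integral_rpow (ν : Measure I) [IsFiniteMeasure ν] :
    ContinuousOn (fun q : ℝ => ∫ y : I, (y : ℝ) ^ q ∂ν) (Ioi 0) := by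
  intro q hq
  refine ContinuousAt.continuousWithinAt ?_
  refine continuousAt_of_dominated (bound := fun _ => 1) ?_ ?_ (integrable_const _) ?_
  · exact Eventually.of_forall fun p =>
      (by fun_prop : Measurable fun y : I => (y : ℝ) ^ p).aestronglyMeasurable
  · filter_upwards [lt_mem_nhds hq] with p hp
    refine ae_of_all _ fun y => ?_
    rw [Real.norm_of_nonneg (Real.rpow_nonneg y.2.1 _)]
    exact Real.rpow_le_one y.2.1 y.2.2 (le_of_lt hp)
  · exact ae_of_all _ fun y => Real.continuousAt_const_rpow' (ne_of_gt hq)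

/-- Representation of a shifted completely monotone function by a finite measure on `[0,1]`. -/
theorem exists_finiteMeasure_rpow {f : ℝ → ℝ} (hf : CompletelyMonotone f)
    (hcont : ContinuousOn f (Ioi 0)) {ε : ℝ} (hε : 0 < ε) :
    ∃ ν : FiniteMeasure I, ∀ q : ℝ, 0 < q → ∫ y : I, (y : ℝ) ^ q ∂(ν : Measure I) = f (ε + q) := by
  -- Sampling with mesh 1/m!: every positive rational becomes a multiple of the mesh once m is at
  -- least its denominator.
  have h1 : ∀ m : ℕ, ∃ κ : FiniteMeasure I, ∀ n : ℕ,
      ∫ y : I, (y : ℝ) ^ n ∂(κ : Measure I) = f (ε + n * ((m.factorial : ℝ))⁻¹) := by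
    intro m
    refine exists_measure_moments_eq _ fun k n => ?_
    rw [one_sub_seqShift_pow_apply]
    exact hf _ (by positivity) k _ (by positivity)
  choose κ hκ using h1
  have hmeas : ∀ m : ℕ, Measurable (fun y : I => y ^ m.factorial) := fun m => by fun_prop
  -- After the push-forward by y ↦ y^{m!}, the moment of order n/m! is the n-th moment of `κ m`,
  -- that is f(ε + n/m!).
  let μ : ℕ → FiniteMeasure I := fun m => (κ m).map (fun y : I => y ^ m.factorial)
  have hμint : ∀ m (q : ℝ), ∫ y : I, (y : ℝ) ^ q ∂(μ m : Measure I) =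
      ∫ y : I, ((y : ℝ) ^ m.factorial) ^ q ∂(κ m : Measure I) := by
    intro m q
    simp only [μ, FiniteMeasure.toMeasure_map]
    rw [integral_map (hmeas m).aemeasurable
      (by fun_prop : Measurable fun y : I => (y : ℝ) ^ q).aestronglyMeasurable]
    simp
  have hmass : ∀ m, (μ m).mass ≤ (f ε).toNNReal := by
    intro m
    have h2 := hκ m 0
    have h3 : (μ m).mass = (κ m).mass := by
      simp only [FiniteMeasure.mass, μ]
      rw [FiniteMeasure.map_apply _ (hmeas m) MeasurableSet.univ]
      rfl
    simp only [pow_zero, integral_const, smul_eq_mul, mul_one, Nat.cast_zero, zero_mul,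
      add_zero] at h2
    rw [h3, ← NNReal.coe_le_coe, ← h2, Real.coe_toNNReal _ measureReal_nonneg]
    rfl
  obtain ⟨ν, l, hl, hl', hν⟩ := FiniteMeasure.exists_tendsto_subfilter μ _ hmass
  refine ⟨ν, ?_⟩
  have hcν : ContinuousOn (fun q : ℝ => ∫ y : I, (y : ℝ) ^ q ∂(ν : Measure I)) (Ioi 0) :=
    continuousOn_integral_rpow _
  have hrat : ∀ q : ℚ, 0 < q → ∫ y : I, (y : ℝ) ^ (q : ℝ) ∂(ν : Measure I) = f (ε + q) := by
    intro q hq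
    have hq' : (0 : ℝ) < q := by exact_mod_cast hq
    let g : I →ᵇ ℝ := BoundedContinuousFunction.mkOfCompact
      ⟨fun y : I => (y : ℝ) ^ (q : ℝ), by
        exact (Real.continuous_rpow_const hq'.le).comp continuous_subtype_val⟩
    have h4 := FiniteMeasure.tendsto_iff_forall_integral_tendsto.1 hν g
    refine tendsto_nhds_unique h4 (Tendsto.congr' ?_ tendsto_const_nhds)
    refine hl' ?_
    filter_upwards [eventually_ge_atTop q.den] with m hm
    change _ = ∫ y : I, (y : ℝ) ^ (q : ℝ) ∂(μ m : Measure I)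
    rw [hμint]
    obtain ⟨c, hc⟩ := Nat.dvd_factorial q.den_pos hm
    have hnum : (q.num.toNat : ℝ) = q.num := by
      have : ((q.num.toNat : ℤ) : ℝ) = q.num := by
        rw [Int.toNat_of_nonneg (Rat.num_nonneg.2 hq.le)]
      exact_mod_cast this
    have hden : (q.den : ℝ) ≠ 0 := by exact_mod_cast q.den_pos.ne'
    have hqe : (q : ℝ) = q.num / q.den := by exact_mod_cast (Rat.num_div_den q).symm
    have hc0 : (c : ℝ) ≠ 0 := by
      intro h0
      have : c = 0 := by exact_mod_cast h0
      simp [this, Nat.factorial_ne_zero] at hc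
    have h5 := hκ m (c * q.num.toNat)
    have e : ((c * q.num.toNat : ℕ) : ℝ) * ((m.factorial : ℝ))⁻¹ = q := by
      rw [hc, hqe]
      push_cast
      rw [hnum]
      field_simp
    rw [e] at h5
    rw [← h5]
    refine integral_congr_ae (ae_of_all _ fun y => ?_)
    change (y : ℝ) ^ (c * q.num.toNat) = ((y : ℝ) ^ m.factorial) ^ (q : ℝ)
    rw [← Real.rpow_natCast, ← Real.rpow_natCast, ← Real.rpow_mul y.2.1]
    congr 1
    rw [hc, hqe]
    push_cast
    rw [hnum]
    field_simp
  -- Real exponents follow from rational ones decreasing to q, both sides being continuous.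
  intro q hq
  obtain ⟨u, -, hu, hut⟩ := Real.exists_seq_rat_strictAnti_tendsto q
  have h6 : Tendsto (fun n => ((u n : ℚ) : ℝ)) atTop (𝓝[Ioi 0] q) :=
    tendsto_nhdsWithin_iff.2 ⟨hut, Eventually.of_forall fun n => hq.trans (hu n)⟩
  have h7 := (hcν q hq).tendsto.comp h6
  have h8 : Tendsto (fun n => f (ε + (u n : ℚ))) atTop (𝓝 (f (ε + q))) := by
    refine ((hcont (ε + q) (by simp only [mem_Ioi]; positivity)).tendsto).comp ?_
    refine tendsto_nhdsWithin_iff.2 ⟨hut.const_add ε, Eventually.of_forall fun n => ?_⟩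
    have := hu n
    simp only [mem_Ioi]
    linarith
  refine tendsto_nhds_unique (h7.congr fun n => ?_) h8
  have : (0 : ℝ) < u n := hq.trans (hu n)
  exact hrat _ (by exact_mod_cast this)

/-- Finite measures on `[0,1]` are determined by their moments. -/
theorem unitInterval_measure_ext {μ ν : Measure I} [IsFiniteMeasure μ] [IsFiniteMeasure ν]
    (h : ∀ n : ℕ, ∫ y : I, (y : ℝ) ^ n ∂μ = ∫ y : I, (y : ℝ) ^ n ∂ν) : μ = ν := by
  let e : I →ᵇ ℝ := BoundedContinuousFunction.mkOfCompact ⟨fun y : I => (y : ℝ), by fun_prop⟩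
  refine Measure.ext_of_submonoid (Submonoid.powers e) (fun x y hxy => ⟨e, ⟨1, pow_one e⟩, ?_⟩) ?_
  · exact fun h => hxy (Subtype.ext h)
  · rintro _ ⟨n, rfl⟩
    exact h n

/-- **Bernstein's theorem**: a continuous completely monotone function on `(0, ∞)` is a Laplace
transform. -/
theorem CompletelyMonotone.exists_measure {f : ℝ → ℝ} (hf : CompletelyMonotone f)
    (hcont : ContinuousOn f (Ioi 0)) :
    ∃ ν : Measure ℝ, SFinite ν ∧ ν (Iio 0) = 0 ∧ ∀ w : ℝ, 0 < w →
      ENNReal.ofReal (f w) = ∫⁻ x, ENNReal.ofReal (Real.exp (-(w * x))) ∂ν := by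
  obtain ⟨ν₁, hν₁⟩ := exists_finiteMeasure_rpow hf hcont zero_lt_one
  have hmono : ∀ p : ℝ, Measurable (fun y : I => ENNReal.ofReal ((y : ℝ) ^ p)) := fun p => by
    fun_prop
  have hlint : ∀ (κ : Measure I), IsFiniteMeasure κ → ∀ p : ℝ, 0 < p →
      ∫⁻ y : I, ENNReal.ofReal ((y : ℝ) ^ p) ∂κ = ENNReal.ofReal (∫ y : I, (y : ℝ) ^ p ∂κ) := by
    intro κ hκ p hp
    rw [ofReal_integral_eq_lintegral_ofReal]
    · refine Integrable.of_bound (C := 1)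
        (by fun_prop : Measurable fun y : I => (y : ℝ) ^ p).aestronglyMeasurable (ae_of_all _ fun y => ?_)
      rw [Real.norm_of_nonneg (Real.rpow_nonneg y.2.1 _)]
      exact Real.rpow_le_one y.2.1 y.2.2 hp.le
    · exact ae_of_all _ fun y => Real.rpow_nonneg y.2.1 _
  have hS : MeasurableSet {y : I | 0 < (y : ℝ)} := measurableSet_lt (by fun_prop) (by fun_prop)
  -- `ν₁` represents f(1 + ·), and dividing by y should undo the shift, even for w ≤ 1. To see this,
  -- it is compared with the measure representing f(ε + ·) for some ε < w.
  have key : ∀ w : ℝ, 0 < w → ENNReal.ofReal (f w) =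
      ∫⁻ y in {y : I | 0 < (y : ℝ)}, ENNReal.ofReal ((y : ℝ) ^ (w - 1)) ∂(ν₁ : Measure I) := by
    intro w hw
    set ε : ℝ := min 1 w / 2 with hε
    have hmin : 0 < min 1 w := lt_min one_pos hw
    have hε0 : 0 < ε := by positivity
    have hε1 : ε < 1 := by have := min_le_left 1 w; rw [hε]; linarith
    have hεw : ε < w := by have := min_le_right 1 w; rw [hε]; linarith
    obtain ⟨ν, hν⟩ := exists_finiteMeasure_rpow hf hcont hε0
    have hfin : ∀ (κ : FiniteMeasure I) (p : ℝ), 0 < p → IsFiniteMeasure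
        ((κ : Measure I).withDensity fun y => ENNReal.ofReal ((y : ℝ) ^ p)) := by
      intro κ p hp
      refine isFiniteMeasure_withDensity ?_
      rw [hlint _ inferInstance p hp]
      exact ENNReal.ofReal_ne_top
    have := hfin ν₁ 1 one_pos
    have := hfin ν (2 - ε) (by linarith)
    have hmom : ∀ (κ : FiniteMeasure I) (p : ℝ), 0 < p → ∀ n : ℕ,
        ∫ y : I, (y : ℝ) ^ n ∂((κ : Measure I).withDensity fun y => ENNReal.ofReal ((y : ℝ) ^ p)) =
          ∫ y : I, (y : ℝ) ^ (p + n) ∂(κ : Measure I) := by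
      intro κ p hp n
      rw [integral_withDensity_eq_integral_toReal_smul (hmono p) (ae_of_all _ fun _ => by simp)]
      refine integral_congr_ae (ae_of_all _ fun y => ?_)
      simp only [smul_eq_mul]
      rw [ENNReal.toReal_ofReal (Real.rpow_nonneg y.2.1 _), ← Real.rpow_natCast,
        ← Real.rpow_add_of_nonneg y.2.1 hp.le (Nat.cast_nonneg n)]
    -- The measures y ν₁ and y^{2-ε} ν both have n-th moment f(2 + n), so they coincide.
    have heq : (ν₁ : Measure I).withDensity (fun y => ENNReal.ofReal ((y : ℝ) ^ (1 : ℝ))) =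
        (ν : Measure I).withDensity fun y => ENNReal.ofReal ((y : ℝ) ^ (2 - ε)) := by
      refine unitInterval_measure_ext fun n => ?_
      rw [hmom ν₁ 1 one_pos, hmom ν (2 - ε) (by linarith), hν₁ _ (by positivity),
        hν _ (by have : (0 : ℝ) ≤ n := Nat.cast_nonneg n; linarith)]
      congr 1
      ring
    have hsplit : ∀ (κ : FiniteMeasure I) (p q : ℝ),
        ∫⁻ y in {y : I | 0 < (y : ℝ)}, ENNReal.ofReal ((y : ℝ) ^ q)
          ∂((κ : Measure I).withDensity fun y => ENNReal.ofReal ((y : ℝ) ^ p)) =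
        ∫⁻ y in {y : I | 0 < (y : ℝ)}, ENNReal.ofReal ((y : ℝ) ^ (p + q)) ∂(κ : Measure I) := by
      intro κ p q
      rw [restrict_withDensity hS, lintegral_withDensity_eq_lintegral_mul _ (hmono p) (hmono q)]
      refine setLIntegral_congr_fun hS fun y hy => ?_
      simp only [Pi.mul_apply]
      rw [← ENNReal.ofReal_mul (Real.rpow_nonneg y.2.1 _), ← Real.rpow_add hy]
    have h2 := hsplit ν₁ 1 (w - 2)
    rw [heq, hsplit] at h2
    have e1 : (1 : ℝ) + (w - 2) = w - 1 := by ring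
    have e2 : 2 - ε + (w - 2) = w - ε := by ring
    rw [e1, e2] at h2
    rw [← h2]
    have h3 : ∫⁻ y in {y : I | 0 < (y : ℝ)}, ENNReal.ofReal ((y : ℝ) ^ (w - ε)) ∂(ν : Measure I) =
        ∫⁻ y : I, ENNReal.ofReal ((y : ℝ) ^ (w - ε)) ∂(ν : Measure I) := by
      refine setLIntegral_eq_of_support_subset fun y hy => ?_
      by_contra hy0
      have : (y : ℝ) = 0 := le_antisymm (not_lt.1 hy0) y.2.1
      simp [this, Real.zero_rpow (by linarith : w - ε ≠ 0)] at hy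
    rw [h3, hlint _ inferInstance _ (by linarith), hν _ (by linarith)]
    congr 2
    ring
  -- Undo the shift with the density 1/y, then set y = e^{-x}. The point y = 0 would correspond to x
  -- = ∞ and does not contribute.
  let κ : Measure I := ((ν₁ : Measure I).restrict {y : I | 0 < (y : ℝ)}).withDensity
    fun y => ENNReal.ofReal ((y : ℝ) ^ (-1 : ℝ))
  have hlog : Measurable (fun y : I => -Real.log (y : ℝ)) := by fun_prop
  refine ⟨Measure.map (fun y : I => -Real.log (y : ℝ)) κ, ?_, ?_, ?_⟩
  · infer_instance
  · rw [Measure.map_apply hlog measurableSet_Iio]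
    have : (fun y : I => -Real.log (y : ℝ)) ⁻¹' Iio 0 = ∅ := by
      ext y
      have := Real.log_nonpos y.2.1 y.2.2
      simp only [mem_preimage, mem_Iio, mem_empty_iff_false, iff_false, not_lt]
      linarith
    rw [this, measure_empty]
  · intro w hw
    rw [key w hw, lintegral_map (by fun_prop) hlog,
      lintegral_withDensity_eq_lintegral_mul _ (hmono _) (by fun_prop)]
    refine setLIntegral_congr_fun hS fun y hy => ?_
    simp only [Pi.mul_apply]
    rw [← ENNReal.ofReal_mul (Real.rpow_nonneg y.2.1 _)]
    congr 1
    rw [show -(w * -Real.log (y : ℝ)) = Real.log y * w by ring, ← Real.rpow_def_of_pos hy,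
      ← Real.rpow_add hy]
    congr 1
    ring

end

/-! ### The exponential e^{-qx} on [0, ∞] -/

section

open scoped BoundedContinuousFunction

theorem expNeg_top (q : ℝ) : expNeg q ∞ = 0 := if_pos rfl

theorem expNeg_of_ne_top (q : ℝ) {x : ℝ≥0∞} (hx : x ≠ ∞) :
    expNeg q x = Real.exp (-(q * x.toReal)) := if_neg hx

theorem expNeg_zero_right (q : ℝ) : expNeg q 0 = 1 := by simp [expNeg]

theorem expNeg_nonneg (q : ℝ) (x : ℝ≥0∞) : 0 ≤ expNeg q x := by
  unfold expNeg
  split_ifs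
  · exact le_rfl
  · exact (Real.exp_pos _).le

theorem expNeg_le_one {q : ℝ} (hq : 0 ≤ q) (x : ℝ≥0∞) : expNeg q x ≤ 1 := by
  unfold expNeg
  split_ifs
  · exact zero_le_one
  · exact Real.exp_le_one_iff.2 (by have := mul_nonneg hq x.toReal_nonneg; linarith)

theorem expNeg_add_right (q : ℝ) (x y : ℝ≥0∞) : expNeg q (x + y) = expNeg q x * expNeg q y := by
  by_cases hx : x = ∞
  · simp [hx, expNeg_top]
  by_cases hy : y = ∞
  · simp [hy, expNeg_top]
  rw [expNeg_of_ne_top _ hx, expNeg_of_ne_top _ hy, expNeg_of_ne_top _ (ENNReal.add_ne_top.2 ⟨hx, hy⟩),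
    ENNReal.toReal_add hx hy, ← Real.exp_add]
  ring_nf

theorem expNeg_sum {ι : Type*} (q : ℝ) (s : Finset ι) (f : ι → ℝ≥0∞) :
    expNeg q (∑ i ∈ s, f i) = ∏ i ∈ s, expNeg q (f i) := by
  classical
  induction s using Finset.induction_on with
  | empty => simp [expNeg_zero_right]
  | insert i s hi ih => rw [Finset.sum_insert hi, Finset.prod_insert hi, expNeg_add_right, ih]

theorem expNeg_natCast_mul (q : ℝ) (n : ℕ) (x : ℝ≥0∞) : expNeg q (n * x) = expNeg q x ^ n := by
  have := expNeg_sum q (Finset.range n) (fun _ => x)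
  simpa using this

theorem expNeg_ofReal_mul {q a : ℝ} (ha : 0 < a) (x : ℝ≥0∞) :
    expNeg q (ENNReal.ofReal a * x) = expNeg (q * a) x := by
  by_cases hx : x = ∞
  · simp [hx, expNeg_top, ENNReal.mul_top, ha]
  · rw [expNeg_of_ne_top _ hx, expNeg_of_ne_top _ (ENNReal.mul_ne_top ENNReal.ofReal_ne_top hx),
      ENNReal.toReal_mul, ENNReal.toReal_ofReal ha.le, mul_assoc]

theorem expNeg_antitone {q : ℝ} (hq : 0 ≤ q) : Antitone (expNeg q) := by
  intro x y hxy
  by_cases hy : y = ∞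
  · rw [hy, expNeg_top]
    exact expNeg_nonneg _ _
  · have hx : x ≠ ∞ := ne_top_of_le_ne_top hy hxy
    rw [expNeg_of_ne_top _ hx, expNeg_of_ne_top _ hy]
    gcongr

@[fun_prop]
theorem measurable_expNeg (q : ℝ) : Measurable (expNeg q) := by
  unfold expNeg
  exact Measurable.ite (measurableSet_singleton ∞) measurable_const (by fun_prop)

/-- Continuity at ∞ is the point, and it fails for q = 0: for q > 0 the exponential is a continuous
function on the compact space [0, ∞]. -/
theorem continuous_expNeg {q : ℝ} (hq : 0 < q) : Continuous (expNeg q) := by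
  rw [continuous_iff_continuousAt]
  intro x
  by_cases hx : x = ∞
  · subst hx
    unfold ContinuousAt
    rw [expNeg_top]
    refine tendsto_order.2 ⟨fun a ha => Eventually.of_forall fun y =>
      ha.trans_le (expNeg_nonneg _ _), fun a ha => ?_⟩
    have h1 : Tendsto (fun r : ℝ => Real.exp (-(q * r))) atTop (𝓝 0) :=
      Real.tendsto_exp_neg_atTop_nhds_zero.comp (tendsto_id.const_mul_atTop hq)
    obtain ⟨R, hR0, hR⟩ := ((eventually_ge_atTop 0).and (h1.eventually (gt_mem_nhds ha))).exists
    filter_upwards [lt_mem_nhds (ENNReal.ofReal_lt_top (r := R))] with y hy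
    refine (expNeg_antitone hq.le hy.le).trans_lt ?_
    rwa [expNeg_of_ne_top _ ENNReal.ofReal_ne_top, ENNReal.toReal_ofReal hR0]
  · have h1 : ContinuousAt (fun y : ℝ≥0∞ => Real.exp (-(q * y.toReal))) x :=
      Real.continuous_exp.continuousAt.comp
        ((ENNReal.continuousAt_toReal hx).const_mul q).neg
    refine h1.congr ?_
    filter_upwards [isOpen_ne.mem_nhds hx] with y hy
    exact (expNeg_of_ne_top q hy).symm

theorem expNeg_injective {q : ℝ} (hq : 0 < q) : Function.Injective (expNeg q) := by
  intro x y hxy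
  by_cases hx : x = ∞ <;> by_cases hy : y = ∞
  · rw [hx, hy]
  · rw [hx, expNeg_top, expNeg_of_ne_top _ hy] at hxy
    exact absurd hxy.symm (Real.exp_pos _).ne'
  · rw [hy, expNeg_top, expNeg_of_ne_top _ hx] at hxy
    exact absurd hxy (Real.exp_pos _).ne'
  · rw [expNeg_of_ne_top _ hx, expNeg_of_ne_top _ hy] at hxy
    have h := Real.exp_injective hxy
    have h2 : x.toReal = y.toReal := by
      have : q * x.toReal = q * y.toReal := by linarith
      exact mul_left_cancel₀ hq.ne' this
    exact (ENNReal.toReal_eq_toReal_iff' hx hy).1 h2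

theorem integrable_expNeg {Ω : Type*} [MeasurableSpace Ω] {μ : Measure Ω} [IsFiniteMeasure μ]
    {q : ℝ} (hq : 0 ≤ q) {X : Ω → ℝ≥0∞} (hX : Measurable X) :
    Integrable (fun ω => expNeg q (X ω)) μ :=
  Integrable.of_bound (C := 1) ((measurable_expNeg q).comp hX).aestronglyMeasurable (ae_of_all _ fun ω => by
    rw [Real.norm_of_nonneg (expNeg_nonneg _ _)]
    exact expNeg_le_one hq _)

/-- The unit exponential as a bounded continuous function on `[0, ∞]`. -/
noncomputable def expNegBCF : ℝ≥0∞ →ᵇ ℝ :=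
  BoundedContinuousFunction.mkOfCompact ⟨expNeg 1, continuous_expNeg one_pos⟩

/-- Finite measures on `[0, ∞]` are determined by the Laplace transform at integers. -/
theorem ennreal_measure_ext {μ ν : Measure ℝ≥0∞} [IsFiniteMeasure μ] [IsFiniteMeasure ν]
    (h : ∀ n : ℕ, ∫ x, expNeg 1 x ^ n ∂μ = ∫ x, expNeg 1 x ^ n ∂ν) : μ = ν := by
  refine Measure.ext_of_submonoid (Submonoid.powers expNegBCF)
    (fun x y hxy => ⟨expNegBCF, ⟨1, pow_one _⟩, fun h => hxy (expNeg_injective one_pos h)⟩) ?_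
  rintro _ ⟨n, rfl⟩
  exact h n

/-! ### Poisson point processes -/

section PoissonConfigurations

variable {E : Type*}

/-- Sum of the values of `f` over a finite configuration. -/
noncomputable def configSum (f : E → ℝ≥0∞) (c : Σ k : ℕ, Fin k → E) : ℝ≥0∞ := ∑ i, f (c.2 i)

/-- Sum of the values of `f` over a countable family of finite configurations. -/
noncomputable def poissonSum (f : E → ℝ≥0∞) (ω : ℕ → Σ k : ℕ, Fin k → E) : ℝ≥0∞ :=
  ∑' j, configSum f (ω j)

theorem poissonSum_add (f g : E → ℝ≥0∞) (ω) :
    poissonSum (fun x => f x + g x) ω = poissonSum f ω + poissonSum g ω := by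
  simp only [poissonSum, configSum, Finset.sum_add_distrib]
  exact ENNReal.tsum_add

theorem poissonSum_const_mul (a : ℝ≥0∞) (f : E → ℝ≥0∞) (ω) :
    poissonSum (fun x => a * f x) ω = a * poissonSum f ω := by
  simp only [poissonSum, configSum, ← Finset.mul_sum]
  exact ENNReal.tsum_mul_left

theorem poissonSum_sum {ι : Type*} (s : Finset ι) (f : ι → E → ℝ≥0∞) (ω) :
    poissonSum (fun x => ∑ i ∈ s, f i x) ω = ∑ i ∈ s, poissonSum (f i) ω := by
  classical
  induction s using Finset.induction_on with
  | empty => simp [poissonSum, configSum]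
  | insert i s hi ih => simp only [Finset.sum_insert hi, poissonSum_add, ih]

theorem poissonSum_mono {f g : E → ℝ≥0∞} (h : ∀ x, f x ≤ g x) (ω) :
    poissonSum f ω ≤ poissonSum g ω :=
  ENNReal.tsum_le_tsum fun _ => Finset.sum_le_sum fun _ _ => h _

variable [MeasurableSpace E]

theorem measurable_of_sigma {β : ℕ → Type*} [∀ k, MeasurableSpace (β k)] {γ : Type*}
    [MeasurableSpace γ] {f : (Σ k, β k) → γ} (hf : ∀ k, Measurable fun b : β k => f ⟨k, b⟩) :
    Measurable f := by
  intro s hs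
  rw [Sigma.instMeasurableSpace, MeasurableSpace.measurableSet_iInf]
  exact fun k => hf k hs

theorem measurable_sigmaMk {β : ℕ → Type*} [∀ k, MeasurableSpace (β k)] (k : ℕ) :
    Measurable (Sigma.mk k : β k → Σ k, β k) := by
  intro s hs
  rw [Sigma.instMeasurableSpace, MeasurableSpace.measurableSet_iInf] at hs
  exact hs k

theorem measurable_configSum {f : E → ℝ≥0∞} (hf : Measurable f) : Measurable (configSum f) :=
  measurable_of_sigma fun k => by
    have h : ∀ i : Fin k, Measurable fun b : Fin k → E => f (b i) := fun i => by fun_prop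
    exact Finset.measurable_sum Finset.univ fun i _ => h i

/-- The law of a Poisson configuration with finite intensity measure. -/
noncomputable def poissonLaw (m : Measure E) : Measure (Σ k : ℕ, Fin k → E) :=
  Measure.sum fun k : ℕ =>
    ENNReal.ofReal (Real.exp (-(m univ).toReal) / k.factorial) •
      (Measure.pi fun _ : Fin k => m).map
        (fun c => (⟨k, c⟩ : Σ k : ℕ, Fin k → E))

theorem poissonLaw_univ (m : Measure E) [IsFiniteMeasure m] : poissonLaw m univ = 1 := by
  set r : ℝ := (m univ).toReal with hr
  have hr0 : 0 ≤ r := ENNReal.toReal_nonneg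
  have hm : m univ = ENNReal.ofReal r := (ENNReal.ofReal_toReal (measure_ne_top _ _)).symm
  have h1 : ∀ k : ℕ, (ENNReal.ofReal (Real.exp (-r) / k.factorial) •
      (Measure.pi fun _ : Fin k => m).map
        (fun c => (⟨k, c⟩ : Σ k : ℕ, Fin k → E))) univ =
      ENNReal.ofReal (Real.exp (-r) * (r ^ k / k.factorial)) := by
    intro k
    rw [Measure.smul_apply, Measure.map_apply (measurable_sigmaMk (β := fun k => Fin k → E) k) MeasurableSet.univ,
      preimage_univ, Measure.pi_univ, smul_eq_mul]
    simp only [hm, Finset.prod_const, Finset.card_univ, Fintype.card_fin]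
    rw [← ENNReal.ofReal_pow hr0, ← ENNReal.ofReal_mul (by positivity)]
    congr 1
    ring
  have h2 : HasSum (fun k : ℕ => Real.exp (-r) * (r ^ k / k.factorial)) 1 := by
    have := (NormedSpace.expSeries_div_hasSum_exp (𝔸 := ℝ) r).mul_left (Real.exp (-r))
    rwa [← Real.exp_eq_exp_ℝ, ← Real.exp_add, neg_add_cancel, Real.exp_zero] at this
  rw [poissonLaw, Measure.sum_apply _ MeasurableSet.univ]
  simp only [← hr, h1]
  rw [← ENNReal.ofReal_tsum_of_nonneg (fun k => by positivity) h2.summable, h2.tsum_eq,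
    ENNReal.ofReal_one]

instance (m : Measure E) [IsFiniteMeasure m] : IsProbabilityMeasure (poissonLaw m) :=
  ⟨poissonLaw_univ m⟩

/-- With r the mass of m and a = ∫ e^{-f} dm, configurations of k points contribute e^{-r} a^k / k!,
and these sum to e^{-(r-a)}, where r - a = ∫ (1 - e^{-f}) dm. Keeping the exponent in [0, ∞] allows
the passage to s-finite intensities. -/
theorem integral_poissonLaw (m : Measure E) [IsFiniteMeasure m] {f : E → ℝ≥0∞}
    (hf : Measurable f) :
    ∫ c, expNeg 1 (configSum f c) ∂(poissonLaw m) =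
      expNeg 1 (∫⁻ x, ENNReal.ofReal (1 - expNeg 1 (f x)) ∂m) := by
  have hI : Integrable (fun c => expNeg 1 (configSum f c)) (poissonLaw m) :=
    integrable_expNeg zero_le_one (measurable_configSum hf)
  have hfi : Integrable (fun x => expNeg 1 (f x)) m := integrable_expNeg zero_le_one hf
  have hmc : Measurable (fun c => expNeg 1 (configSum f c)) :=
    (measurable_expNeg 1).comp (measurable_configSum hf)
  set a : ℝ := ∫ x, expNeg 1 (f x) ∂m with ha
  set r : ℝ := (m univ).toReal with hr
  have h1 : ∀ k : ℕ, ∫ c, expNeg 1 (configSum f c)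
      ∂(ENNReal.ofReal (Real.exp (-r) / k.factorial) •
      (Measure.pi fun _ : Fin k => m).map
        (fun c => (⟨k, c⟩ : Σ k : ℕ, Fin k → E))) = Real.exp (-r) * (a ^ k / k.factorial) := by
    intro k
    rw [integral_smul_measure, ENNReal.toReal_ofReal (by positivity),
      integral_map (measurable_sigmaMk (β := fun k => Fin k → E) k).aemeasurable
        (hmc.aestronglyMeasurable)]
    simp only [configSum, expNeg_sum]
    rw [integral_fintype_prod_eq_pow (fun x => expNeg 1 (f x)), Fintype.card_fin, smul_eq_mul, ← ha]
    ring
  have h2 : HasSum (fun k : ℕ => Real.exp (-r) * (a ^ k / k.factorial))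
      (Real.exp (-r) * Real.exp a) := by
    have := (NormedSpace.expSeries_div_hasSum_exp (𝔸 := ℝ) a).mul_left (Real.exp (-r))
    rwa [← Real.exp_eq_exp_ℝ] at this
  have h3 := hasSum_integral_measure hI
  rw [← hr] at h3
  simp only [h1] at h3
  rw [show ∫ c, expNeg 1 (configSum f c) ∂(poissonLaw m) = _ from h3.unique h2, ← Real.exp_add]
  have h4 : ∫⁻ x, ENNReal.ofReal (1 - expNeg 1 (f x)) ∂m = ENNReal.ofReal (r - a) := by
    rw [← ofReal_integral_eq_lintegral_ofReal (f := fun x => 1 - expNeg 1 (f x))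
      ((integrable_const _).sub hfi)
      (ae_of_all _ fun x => sub_nonneg.2 (expNeg_le_one zero_le_one _)),
      integral_sub (integrable_const _) hfi, integral_const, smul_eq_mul, mul_one]
    rfl
  have h5 : 0 ≤ r - a := by
    have : a ≤ ∫ _, (1 : ℝ) ∂m :=
      integral_mono hfi (integrable_const _) fun x => expNeg_le_one zero_le_one _
    rw [integral_const, smul_eq_mul, mul_one] at this
    simp only [Measure.real] at this
    linarith
  rw [h4, expNeg_of_ne_top _ ENNReal.ofReal_ne_top, ENNReal.toReal_ofReal h5]
  congr 1
  ring

theorem measurable_poissonSum {f : E → ℝ≥0∞} (hf : Measurable f) : Measurable (poissonSum f) :=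
  Measurable.tsum fun j => (measurable_configSum hf).comp (measurable_pi_apply j)

/-- The law of a Poisson point process with `s`-finite intensity measure. -/
noncomputable def poissonProcessLaw (m : Measure E) [SFinite m] :
    Measure (ℕ → Σ k : ℕ, Fin k → E) :=
  Measure.infinitePi fun j => poissonLaw (sfiniteSeq m j)

instance (m : Measure E) [SFinite m] : IsProbabilityMeasure (poissonProcessLaw m) := by
  unfold poissonProcessLaw
  infer_instance

/-- The Laplace functional of a Poisson point process. -/
theorem integral_poissonProcessLaw (m : Measure E) [SFinite m] {f : E → ℝ≥0∞}
    (hf : Measurable f) :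
    ∫ ω, expNeg 1 (poissonSum f ω) ∂(poissonProcessLaw m) =
      expNeg 1 (∫⁻ x, ENNReal.ofReal (1 - expNeg 1 (f x)) ∂m) := by
  have hcont := continuous_expNeg one_pos
  -- Finitely many independent configurations multiply. The limit n → ∞ then uses continuity on all
  -- of [0, ∞], so infinite sums need no separate treatment.
  have hpart : ∀ n : ℕ, ∫ ω, expNeg 1 (∑ j ∈ Finset.range n, configSum f (ω j))
      ∂(poissonProcessLaw m) =
      expNeg 1 (∑ j ∈ Finset.range n,
        ∫⁻ x, ENNReal.ofReal (1 - expNeg 1 (f x)) ∂(sfiniteSeq m j)) := by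
    intro n
    have e : ∀ ω : ℕ → Σ k : ℕ, Fin k → E,
        expNeg 1 (∑ j ∈ Finset.range n, configSum f (ω j)) =
        (fun y : (Π j : Finset.range n, Σ k : ℕ, Fin k → E) =>
          ∏ j, expNeg 1 (configSum f (y j))) ((Finset.range n).restrict ω) := by
      intro ω
      rw [expNeg_sum]
      exact (Finset.prod_coe_sort (Finset.range n) fun j => expNeg 1 (configSum f (ω j))).symm
    rw [integral_congr_ae (ae_of_all _ e)]
    have hm : Measurable (fun y : (Π j : Finset.range n, Σ k : ℕ, Fin k → E) =>
          ∏ j, expNeg 1 (configSum f (y j))) := by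
      refine Finset.measurable_prod _ fun j _ => ?_
      exact (measurable_expNeg 1).comp ((measurable_configSum hf).comp (measurable_pi_apply j))
    rw [poissonProcessLaw, integral_restrict_infinitePi
      (μ := fun j => poissonLaw (sfiniteSeq m j)) hm.aestronglyMeasurable,
      integral_fintype_prod_eq_prod (fun _ c => expNeg 1 (configSum f c)), expNeg_sum]
    simp only [integral_poissonLaw _ hf]
    exact Finset.prod_coe_sort (Finset.range n) fun j =>
      expNeg 1 (∫⁻ x, ENNReal.ofReal (1 - expNeg 1 (f x)) ∂(sfiniteSeq m j))
  have h1 : Tendsto (fun n : ℕ => ∫ ω, expNeg 1 (∑ j ∈ Finset.range n, configSum f (ω j))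
      ∂(poissonProcessLaw m)) atTop (𝓝 (∫ ω, expNeg 1 (poissonSum f ω) ∂(poissonProcessLaw m))) := by
    refine tendsto_integral_of_dominated_convergence (fun _ => 1) (fun n => ?_)
      (integrable_const _) (fun n => ae_of_all _ fun ω => ?_) (ae_of_all _ fun ω => ?_)
    · refine (Measurable.comp (measurable_expNeg 1) ?_).aestronglyMeasurable
      exact Finset.measurable_sum _ fun j _ => (measurable_configSum hf).comp (measurable_pi_apply j)
    · rw [Real.norm_of_nonneg (expNeg_nonneg _ _)]
      exact expNeg_le_one zero_le_one _
    · exact (hcont.tendsto _).comp (ENNReal.tendsto_nat_tsum _)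
  have h2 : Tendsto (fun n : ℕ => expNeg 1 (∑ j ∈ Finset.range n,
        ∫⁻ x, ENNReal.ofReal (1 - expNeg 1 (f x)) ∂(sfiniteSeq m j))) atTop
      (𝓝 (expNeg 1 (∫⁻ x, ENNReal.ofReal (1 - expNeg 1 (f x)) ∂m))) := by
    have e : ∫⁻ x, ENNReal.ofReal (1 - expNeg 1 (f x)) ∂m =
        ∑' j, ∫⁻ x, ENNReal.ofReal (1 - expNeg 1 (f x)) ∂(sfiniteSeq m j) := by
      conv_lhs => rw [← sum_sfiniteSeq m]
      rw [lintegral_sum_measure]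
    rw [e]
    exact (hcont.tendsto _).comp (ENNReal.tendsto_nat_tsum _)
  exact tendsto_nhds_unique (h1.congr hpart) h2

/-- Sums over disjoint regions of a Poisson point process are independent. -/
theorem indepFun_poissonSum (m : Measure E) [SFinite m] {ι : Type*} {F : ι → E → ℝ≥0∞}
    {g : E → ℝ≥0∞} (hF : ∀ i, Measurable (F i)) (hg : Measurable g)
    (hdisj : ∀ x, g x = 0 ∨ ∀ i, F i x = 0) :
    ProbabilityTheory.IndepFun (fun ω i => poissonSum (F i) ω) (poissonSum g)
      (poissonProcessLaw m) := by
  refine ProbabilityTheory.IndepFun.process_indepFun (fun i => measurable_poissonSum (hF i))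
    (measurable_poissonSum hg) fun I => ?_
  have hmF : Measurable (fun ω (i : I) => poissonSum (F i) ω) :=
    measurable_pi_lambda _ fun i => measurable_poissonSum (hF i)
  have hmg := measurable_poissonSum hg
  rw [ProbabilityTheory.indepFun_iff_map_prod_eq_prod_map_map hmF.aemeasurable hmg.aemeasurable]
  -- Products of integer powers of the coordinate exponentials form a multiplicative,
  -- point-separating family, so they identify the joint law with the product law.
  let A : (I → ℕ) → (I → ℝ≥0∞) → ℝ := fun n y => ∏ i, expNeg 1 (y i) ^ n i
  have hcA : ∀ n, Continuous (A n) := fun n => continuous_finsetProd _ fun i _ =>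
    ((continuous_expNeg one_pos).comp (continuous_apply i)).pow _
  let T : (I → ℕ) → ℕ → ((I → ℝ≥0∞) × ℝ≥0∞ →ᵇ ℝ) := fun n k =>
    BoundedContinuousFunction.mkOfCompact ⟨fun p => A n p.1 * expNeg 1 p.2 ^ k,
      ((hcA n).comp continuous_fst).mul
        (((continuous_expNeg one_pos).comp continuous_snd).pow _)⟩
  have hT : ∀ n k p, T n k p = A n p.1 * expNeg 1 p.2 ^ k := fun _ _ _ => rfl
  let M : Submonoid ((I → ℝ≥0∞) × ℝ≥0∞ →ᵇ ℝ) :=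
    { carrier := {f | ∃ n k, f = T n k}
      one_mem' := ⟨0, 0, by ext p; simp [hT, A]⟩
      mul_mem' := by
        rintro _ _ ⟨n, k, rfl⟩ ⟨n', k', rfl⟩
        refine ⟨n + n', k + k', ?_⟩
        ext p
        simp only [BoundedContinuousFunction.coe_mul, Pi.mul_apply, hT, A, Pi.add_apply, pow_add,
          Finset.prod_mul_distrib]
        ring }
  have hP : IsProbabilityMeasure ((poissonProcessLaw m).map fun ω (i : I) => poissonSum (F i) ω) :=
    Measure.isProbabilityMeasure_map hmF.aemeasurable
  have hP' : IsProbabilityMeasure ((poissonProcessLaw m).map (poissonSum g)) :=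
    Measure.isProbabilityMeasure_map hmg.aemeasurable
  have hP'' := Measure.isProbabilityMeasure_map (μ := poissonProcessLaw m)
    (hmF.prodMk hmg).aemeasurable
  refine Measure.ext_of_submonoid M ?_ ?_
  · intro p p' hpp
    by_cases h2 : p.2 = p'.2
    · have h1 : p.1 ≠ p'.1 := fun h => hpp (Prod.ext h h2)
      obtain ⟨i, hi⟩ := Function.ne_iff.1 h1
      classical
      refine ⟨T (Pi.single i 1) 0, ⟨_, _, rfl⟩, fun h => hi (expNeg_injective one_pos ?_)⟩
      have e : ∀ y : I → ℝ≥0∞, A (Pi.single i 1) y = expNeg 1 (y i) := by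
        intro y
        simp only [A]
        rw [Finset.prod_eq_single i]
        · simp
        · intro j _ hj
          simp [Pi.single_eq_of_ne hj]
        · simp
      simpa [hT, e] using h
    · refine ⟨T 0 1, ⟨_, _, rfl⟩, fun h => h2 (expNeg_injective one_pos ?_)⟩
      simpa [hT, A] using h
  · rintro _ ⟨n, k, rfl⟩
    simp only [hT]
    rw [integral_prod_mul (A n) (fun y => expNeg 1 y ^ k),
      integral_map (f := fun p : (I → ℝ≥0∞) × ℝ≥0∞ => A n p.1 * expNeg 1 p.2 ^ k)
        (hmF.prodMk hmg).aemeasurable (T n k).continuous.measurable.aestronglyMeasurable,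
      integral_map hmF.aemeasurable (hcA n).measurable.aestronglyMeasurable,
      integral_map hmg.aemeasurable ((measurable_expNeg 1).pow_const k).aestronglyMeasurable]
    -- The exponents combine into Poisson sums of the two functions G and K, to which the Laplace
    -- functional applies.
    let G : E → ℝ≥0∞ := fun x => ∑ i : I, (n i : ℝ≥0∞) * F i x
    let K : E → ℝ≥0∞ := fun x => (k : ℝ≥0∞) * g x
    have hG : Measurable G := Finset.measurable_sum _ fun i _ => (hF i).const_mul _
    have hK : Measurable K := hg.const_mul _
    have e1 : ∀ ω, A n (fun i => poissonSum (F i) ω) = expNeg 1 (poissonSum G ω) := by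
      intro ω
      simp only [G, A]
      rw [poissonSum_sum, expNeg_sum]
      refine Finset.prod_congr rfl fun i _ => ?_
      rw [poissonSum_const_mul, expNeg_natCast_mul]
    have e2 : ∀ ω, expNeg 1 (poissonSum g ω) ^ k = expNeg 1 (poissonSum K ω) := by
      intro ω
      simp only [K]
      rw [poissonSum_const_mul, expNeg_natCast_mul]
    simp only [e1, e2, ← expNeg_add_right, ← poissonSum_add]
    rw [integral_poissonProcessLaw m hG, integral_poissonProcessLaw m hK,
      integral_poissonProcessLaw m (f := fun x => G x + K x) (hG.add hK), ← expNeg_add_right,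
      ← lintegral_add_left (by fun_prop)]
    congr 1
    -- At every point G or K vanishes, hence 1 - e^{-(G+K)} = (1 - e^{-G}) + (1 - e^{-K}).
    refine lintegral_congr fun x => ?_
    rcases hdisj x with h | h
    · simp [K, h, expNeg_zero_right]
    · simp [G, h, expNeg_zero_right]

end PoissonConfigurations

end

/-! ### The subordinator with given drift and Lévy measure -/

theorem tendsto_expNeg_nhdsGE_zero (x : ℝ≥0∞) {u : ℕ → ℝ} (hu : Tendsto u atTop (𝓝 0)) :
    Tendsto (fun n => expNeg (u n) x) atTop (𝓝 (expNeg 0 x)) := by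
  by_cases hx : x = ∞
  · simp [hx, expNeg_top]
  · simp only [expNeg_of_ne_top _ hx]
    exact (Real.continuous_exp.tendsto _).comp ((hu.mul_const _).neg)

theorem ae_eq_zero_of_integral_expNeg {Ω : Type*} [MeasurableSpace Ω] {P : Measure Ω}
    [IsProbabilityMeasure P] {X : Ω → ℝ≥0∞} (hX : Measurable X) {q : ℝ} (hq : 0 ≤ q)
    (h : ∫ ω, expNeg q (X ω) ∂P = 1) : ∀ᵐ ω ∂P, expNeg q (X ω) = 1 := by
  have hi := integrable_expNeg (μ := P) hq hX
  have h0 : ∫ ω, (1 - expNeg q (X ω)) ∂P = 0 := by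
    rw [integral_sub (integrable_const _) hi, h]
    simp
  rw [integral_eq_zero_iff_of_nonneg (fun ω => sub_nonneg.2 (expNeg_le_one hq _))
    ((integrable_const _).sub hi)] at h0
  filter_upwards [h0] with ω hω
  simp only [Pi.zero_apply] at hω
  linarith

/-- The jumps `x` occurring at times in `S`. -/
noncomputable def jumpsIn (S : Set ℝ) (p : ℝ × ℝ) : ℝ≥0∞ :=
  S.indicator (fun _ => ENNReal.ofReal p.2) p.1

theorem measurable_jumpsIn {S : Set ℝ} (hS : MeasurableSet S) : Measurable (jumpsIn S) := by
  have : jumpsIn S = (Prod.fst ⁻¹' S).indicator fun p : ℝ × ℝ => ENNReal.ofReal p.2 := by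
    ext p
    by_cases hp : p.1 ∈ S <;> simp [jumpsIn, hp]
  rw [this]
  exact Measurable.indicator (by fun_prop) (measurable_fst hS)

/-- The intensity of the jumps of a subordinator with Lévy measure `L`. -/
noncomputable def jumpIntensity (L : Measure ℝ) : Measure (ℝ × ℝ) :=
  (volume.restrict (Ioi (0 : ℝ))).prod L

instance (L : Measure ℝ) [SFinite L] : SFinite (jumpIntensity L) := by
  unfold jumpIntensity
  infer_instance

theorem integral_expNeg_poissonSum_jumpsIn (L : Measure ℝ) [SFinite L] {S : Set ℝ}
    (hS : MeasurableSet S) (a : ℝ≥0∞) :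
    ∫ ω, expNeg 1 (a * poissonSum (jumpsIn S) ω) ∂(poissonProcessLaw (jumpIntensity L)) =
      expNeg 1 (volume (S ∩ Ioi 0) *
        ∫⁻ x, ENNReal.ofReal (1 - expNeg 1 (a * ENNReal.ofReal x)) ∂L) := by
  simp only [← poissonSum_const_mul]
  rw [integral_poissonProcessLaw _ ((measurable_jumpsIn hS).const_mul a)]
  congr 1
  have e : ∀ p : ℝ × ℝ, ENNReal.ofReal (1 - expNeg 1 (a * jumpsIn S p)) =
      S.indicator 1 p.1 * ENNReal.ofReal (1 - expNeg 1 (a * ENNReal.ofReal p.2)) := by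
    intro p
    by_cases hp : p.1 ∈ S
    · simp [jumpsIn, hp]
    · simp [jumpsIn, hp, expNeg_zero_right]
  simp only [e]
  rw [jumpIntensity, lintegral_prod_mul (f := S.indicator 1)
    (g := fun x => ENNReal.ofReal (1 - expNeg 1 (a * ENNReal.ofReal x)))
    (measurable_one.indicator hS).aemeasurable
    (Measurable.aemeasurable (by fun_prop)), lintegral_indicator_one hS,
    Measure.restrict_apply hS]

/-- The subordinator with drift `d` driven by a Poisson point process of jumps. -/
noncomputable def poissonSubordinator (d : ℝ) (t : ℝ≥0) (ω : ℕ → Σ k : ℕ, Fin k → ℝ × ℝ) : ℝ≥0∞ :=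
  ENNReal.ofReal (d * t) + poissonSum (jumpsIn (Iic (t : ℝ))) ω

theorem measurable_poissonSubordinator (d : ℝ) (t : ℝ≥0) : Measurable (poissonSubordinator d t) :=
  (measurable_poissonSum (measurable_jumpsIn measurableSet_Iic)).const_add _

theorem monotone_poissonSubordinator {d : ℝ} (hd : 0 ≤ d)
    (ω : ℕ → Σ k : ℕ, Fin k → ℝ × ℝ) : Monotone fun t => poissonSubordinator d t ω := by
  intro s t hst
  refine add_le_add (ENNReal.ofReal_le_ofReal (by gcongr)) (poissonSum_mono (fun p => ?_) ω)
  refine indicator_le_indicator_of_subset (Iic_subset_Iic.2 ?_) (fun _ => zero_le) _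
  exact_mod_cast hst

/-- Dominated convergence for the counting measure on the configurations: just to the right of t
each finite configuration contributes a constant, and the jumps up to time t + 1 dominate.
Finiteness makes this bound summable. -/
theorem continuousWithinAt_poissonSubordinator {d : ℝ}
    {ω : ℕ → Σ k : ℕ, Fin k → ℝ × ℝ} (hfin : ∀ t, poissonSubordinator d t ω ≠ ∞) (t : ℝ≥0) :
    ContinuousWithinAt (fun s => poissonSubordinator d s ω) (Ici t) t := by
  have hdrift : Continuous fun s : ℝ≥0 => ENNReal.ofReal (d * s) :=
    ENNReal.continuous_ofReal.comp (by fun_prop)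
  suffices hsum : ContinuousWithinAt (fun s : ℝ≥0 => poissonSum (jumpsIn (Iic (s : ℝ))) ω)
      (Ici t) t from hdrift.continuousWithinAt.add hsum
  · have hT : poissonSum (jumpsIn (Iic ((t + 1 : ℝ≥0) : ℝ))) ω ≠ ∞ :=
      (ENNReal.add_ne_top.1 (hfin (t + 1))).2
    have e : ∀ s : ℝ≥0, poissonSum (jumpsIn (Iic (s : ℝ))) ω =
        ∫⁻ j, configSum (jumpsIn (Iic (s : ℝ))) (ω j) ∂Measure.count := fun s =>
      (lintegral_count _).symm
    simp only [ContinuousWithinAt, e]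
    refine tendsto_lintegral_filter_of_dominated_convergence (μ := Measure.count)
      (F := fun (s : ℝ≥0) j => configSum (jumpsIn (Iic (s : ℝ))) (ω j))
      (f := fun j => configSum (jumpsIn (Iic (t : ℝ))) (ω j))
      (fun j => configSum (jumpsIn (Iic ((t + 1 : ℝ≥0) : ℝ))) (ω j)) ?_ ?_ ?_ ?_
    · exact Eventually.of_forall fun s => measurable_of_countable _
    · have h1 : ∀ᶠ s : ℝ≥0 in 𝓝[≥] t, s ≤ t + 1 :=
        mem_nhdsWithin_of_mem_nhds (Iic_mem_nhds (lt_add_one t))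
      filter_upwards [h1] with s hs
      refine ae_of_all _ fun j => Finset.sum_le_sum fun i _ => ?_
      refine indicator_le_indicator_of_subset (Iic_subset_Iic.2 ?_) (fun _ => zero_le) _
      exact_mod_cast hs
    · rw [lintegral_count]
      exact hT
    · refine ae_of_all _ fun j => tendsto_finsetSum _ fun i _ => ?_
      refine Tendsto.congr' ?_ tendsto_const_nhds
      set p := (ω j).2 i
      by_cases hp : p.1 ≤ t
      · filter_upwards [self_mem_nhdsWithin] with s hs
        have hs' : (t : ℝ) ≤ s := by exact_mod_cast hs
        simp [jumpsIn, hp, hp.trans hs']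
      · have h2 : ∀ᶠ s : ℝ≥0 in 𝓝[≥] t, (s : ℝ) < p.1 :=
          mem_nhdsWithin_of_mem_nhds (NNReal.continuous_coe.continuousAt.eventually
            (gt_mem_nhds (not_le.1 hp)))
        filter_upwards [h2] with s hs
        simp [jumpsIn, hp, not_le.2 hs]

section Exponent

variable {L : Measure ℝ}

theorem ae_pos_of_measure_Iic (hL0 : L (Iic 0) = 0) : ∀ᵐ x ∂L, 0 < x := by
  rw [ae_iff]
  simpa [Iic] using hL0

theorem one_sub_exp_le_max_mul_min {q x : ℝ} (hx : 0 ≤ x) :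
    1 - Real.exp (-(q * x)) ≤ max 1 q * min 1 x := by
  have h1 : 1 - Real.exp (-(q * x)) ≤ 1 := by linarith [Real.exp_pos (-(q * x))]
  have h2 : 1 - Real.exp (-(q * x)) ≤ q * x := by linarith [Real.add_one_le_exp (-(q * x))]
  rcases le_total 1 x with h | h
  · rw [min_eq_left h, mul_one]
    exact h1.trans (le_max_left _ _)
  · rw [min_eq_right h]
    exact h2.trans (by gcongr; exact le_max_right _ _)

theorem integrable_one_sub_exp (hL : ∫⁻ x in Ioi (0 : ℝ), ENNReal.ofReal (min 1 x) ∂L < ∞)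
    {q : ℝ} (hq : 0 ≤ q) :
    IntegrableOn (fun x : ℝ => 1 - Real.exp (-(q * x))) (Ioi 0) L := by
  have hmin : IntegrableOn (fun x : ℝ => min 1 x) (Ioi 0) L := by
    refine ⟨by fun_prop, ?_⟩
    rw [hasFiniteIntegral_iff_ofReal]
    · exact hL
    · filter_upwards [ae_restrict_mem measurableSet_Ioi] with x hx
      exact le_min zero_le_one (le_of_lt hx)
  refine Integrable.mono' (hmin.const_mul (max 1 q)) (by fun_prop) ?_
  filter_upwards [ae_restrict_mem measurableSet_Ioi] with x hx
  have hx0 : 0 ≤ x := le_of_lt hx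
  rw [Real.norm_of_nonneg]
  · exact one_sub_exp_le_max_mul_min hx0
  · exact sub_nonneg.2 (Real.exp_le_one_iff.2 (by nlinarith))

theorem lintegral_one_sub_expNeg (hL0 : L (Iic 0) = 0)
    (hL : ∫⁻ x in Ioi (0 : ℝ), ENNReal.ofReal (min 1 x) ∂L < ∞) {q : ℝ} (hq : 0 ≤ q) :
    ∫⁻ x, ENNReal.ofReal (1 - expNeg 1 (ENNReal.ofReal q * ENNReal.ofReal x)) ∂L =
      ENNReal.ofReal (∫ x in Ioi (0 : ℝ), (1 - Real.exp (-(q * x))) ∂L) := by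
  have hpos := ae_pos_of_measure_Iic hL0
  have hr : L.restrict (Ioi 0) = L := Measure.restrict_eq_self_of_ae_mem hpos
  rw [ofReal_integral_eq_lintegral_ofReal (integrable_one_sub_exp hL hq), hr]
  · refine lintegral_congr_ae ?_
    filter_upwards [hpos] with x hx
    rw [← ENNReal.ofReal_mul hq, expNeg_of_ne_top _ ENNReal.ofReal_ne_top,
      ENNReal.toReal_ofReal (by positivity), one_mul]
  · filter_upwards [ae_restrict_mem measurableSet_Ioi] with x hx
    exact sub_nonneg.2 (Real.exp_le_one_iff.2 (by have : 0 < x := hx; nlinarith))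

theorem integral_one_sub_exp_nonneg {q : ℝ} (hq : 0 ≤ q) :
    0 ≤ ∫ x in Ioi (0 : ℝ), (1 - Real.exp (-(q * x))) ∂L := by
  refine setIntegral_nonneg measurableSet_Ioi fun x hx => ?_
  exact sub_nonneg.2 (Real.exp_le_one_iff.2 (by have : 0 < x := hx; nlinarith))

theorem tendsto_integral_one_sub_exp
    (hL : ∫⁻ x in Ioi (0 : ℝ), ENNReal.ofReal (min 1 x) ∂L < ∞) :
    Tendsto (fun n : ℕ => ∫ x in Ioi (0 : ℝ), (1 - Real.exp (-(1 / ((n : ℝ) + 1) * x))) ∂L) atTop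
      (𝓝 0) := by
  have : Tendsto (fun n : ℕ => ∫ x in Ioi (0 : ℝ), (1 - Real.exp (-(1 / ((n : ℝ) + 1) * x))) ∂L)
      atTop (𝓝 (∫ _ in Ioi (0 : ℝ), (0 : ℝ) ∂L)) := by
    refine tendsto_integral_of_dominated_convergence (fun x => 1 - Real.exp (-(1 * x)))
      (fun n => by fun_prop) (integrable_one_sub_exp hL zero_le_one) (fun n => ?_) ?_
    · filter_upwards [ae_restrict_mem measurableSet_Ioi] with x hx
      have hx0 : 0 < x := hx
      have h1 : 1 / ((n : ℝ) + 1) ≤ 1 := by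
        rw [div_le_one (by positivity)]
        linarith [(Nat.cast_nonneg n : (0 : ℝ) ≤ n)]
      rw [Real.norm_of_nonneg (sub_nonneg.2 (Real.exp_le_one_iff.2 (by
        have : 0 ≤ 1 / ((n : ℝ) + 1) * x := by positivity
        linarith)))]
      gcongr
    · refine ae_of_all _ fun x => ?_
      have h := (tendsto_one_div_add_atTop_nhds_zero_nat (𝕜 := ℝ)).mul_const x
      have h2 := ((Real.continuous_exp.tendsto _).comp h.neg).const_sub 1
      simpa using h2
  simpa using this

variable [SFinite L] {d : ℝ}

theorem integral_expNeg_poissonSubordinator_of_pos (hd : 0 ≤ d) (hL0 : L (Iic 0) = 0)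
    (hL : ∫⁻ x in Ioi (0 : ℝ), ENNReal.ofReal (min 1 x) ∂L < ∞) (t : ℝ≥0) {q : ℝ} (hq : 0 < q) :
    ∫ ω, expNeg q (poissonSubordinator d t ω) ∂(poissonProcessLaw (jumpIntensity L)) =
      Real.exp (-(t * (d * q + ∫ x in Ioi (0 : ℝ), (1 - Real.exp (-(q * x))) ∂L))) := by
  have e : ∀ ω, expNeg q (poissonSubordinator d t ω) = Real.exp (-(q * (d * t))) *
      expNeg 1 (ENNReal.ofReal q * poissonSum (jumpsIn (Iic (t : ℝ))) ω) := by
    intro ω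
    rw [poissonSubordinator, expNeg_add_right, expNeg_ofReal_mul hq, one_mul,
      expNeg_of_ne_top _ ENNReal.ofReal_ne_top, ENNReal.toReal_ofReal (by positivity)]
  simp only [e]
  have hv : volume (Iic (t : ℝ) ∩ Ioi 0) = ENNReal.ofReal t := by
    rw [inter_comm, Ioi_inter_Iic, Real.volume_Ioc, sub_zero]
  rw [integral_const_mul, integral_expNeg_poissonSum_jumpsIn L measurableSet_Iic,
    lintegral_one_sub_expNeg hL0 hL hq.le, hv, ← ENNReal.ofReal_mul t.coe_nonneg,
    expNeg_of_ne_top _ ENNReal.ofReal_ne_top, ENNReal.toReal_ofReal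
      (mul_nonneg t.coe_nonneg (integral_one_sub_exp_nonneg hq.le)), ← Real.exp_add]
  ring_nf

/-- Let q decrease to 0. Since e^{-0·∞} = 0, the value 1 says that the law has no mass at ∞. -/
theorem integral_expNeg_zero_poissonSubordinator (hd : 0 ≤ d) (hL0 : L (Iic 0) = 0)
    (hL : ∫⁻ x in Ioi (0 : ℝ), ENNReal.ofReal (min 1 x) ∂L < ∞) (t : ℝ≥0) :
    ∫ ω, expNeg 0 (poissonSubordinator d t ω) ∂(poissonProcessLaw (jumpIntensity L)) = 1 := by
  have hu := tendsto_one_div_add_atTop_nhds_zero_nat (𝕜 := ℝ)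
  have h1 : Tendsto (fun n : ℕ => ∫ ω, expNeg (1 / ((n : ℝ) + 1)) (poissonSubordinator d t ω)
      ∂(poissonProcessLaw (jumpIntensity L))) atTop
      (𝓝 (∫ ω, expNeg 0 (poissonSubordinator d t ω) ∂(poissonProcessLaw (jumpIntensity L)))) := by
    refine tendsto_integral_of_dominated_convergence (fun _ => 1) (fun n =>
      ((measurable_expNeg _).comp (measurable_poissonSubordinator d t)).aestronglyMeasurable)
      (integrable_const _) (fun n => ae_of_all _ fun ω => ?_) (ae_of_all _ fun ω => ?_)
    · rw [Real.norm_of_nonneg (expNeg_nonneg _ _)]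
      exact expNeg_le_one (by positivity) _
    · exact tendsto_expNeg_nhdsGE_zero _ hu
  refine tendsto_nhds_unique h1 ?_
  have h2 := (((hu.const_mul d).add (tendsto_integral_one_sub_exp hL)).const_mul (t : ℝ)).neg
  have h3 := (Real.continuous_exp.tendsto _).comp h2
  simp only [mul_zero, add_zero, neg_zero, Real.exp_zero] at h3
  refine h3.congr fun n => ?_
  exact (integral_expNeg_poissonSubordinator_of_pos hd hL0 hL t (by positivity)).symm

theorem ae_poissonSubordinator_ne_top (hd : 0 ≤ d) (hL0 : L (Iic 0) = 0)
    (hL : ∫⁻ x in Ioi (0 : ℝ), ENNReal.ofReal (min 1 x) ∂L < ∞) :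
    ∀ᵐ ω ∂(poissonProcessLaw (jumpIntensity L)), ∀ t, poissonSubordinator d t ω ≠ ∞ := by
  have h1 : ∀ᵐ ω ∂(poissonProcessLaw (jumpIntensity L)), ∀ n : ℕ,
      expNeg 0 (poissonSubordinator d n ω) = 1 := by
    rw [ae_all_iff]
    exact fun n => ae_eq_zero_of_integral_expNeg (measurable_poissonSubordinator d n) le_rfl
      (integral_expNeg_zero_poissonSubordinator hd hL0 hL n)
  filter_upwards [h1] with ω hω t ht
  obtain ⟨n, hn⟩ := exists_nat_ge t
  have h2 := monotone_poissonSubordinator hd ω hn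
  simp only [ht, top_le_iff] at h2
  have := hω n
  rw [h2, expNeg_top] at this
  exact zero_ne_one this

theorem isSubordinator_poissonSubordinator (hd : 0 ≤ d) (hL0 : L (Iic 0) = 0)
    (hL : ∫⁻ x in Ioi (0 : ℝ), ENNReal.ofReal (min 1 x) ∂L < ∞) :
    IsSubordinator (poissonSubordinator d) (poissonProcessLaw (jumpIntensity L)) where
  measurable := measurable_poissonSubordinator d
  zero := by
    have h1 := integral_expNeg_poissonSubordinator_of_pos hd hL0 hL 0 one_pos
    simp only [NNReal.coe_zero, zero_mul, neg_zero, Real.exp_zero] at h1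
    filter_upwards [ae_eq_zero_of_integral_expNeg (measurable_poissonSubordinator d 0)
      zero_le_one h1] with ω hω
    exact expNeg_injective one_pos (hω.trans (expNeg_zero_right 1).symm)
  mono := ae_of_all _ (monotone_poissonSubordinator hd)
  right_cont := by
    filter_upwards [ae_poissonSubordinator_ne_top hd hL0 hL] with ω hω
    exact continuousWithinAt_poissonSubordinator hω
  increments := by
    intro s t A B hA hB
    set P := poissonProcessLaw (jumpIntensity L) with hP
    let F : {r : ℝ≥0 // r ≤ s} → ℝ × ℝ → ℝ≥0∞ := fun r => jumpsIn (Iic ((r : ℝ≥0) : ℝ))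
    -- The increment depends on the jumps in (s, s+t] and the past on those at times at most s.
    -- These regions are disjoint, hence the independence.
    let g : ℝ × ℝ → ℝ≥0∞ := jumpsIn (Ioc (s : ℝ) ((s + t : ℝ≥0) : ℝ))
    let X := fun ω (r : {r : ℝ≥0 // r ≤ s}) => poissonSum (F r) ω
    have hg : Measurable g := measurable_jumpsIn measurableSet_Ioc
    have hind : ProbabilityTheory.IndepFun X (poissonSum g) P := by
      refine indepFun_poissonSum _ (fun r => measurable_jumpsIn measurableSet_Iic) hg fun p => ?_
      by_cases hp : s < p.1
      · right
        intro r
        have hr : ((r : ℝ≥0) : ℝ) ≤ s := by exact_mod_cast r.2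
        have : ¬ p.1 ≤ ((r : ℝ≥0) : ℝ) := not_le.2 (hr.trans_lt hp)
        simp [F, jumpsIn, this]
      · left
        simp [g, jumpsIn, hp]
    have hAX : ∃ S, MeasurableSet S ∧ X ⁻¹' S = A := by
      have hle : (⨆ r : {r : ℝ≥0 // r ≤ s}, MeasurableSpace.comap (poissonSubordinator d r)
          (inferInstance : MeasurableSpace ℝ≥0∞)) ≤ MeasurableSpace.comap X inferInstance := by
        refine iSup_le fun r => ?_
        have : poissonSubordinator d (r : ℝ≥0) =
            (fun x : {r : ℝ≥0 // r ≤ s} → ℝ≥0∞ => ENNReal.ofReal (d * (r : ℝ≥0)) + x r) ∘ X := rfl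
        rw [this, ← MeasurableSpace.comap_comp]
        exact MeasurableSpace.comap_mono
          (Measurable.comap_le ((measurable_pi_apply r).const_add _))
      exact hle A hA
    obtain ⟨S, hS, rfl⟩ := hAX
    have hincr : ∀ ω, poissonSubordinator d (s + t) ω =
        poissonSubordinator d s ω + (ENNReal.ofReal (d * t) + poissonSum g ω) := by
      intro ω
      have e : jumpsIn (Iic ((s + t : ℝ≥0) : ℝ)) = fun p => jumpsIn (Iic (s : ℝ)) p + g p := by
        ext p
        have h1 : (s : ℝ) ≤ ((s + t : ℝ≥0) : ℝ) := by simp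
        simp only [g, jumpsIn]
        rw [← Iic_union_Ioc_eq_Iic h1]
        have hdisj : Disjoint (Iic (s : ℝ)) (Ioc (s : ℝ) ((s + t : ℝ≥0) : ℝ)) :=
          Set.disjoint_left.2 fun x hx hx' => not_le.2 hx'.1 hx
        exact congrFun (indicator_union_of_disjoint hdisj (fun _ => ENNReal.ofReal p.2)) p.1
      simp only [poissonSubordinator]
      rw [e, poissonSum_add, NNReal.coe_add, mul_add,
        ENNReal.ofReal_add (by positivity) (by positivity)]
      ring
    have hfin := ae_poissonSubordinator_ne_top hd hL0 hL
    -- Subtraction in [0, ∞] recovers the increment only where the value at s is finite, which is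
    -- almost everywhere.
    have e1 : P (X ⁻¹' S ∩ {ω | poissonSubordinator d s ω < ∞} ∩
        {ω | poissonSubordinator d (s + t) ω - poissonSubordinator d s ω ∈ B}) =
        P (X ⁻¹' S ∩ poissonSum g ⁻¹' {y | ENNReal.ofReal (d * t) + y ∈ B}) := by
      refine measure_congr ?_
      filter_upwards [hfin] with ω hω
      refine propext ?_
      have hBω : poissonSubordinator d (s + t) ω - poissonSubordinator d s ω ∈ B ↔
          ENNReal.ofReal (d * t) + poissonSum g ω ∈ B := by
        rw [hincr ω, ENNReal.add_sub_cancel_left (hω s)]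
      change (_ ∧ _) ∧ (_ ∈ B) ↔ _ ∧ (_ ∈ B)
      rw [hBω]
      exact ⟨fun h => ⟨h.1.1, h.2⟩, fun h => ⟨⟨h.1, (hω s).lt_top⟩, h.2⟩⟩
    have e2 : P (X ⁻¹' S ∩ {ω | poissonSubordinator d s ω < ∞}) = P (X ⁻¹' S) := by
      refine measure_congr ?_
      filter_upwards [hfin] with ω hω
      exact propext ⟨fun h => h.1, fun h => ⟨h, (hω s).lt_top⟩⟩
    have hB' : MeasurableSet {y : ℝ≥0∞ | ENNReal.ofReal (d * t) + y ∈ B} :=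
      (measurable_const_add (ENNReal.ofReal (d * t))) hB
    -- Only the length of the time window inside (0, ∞) enters the Laplace functional, and it is t
    -- in both cases.
    have hlaw : P.map (poissonSum g) = P.map (poissonSum (jumpsIn (Iic (t : ℝ)))) := by
      have hm1 := measurable_poissonSum hg
      have hm2 := measurable_poissonSum (measurable_jumpsIn (measurableSet_Iic (a := (t : ℝ))))
      have := Measure.isProbabilityMeasure_map (μ := P) hm1.aemeasurable
      have := Measure.isProbabilityMeasure_map (μ := P) hm2.aemeasurable
      refine ennreal_measure_ext fun n => ?_
      rw [integral_map hm1.aemeasurable ((measurable_expNeg 1).pow_const n).aestronglyMeasurable,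
        integral_map hm2.aemeasurable ((measurable_expNeg 1).pow_const n).aestronglyMeasurable]
      simp only [← expNeg_natCast_mul]
      rw [integral_expNeg_poissonSum_jumpsIn L measurableSet_Ioc,
        integral_expNeg_poissonSum_jumpsIn L measurableSet_Iic]
      congr 2
      have h1 : Ioc (s : ℝ) ((s + t : ℝ≥0) : ℝ) ∩ Ioi 0 = Ioc (s : ℝ) ((s + t : ℝ≥0) : ℝ) :=
        inter_eq_left.2 fun x hx => s.coe_nonneg.trans_lt hx.1
      rw [h1, inter_comm, Ioi_inter_Iic, Real.volume_Ioc, Real.volume_Ioc]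
      congr 1
      push_cast
      ring
    rw [e1, e2, hind.measure_inter_preimage_eq_mul _ _ hS hB']
    congr 1
    rw [← Measure.map_apply (measurable_poissonSum hg) hB', hlaw,
      Measure.map_apply (measurable_poissonSum (measurable_jumpsIn measurableSet_Iic)) hB']
    rfl

/-- Every drift and Lévy measure are those of some subordinator. -/
theorem exists_subordinator (hd : 0 ≤ d) (hL0 : L (Iic 0) = 0)
    (hL : ∫⁻ x in Ioi (0 : ℝ), ENNReal.ofReal (min 1 x) ∂L < ∞) :
    ∃ (Ω' : Type) (_ : MeasurableSpace Ω') (P' : Measure Ω') (σ : ℝ≥0 → Ω' → ℝ≥0∞),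
      IsProbabilityMeasure P' ∧ IsSubordinator σ P' ∧ ∀ q : ℝ, 0 ≤ q →
        laplaceExponent σ P' q = d * q + ∫ x in Ioi (0 : ℝ), (1 - Real.exp (-(q * x))) ∂L := by
  refine ⟨_, _, poissonProcessLaw (jumpIntensity L), poissonSubordinator d, inferInstance,
    isSubordinator_poissonSubordinator hd hL0 hL, fun q hq => ?_⟩
  unfold laplaceExponent
  rcases hq.eq_or_lt with rfl | hq
  · rw [integral_expNeg_zero_poissonSubordinator hd hL0 hL]
    simp
  · rw [integral_expNeg_poissonSubordinator_of_pos hd hL0 hL 1 hq, Real.log_exp]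
    simp

end Exponent

/-! ### The Laplace exponent of a subordinator -/

theorem expNeg_add_left (p q : ℝ) (x : ℝ≥0∞) : expNeg (p + q) x = expNeg p x * expNeg q x := by
  by_cases hx : x = ∞
  · simp [hx, expNeg_top]
  · rw [expNeg_of_ne_top _ hx, expNeg_of_ne_top _ hx, expNeg_of_ne_top _ hx, ← Real.exp_add]
    ring_nf

theorem expNeg_le_of_le {p q : ℝ} (hpq : p ≤ q) (x : ℝ≥0∞) : expNeg q x ≤ expNeg p x := by
  by_cases hx : x = ∞
  · simp [hx, expNeg_top]
  · rw [expNeg_of_ne_top _ hx, expNeg_of_ne_top _ hx]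
    gcongr

/-- An antitone multiplicative function on `[0, ∞)` is an exponential. -/
theorem eq_exp_of_antitone_of_mul {m : ℝ≥0 → ℝ} (hanti : Antitone m)
    (hmul : ∀ s t, m (s + t) = m s * m t) (hpos : ∀ t, 0 < m t) (t : ℝ≥0) :
    m t = Real.exp (t * Real.log (m 1)) := by
  let f : ℝ≥0 → ℝ := fun t => -Real.log (m t)
  have hf0 : f 0 = 0 := by
    have h := hmul 0 0
    rw [add_zero] at h
    have : m 0 = 1 := by
      have h0 := (hpos 0).ne'
      field_simp at h
      exact h.symm
    simp [f, this]
  have hfadd : ∀ s t, f (s + t) = f s + f t := by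
    intro s t
    simp only [f]
    rw [hmul, Real.log_mul (hpos s).ne' (hpos t).ne']
    ring
  have hfmul : ∀ (n : ℕ) s, f (n * s) = n * f s := by
    intro n s
    induction n with
    | zero => simp [hf0]
    | succ n ih =>
      push_cast
      rw [add_mul, one_mul, hfadd, ih]
      ring
  have hfmono : Monotone f := fun s t hst =>
    neg_le_neg (Real.log_le_log (hpos t) (hanti hst))
  have hf1 : 0 ≤ f 1 := by
    have := hfmono (zero_le (a := (1 : ℝ≥0)))
    rwa [hf0] at this
  -- With k the integer part of nt, both n f(t) and n t f(1) lie between k f(1) and (k+1) f(1).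
  have hbound : ∀ n : ℕ, 0 < n → |f t - t * f 1| ≤ f 1 / n := by
    intro n hn
    have hn' : (0 : ℝ) < n := by exact_mod_cast hn
    set k := ⌊(n : ℝ≥0) * t⌋₊
    have h1 : (k : ℝ≥0) ≤ n * t := Nat.floor_le zero_le
    have h2 : (n : ℝ≥0) * t ≤ (k + 1 : ℕ) := by
      push_cast
      exact (Nat.lt_floor_add_one _).le
    have h3 := hfmono h1
    have h4 := hfmono h2
    have h5 : ∀ j : ℕ, f (j : ℝ≥0) = j * f 1 := fun j => by
      have := hfmul j 1
      rwa [mul_one] at this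
    rw [hfmul, h5] at h3 h4
    push_cast at h4
    have h1' : (k : ℝ) ≤ n * t := by exact_mod_cast h1
    have h2' : (n : ℝ) * t ≤ k + 1 := by exact_mod_cast h2
    rw [le_div_iff₀ hn', ← abs_of_pos hn', ← abs_mul, abs_le]
    constructor <;> nlinarith
  have hlim : Tendsto (fun n : ℕ => f 1 / n) atTop (𝓝 0) :=
    tendsto_const_nhds.div_atTop tendsto_natCast_atTop_atTop
  have h0 : |f t - t * f 1| ≤ 0 :=
    ge_of_tendsto hlim ((eventually_gt_atTop 0).mono fun n hn => hbound n hn)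
  have h6 := sub_eq_zero.1 (abs_nonpos_iff.1 h0)
  simp only [f] at h6
  rw [show (t : ℝ) * Real.log (m 1) = Real.log (m t) by linarith, Real.exp_log (hpos t)]

/-- The left and right Riemann sums enclose the integral and differ by (u/n)(f(u) - f(0)). -/
theorem tendsto_riemann_sum_of_monotoneOn {f : ℝ → ℝ} {u : ℝ} (hu : 0 ≤ u)
    (hf : MonotoneOn f (Icc 0 u)) :
    Tendsto (fun n : ℕ => u / n * ∑ j ∈ Finset.range n, f (u / n * j)) atTop
      (𝓝 (∫ x in (0 : ℝ)..u, f x)) := by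
  rcases hu.eq_or_lt with rfl | hu
  · simp
  have hlim : Tendsto (fun n : ℕ => u / n * (f u - f 0)) atTop (𝓝 0) := by
    have : Tendsto (fun n : ℕ => u / (n : ℝ)) atTop (𝓝 0) :=
      tendsto_const_nhds.div_atTop tendsto_natCast_atTop_atTop
    simpa using this.mul_const (f u - f 0)
  rw [tendsto_iff_dist_tendsto_zero]
  refine squeeze_zero' (Eventually.of_forall fun _ => dist_nonneg) ?_ hlim
  filter_upwards [eventually_gt_atTop 0] with n hn
  have hn' : (0 : ℝ) < n := by exact_mod_cast hn
  have hδ : 0 < u / n := by positivity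
  have hmono : MonotoneOn (fun x => f (u / n * x)) (Icc (0 : ℝ) (0 + n)) := by
    have hmem : ∀ x ∈ Icc (0 : ℝ) (0 + n), u / n * x ∈ Icc 0 u := by
      intro x hx
      rw [zero_add] at hx
      refine ⟨mul_nonneg hδ.le hx.1, ?_⟩
      calc u / n * x ≤ u / n * n := by gcongr; exact hx.2
        _ = u := by field_simp
    exact fun x hx y hy hxy => hf (hmem x hx) (hmem y hy) (by gcongr)
  have h1 := hmono.sum_le_integral
  have h2 := hmono.integral_le_sum
  simp only [zero_add] at h1 h2
  have h3 : u / n * ∫ x in (0 : ℝ)..n, f (u / n * x) = ∫ x in (0 : ℝ)..u, f x := by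
    have h := intervalIntegral.mul_integral_comp_mul_left (f := f) (a := 0) (b := n) (u / n)
    rw [mul_zero] at h
    rw [h]
    congr 1
    field_simp
  have h4 : ∑ i ∈ Finset.range n, f (u / n * ((i + 1 : ℕ) : ℝ)) =
      (∑ i ∈ Finset.range n, f (u / n * i)) + (f u - f 0) := by
    have h5 := Finset.sum_range_succ (fun i : ℕ => f (u / n * i)) n
    have h6 := Finset.sum_range_succ' (fun i : ℕ => f (u / n * i)) n
    have h7 : u / n * n = u := by field_simp
    rw [h7] at h5
    simp only [Nat.cast_zero, mul_zero] at h6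
    linarith
  rw [h4] at h2
  rw [← h3, Real.dist_eq, ← mul_sub, abs_mul, abs_of_pos hδ]
  refine mul_le_mul_of_nonneg_left ?_ hδ.le
  rw [abs_le]
  constructor <;> linarith

namespace IsSubordinator

/-- The `σ`-algebra generated by the process up to time `s`. -/
abbrev past {Ω : Type*} (ξ : ℝ≥0 → Ω → ℝ≥0∞) (s : ℝ≥0) : MeasurableSpace Ω :=
  ⨆ r : {r : ℝ≥0 // r ≤ s}, MeasurableSpace.comap (ξ r) (inferInstance : MeasurableSpace ℝ≥0∞)

theorem measurable_past {Ω : Type*} (ξ : ℝ≥0 → Ω → ℝ≥0∞) {r s : ℝ≥0} (hr : r ≤ s) :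
    Measurable[past ξ s] (ξ r) :=
  (comap_measurable (ξ r)).mono
    (le_iSup (fun r : {r : ℝ≥0 // r ≤ s} => MeasurableSpace.comap (ξ r)
      (inferInstance : MeasurableSpace ℝ≥0∞)) ⟨r, hr⟩) le_rfl

theorem past_le {Ω : Type*} [MeasurableSpace Ω] {P : Measure Ω} {ξ : ℝ≥0 → Ω → ℝ≥0∞}
    (hξ : IsSubordinator ξ P) (s : ℝ≥0) : past ξ s ≤ ‹MeasurableSpace Ω› :=
  iSup_le fun r => (hξ.measurable r).comap_le

variable {Ω : Type*} [MeasurableSpace Ω] {P : Measure Ω} {ξ : ℝ≥0 → Ω → ℝ≥0∞}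

theorem tendsto_expNeg_nhdsGE (hξ : IsSubordinator ξ P) :
    ∀ᵐ ω ∂P, ∀ q : ℝ, 0 ≤ q → Tendsto (fun n : ℕ => expNeg q (ξ (1 / ((n : ℝ≥0) + 1)) ω)) atTop
      (𝓝 1) := by
  filter_upwards [hξ.right_cont, hξ.zero] with ω hω h0 q hq
  have hu : Tendsto (fun n : ℕ => 1 / ((n : ℝ≥0) + 1)) atTop (𝓝[Ici 0] 0) :=
    tendsto_nhdsWithin_iff.2 ⟨tendsto_one_div_add_atTop_nhds_zero_nat,
      Eventually.of_forall fun n => mem_Ici.2 zero_le⟩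
  have h1 : Tendsto (fun n : ℕ => ξ (1 / ((n : ℝ≥0) + 1)) ω) atTop (𝓝 0) := by
    have := (hω 0).tendsto.comp hu
    rwa [h0] at this
  rcases hq.eq_or_lt with rfl | hq
  · have h2 : ∀ᶠ n : ℕ in atTop, ξ (1 / ((n : ℝ≥0) + 1)) ω < ∞ :=
      h1.eventually (gt_mem_nhds ENNReal.zero_lt_top)
    refine tendsto_const_nhds.congr' ?_
    filter_upwards [h2] with n hn
    rw [expNeg_of_ne_top _ hn.ne]
    simp
  · have := ((continuous_expNeg hq).tendsto 0).comp h1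
    rwa [expNeg_zero_right] at this

/-- The increment axiom only concerns events. For fixed H it says that the measure with density
H(increment) and a multiple of P, both restricted to {ξ_s < ∞}, agree on the past; hence they
integrate every past-measurable G alike. -/
theorem lintegral_mul_increment (hξ : IsSubordinator ξ P) (s t : ℝ≥0) {G : Ω → ℝ≥0∞}
    (hG : Measurable[past ξ s] G) {H : ℝ≥0∞ → ℝ≥0∞} (hH : Measurable H) :
    ∫⁻ ω in {ω | ξ s ω < ∞}, G ω * H (ξ (s + t) ω - ξ s ω) ∂P =
      (∫⁻ ω in {ω | ξ s ω < ∞}, G ω ∂P) * ∫⁻ ω, H (ξ t ω) ∂P := by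
  set D : Set Ω := {ω | ξ s ω < ∞}
  have hmi : Measurable fun ω => ξ (s + t) ω - ξ s ω :=
    (hξ.measurable (s + t)).sub (hξ.measurable s)
  have hD : MeasurableSet D := measurableSet_lt (hξ.measurable s) measurable_const
  set c : ℝ≥0∞ := ∫⁻ ω, H (ξ t ω) ∂P
  have hHi : Measurable fun ω => H (ξ (s + t) ω - ξ s ω) := hH.comp hmi
  have hle := hξ.past_le s
  have htrim : ((P.restrict D).withDensity fun ω => H (ξ (s + t) ω - ξ s ω)).trim hle =
      (c • P.restrict D).trim hle := by
    refine @Measure.ext _ (past ξ s) _ _ fun A hA => ?_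
    rw [trim_measurableSet_eq hle hA, trim_measurableSet_eq hle hA,
      withDensity_apply _ (hle A hA), Measure.restrict_restrict (hle A hA), Measure.smul_apply,
      Measure.restrict_apply (hle A hA), smul_eq_mul]
    have hmap : (P.restrict (A ∩ D)).map (fun ω => ξ (s + t) ω - ξ s ω) =
        P (A ∩ D) • P.map (ξ t) := by
      ext B hB
      rw [Measure.map_apply hmi hB, Measure.restrict_apply (hmi hB), Measure.smul_apply,
        Measure.map_apply (hξ.measurable t) hB, smul_eq_mul, inter_comm]
      exact hξ.increments s t A B hA hB
    rw [← lintegral_map (f := H) hH hmi, hmap, lintegral_smul_measure,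
      lintegral_map hH (hξ.measurable t), smul_eq_mul, mul_comm]
  have h1 := lintegral_trim (μ := (P.restrict D).withDensity
    fun ω => H (ξ (s + t) ω - ξ s ω)) hle hG
  rw [htrim, lintegral_trim hle hG, lintegral_smul_measure,
    lintegral_withDensity_eq_lintegral_mul _ hHi (hG.mono hle le_rfl), smul_eq_mul] at h1
  rw [mul_comm, h1]
  exact lintegral_congr fun ω => mul_comm _ _

/-- The factor e^{-qξ_s} vanishes on {ξ_s = ∞}, so the restriction to the event of being alive can
be dropped on both sides. -/
theorem lintegral_mul_expNeg_add (hξ : IsSubordinator ξ P) (s t : ℝ≥0) {G : Ω → ℝ≥0∞}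
    (hG : Measurable[past ξ s] G) (q : ℝ) :
    ∫⁻ ω, G ω * ENNReal.ofReal (expNeg q (ξ (s + t) ω)) ∂P =
      (∫⁻ ω, G ω * ENNReal.ofReal (expNeg q (ξ s ω)) ∂P) *
        ∫⁻ ω, ENNReal.ofReal (expNeg q (ξ t ω)) ∂P := by
  have hD : MeasurableSet {ω | ξ s ω < ∞} := measurableSet_lt (hξ.measurable s) measurable_const
  have hG' : Measurable[past ξ s] fun ω => G ω * ENNReal.ofReal (expNeg q (ξ s ω)) :=
    hG.mul (ENNReal.measurable_ofReal.comp
      ((measurable_expNeg q).comp (measurable_past ξ le_rfl)))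
  have h := hξ.lintegral_mul_increment s t hG' (H := fun x => ENNReal.ofReal (expNeg q x))
    (by fun_prop)
  have e1 : ∫⁻ ω in {ω | ξ s ω < ∞}, G ω * ENNReal.ofReal (expNeg q (ξ s ω)) ∂P =
      ∫⁻ ω, G ω * ENNReal.ofReal (expNeg q (ξ s ω)) ∂P := by
    refine setLIntegral_eq_of_support_subset fun ω hω => ?_
    by_contra hc
    have : ξ s ω = ∞ := not_lt_top_iff.1 hc
    simp [this, expNeg_top] at hω
  have e2 : ∫⁻ ω in {ω | ξ s ω < ∞}, G ω * ENNReal.ofReal (expNeg q (ξ s ω)) *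
      ENNReal.ofReal (expNeg q (ξ (s + t) ω - ξ s ω)) ∂P =
      ∫⁻ ω, G ω * ENNReal.ofReal (expNeg q (ξ (s + t) ω)) ∂P := by
    have e3 : ∫⁻ ω, G ω * ENNReal.ofReal (expNeg q (ξ (s + t) ω)) ∂P =
        ∫⁻ ω, G ω * ENNReal.ofReal (expNeg q (ξ s ω)) *
          ENNReal.ofReal (expNeg q (ξ (s + t) ω - ξ s ω)) ∂P := by
      refine lintegral_congr_ae ?_
      filter_upwards [hξ.mono] with ω hω
      have hle : ξ s ω ≤ ξ (s + t) ω := hω (self_le_add_right s t)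
      rw [mul_assoc, ← ENNReal.ofReal_mul (expNeg_nonneg _ _), ← expNeg_add_right,
        add_tsub_cancel_of_le hle]
    rw [e3]
    refine setLIntegral_eq_of_support_subset fun ω hω => ?_
    by_contra hc
    have : ξ s ω = ∞ := not_lt_top_iff.1 hc
    simp [this, expNeg_top] at hω
  rw [e1, e2] at h
  exact h

variable [IsProbabilityMeasure P]

theorem integrable_expNeg (hξ : IsSubordinator ξ P) {q : ℝ} (hq : 0 ≤ q) (t : ℝ≥0) :
    Integrable (fun ω => expNeg q (ξ t ω)) P := _root_.integrable_expNeg hq (hξ.measurable t)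

theorem integral_mul_expNeg_add (hξ : IsSubordinator ξ P) (s t : ℝ≥0) {G : Ω → ℝ}
    (hG : Measurable[past ξ s] G) (hG0 : ∀ ω, 0 ≤ G ω) (hG1 : ∀ ω, G ω ≤ 1) {q : ℝ} (hq : 0 ≤ q) :
    ∫ ω, G ω * expNeg q (ξ (s + t) ω) ∂P =
      (∫ ω, G ω * expNeg q (ξ s ω) ∂P) * ∫ ω, expNeg q (ξ t ω) ∂P := by
  have hGm : Measurable G := hG.mono (hξ.past_le s) le_rfl
  have hI : ∀ r, Integrable (fun ω => G ω * expNeg q (ξ r ω)) P := fun r =>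
    (hξ.integrable_expNeg hq r).bdd_mul (c := 1) hGm.aestronglyMeasurable
      (ae_of_all _ fun ω => by rw [Real.norm_of_nonneg (hG0 ω)]; exact hG1 ω)
  have h := hξ.lintegral_mul_expNeg_add s t (G := fun ω => ENNReal.ofReal (G ω))
    (ENNReal.measurable_ofReal.comp hG) q
  have e : ∀ r, ∫⁻ ω, ENNReal.ofReal (G ω) * ENNReal.ofReal (expNeg q (ξ r ω)) ∂P =
      ENNReal.ofReal (∫ ω, G ω * expNeg q (ξ r ω) ∂P) := by
    intro r
    rw [ofReal_integral_eq_lintegral_ofReal (hI r)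
      (ae_of_all _ fun ω => mul_nonneg (hG0 ω) (expNeg_nonneg _ _))]
    exact lintegral_congr fun ω => (ENNReal.ofReal_mul (hG0 ω)).symm
  have hnn : ∀ r, 0 ≤ ∫ ω, G ω * expNeg q (ξ r ω) ∂P := fun r =>
    integral_nonneg fun ω => mul_nonneg (hG0 ω) (expNeg_nonneg _ _)
  rw [e, e, ← ofReal_integral_eq_lintegral_ofReal (hξ.integrable_expNeg hq t)
    (ae_of_all _ fun ω => expNeg_nonneg _ _), ← ENNReal.ofReal_mul (hnn s)] at h
  exact (ENNReal.ofReal_eq_ofReal_iff (hnn _)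
    (mul_nonneg (hnn _) (integral_nonneg fun ω => expNeg_nonneg _ _))).1 h

/-- By right-continuity at 0 the expectation is positive for some small δ > 0, by multiplicativity
for all multiples of δ, and by monotonicity for all t. The logarithm defining φ is thus never that
of 0. -/
theorem integral_expNeg_pos (hξ : IsSubordinator ξ P) {q : ℝ} (hq : 0 ≤ q) (t : ℝ≥0) :
    0 < ∫ ω, expNeg q (ξ t ω) ∂P := by
  have hmul : ∀ s t, ∫ ω, expNeg q (ξ (s + t) ω) ∂P =
      (∫ ω, expNeg q (ξ s ω) ∂P) * ∫ ω, expNeg q (ξ t ω) ∂P := by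
    intro s t
    have := hξ.integral_mul_expNeg_add s t (G := fun _ => 1) measurable_const
      (fun _ => zero_le_one) (fun _ => le_rfl) hq
    simpa using this
  have hlim : Tendsto (fun n : ℕ => ∫ ω, expNeg q (ξ (1 / ((n : ℝ≥0) + 1)) ω) ∂P) atTop
      (𝓝 (∫ _, (1 : ℝ) ∂P)) := by
    refine tendsto_integral_of_dominated_convergence (fun _ => 1) (fun n =>
      (hξ.integrable_expNeg hq _).aestronglyMeasurable) (integrable_const _)
      (fun n => ae_of_all _ fun ω => ?_) ?_
    · rw [Real.norm_of_nonneg (expNeg_nonneg _ _)]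
      exact expNeg_le_one hq _
    · filter_upwards [hξ.tendsto_expNeg_nhdsGE] with ω hω using hω q hq
  have hone : ∫ _, (1 : ℝ) ∂P = 1 := by simp
  rw [hone] at hlim
  obtain ⟨n, hn⟩ := (hlim.eventually (lt_mem_nhds zero_lt_one)).exists
  set δ : ℝ≥0 := 1 / ((n : ℝ≥0) + 1) with hδ
  have hpow : ∀ k : ℕ, 0 < ∫ ω, expNeg q (ξ ((k + 1 : ℕ) * δ) ω) ∂P := by
    intro k
    induction k with
    | zero => simpa using hn
    | succ k ih =>
      rw [Nat.cast_succ, add_mul, one_mul, hmul]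
      exact mul_pos ih hn
  obtain ⟨k, hk⟩ := exists_nat_ge (t * (n + 1))
  refine (hpow k).trans_le (integral_mono_ae (hξ.integrable_expNeg hq _)
    (hξ.integrable_expNeg hq _) ?_)
  filter_upwards [hξ.mono] with ω hω
  refine expNeg_antitone hq (hω ?_)
  have h1 : t ≤ k * δ := by
    rw [hδ, mul_one_div, le_div_iff₀ (by positivity)]
    exact hk
  refine h1.trans ?_
  gcongr
  simp

theorem integral_expNeg_eq (hξ : IsSubordinator ξ P) {q : ℝ} (hq : 0 ≤ q) (t : ℝ≥0) :
    ∫ ω, expNeg q (ξ t ω) ∂P = Real.exp (-(t * laplaceExponent ξ P q)) := by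
  have h := eq_exp_of_antitone_of_mul (m := fun t => ∫ ω, expNeg q (ξ t ω) ∂P) ?_ ?_
    (hξ.integral_expNeg_pos hq) t
  · rw [h, laplaceExponent]
    ring_nf
  · intro s t hst
    refine integral_mono_ae (hξ.integrable_expNeg hq _) (hξ.integrable_expNeg hq _) ?_
    filter_upwards [hξ.mono] with ω hω using expNeg_antitone hq (hω hst)
  · intro s t
    have := hξ.integral_mul_expNeg_add s t (G := fun _ => 1) measurable_const
      (fun _ => zero_le_one) (fun _ => le_rfl) hq
    simpa using this

theorem laplaceExponent_nonneg (hξ : IsSubordinator ξ P) {q : ℝ} (hq : 0 ≤ q) :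
    0 ≤ laplaceExponent ξ P q := by
  refine neg_nonneg.2 (Real.log_nonpos (hξ.integral_expNeg_pos hq 1).le ?_)
  calc ∫ ω, expNeg q (ξ 1 ω) ∂P ≤ ∫ _, (1 : ℝ) ∂P :=
        integral_mono (hξ.integrable_expNeg hq 1) (integrable_const _) fun ω => expNeg_le_one hq _
    _ = 1 := by simp

theorem laplaceExponent_monotoneOn (hξ : IsSubordinator ξ P) :
    MonotoneOn (laplaceExponent ξ P) (Ici 0) := by
  intro p hp q hq hpq
  refine neg_le_neg (Real.log_le_log (hξ.integral_expNeg_pos hq 1) ?_)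
  exact integral_mono (hξ.integrable_expNeg hq 1) (hξ.integrable_expNeg hp 1)
    fun ω => expNeg_le_of_le hpq _

theorem laplaceExponent_continuousOn (hξ : IsSubordinator ξ P) :
    ContinuousOn (laplaceExponent ξ P) (Ici 0) := by
  refine ContinuousOn.neg (ContinuousOn.log ?_ fun q hq => (hξ.integral_expNeg_pos hq 1).ne')
  intro q hq
  refine continuousWithinAt_of_dominated (bound := fun _ => 1) ?_ ?_ (integrable_const _) ?_
  · filter_upwards [self_mem_nhdsWithin] with p hp
    exact (hξ.integrable_expNeg hp 1).aestronglyMeasurable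
  · filter_upwards [self_mem_nhdsWithin] with p hp
    refine ae_of_all _ fun ω => ?_
    rw [Real.norm_of_nonneg (expNeg_nonneg _ _)]
    exact expNeg_le_one hp _
  · refine ae_of_all _ fun ω => ?_
    by_cases hx : ξ 1 ω = ∞
    · simp only [hx, expNeg_top]
      exact continuousWithinAt_const
    · simp only [expNeg_of_ne_top _ hx]
      exact Continuous.continuousWithinAt (by fun_prop)

theorem laplaceExponent_pos (hξ : IsSubordinator ξ P)
    (hne : ¬ ∀ t : ℝ≥0, ∀ᵐ ω ∂P, ξ t ω = 0) {q : ℝ} (hq : 0 < q) :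
    0 < laplaceExponent ξ P q := by
  refine lt_of_le_of_ne (hξ.laplaceExponent_nonneg hq.le) fun h0 => hne fun t => ?_
  have h1 := hξ.integral_expNeg_eq hq.le t
  rw [← h0, mul_zero, neg_zero, Real.exp_zero] at h1
  filter_upwards [ae_eq_zero_of_integral_expNeg (hξ.measurable t) hq.le h1] with ω hω
  exact expNeg_injective hq (hω.trans (expNeg_zero_right q).symm)

/-- Discrete form of the joint law of the area and the endpoint. Removing the last increment costs
e^{-δφ(q)}, and the last term of the sum then merges with the endpoint, replacing q by a + q in the
induction hypothesis. -/
theorem integral_expNeg_sum_mul_expNeg (hξ : IsSubordinator ξ P) {a : ℝ} (ha : 0 ≤ a) (δ : ℝ≥0)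
    (n : ℕ) {q : ℝ} (hq : 0 ≤ q) :
    ∫ ω, expNeg a (∑ j ∈ Finset.range n, ξ (δ * j) ω) * expNeg q (ξ (δ * n) ω) ∂P =
      Real.exp (-(δ * ∑ k ∈ Finset.range n, laplaceExponent ξ P (q + a * k))) := by
  induction n generalizing q with
  | zero =>
    simp only [Finset.range_zero, Finset.sum_empty, expNeg_zero_right, one_mul, Nat.cast_zero,
      mul_zero, neg_zero, Real.exp_zero]
    rw [hξ.integral_expNeg_eq hq]
    simp
  | succ n ih =>
    have hG : Measurable[past ξ (δ * n)] fun ω =>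
        expNeg a (∑ j ∈ Finset.range (n + 1), ξ (δ * j) ω) := by
      refine (measurable_expNeg a).comp (Finset.measurable_sum _ fun j hj => ?_)
      refine measurable_past ξ ?_
      gcongr
      exact Nat.lt_succ_iff.1 (Finset.mem_range.1 hj)
    have h1 := hξ.integral_mul_expNeg_add (δ * n) δ hG (fun ω => expNeg_nonneg _ _)
      (fun ω => expNeg_le_one ha _) hq
    have e : δ * ((n + 1 : ℕ) : ℝ≥0) = δ * n + δ := by push_cast; ring
    rw [e, h1]
    simp only [Finset.sum_range_succ, expNeg_add_right, mul_assoc, ← expNeg_add_left]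
    have h2 := ih (q := a + q) (by positivity)
    rw [h2, hξ.integral_expNeg_eq hq, ← Real.exp_add]
    congr 1
    have h3 := Finset.sum_range_succ' (fun k : ℕ => laplaceExponent ξ P (q + a * k)) n
    rw [Finset.sum_range_succ] at h3
    rw [h3]
    have h4 : ∀ k : ℕ, a + q + a * k = q + a * ((k + 1 : ℕ) : ℝ) := fun k => by push_cast; ring
    simp only [h4]
    push_cast
    simp only [mul_zero, add_zero]
    ring

end IsSubordinator

/-! ### Area and time change along a single path -/

/-- Non-decreasing right-continuous paths with values in `[0, ∞]`. -/
structure IsMonotoneCadlag (x : ℝ≥0 → ℝ≥0∞) : Prop where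
  mono : Monotone x
  right_cont : ∀ t, ContinuousWithinAt x (Ici t) t

/-- The area `∫_0^u x_r dr` under a path. -/
noncomputable def area (x : ℝ≥0 → ℝ≥0∞) (u : ℝ≥0) : ℝ≥0∞ :=
  ∫⁻ r in Icc (0 : ℝ) u, x r.toNNReal

theorem area_mono (x : ℝ≥0 → ℝ≥0∞) : Monotone (area x) := fun _ _ huv =>
  lintegral_mono_set (Icc_subset_Icc_right (by exact_mod_cast huv))

/-- The time-changed path, as an infimum. -/
noncomputable def areaChanged (x : ℝ≥0 → ℝ≥0∞) (t : ℝ≥0) : ℝ≥0∞ :=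
  ⨅ (u : ℝ≥0) (_ : (t : ℝ≥0∞) < area x u), x u

theorem measurable_expNeg_areaChanged (x : ℝ≥0 → ℝ≥0∞) {q : ℝ} (hq : 0 < q) :
    Measurable fun t : ℝ => expNeg q (areaChanged x t.toNNReal) := by
  refine Antitone.measurable fun s t hst => expNeg_antitone hq.le ?_
  refine iInf_mono fun u => iInf_mono' fun hu => ⟨lt_of_le_of_lt ?_ hu, le_rfl⟩
  exact_mod_cast Real.toNNReal_le_toNNReal hst

namespace IsMonotoneCadlag

variable {x : ℝ≥0 → ℝ≥0∞}

/-- A non-decreasing right-continuous path takes at an infimum of times the infimum of its values.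
The empty infimum ∞ agrees with the convention ξ_∞ = ∞. -/
theorem timeChanged_eq {Ω : Type*} {ξ : ℝ≥0 → Ω → ℝ≥0∞} {ω : Ω}
    (hx : IsMonotoneCadlag fun t => ξ t ω) (t : ℝ≥0) :
    timeChanged ξ t ω = areaChanged (fun t => ξ t ω) t := by
  set x : ℝ≥0 → ℝ≥0∞ := fun t => ξ t ω with hxdef
  have hT : timeChange ξ t ω = ⨅ (u : ℝ≥0) (_ : (t : ℝ≥0∞) < area x u), (u : ℝ≥0∞) := rfl
  unfold timeChanged
  by_cases hS : ∃ u : ℝ≥0, (t : ℝ≥0∞) < area x u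
  · have hne : {u : ℝ≥0 | (t : ℝ≥0∞) < area x u}.Nonempty := hS
    have hT' : timeChange ξ t ω = ((sInf {u : ℝ≥0 | (t : ℝ≥0∞) < area x u} : ℝ≥0) : ℝ≥0∞) := by
      rw [hT, ENNReal.coe_sInf hne]
      rfl
    set ρ : ℝ≥0 := sInf {u : ℝ≥0 | (t : ℝ≥0∞) < area x u}
    rw [hT', if_neg ENNReal.coe_ne_top, ENNReal.toNNReal_coe]
    refine le_antisymm (le_iInf₂ fun u hu => hx.mono (csInf_le (OrderBot.bddBelow _) hu)) ?_
    refine le_of_forall_gt fun a ha => ?_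
    have h1 : ∀ᶠ s in 𝓝[≥] ρ, x s < a := (hx.right_cont ρ).eventually (gt_mem_nhds ha)
    obtain ⟨b, hb, hb'⟩ := (mem_nhdsGE_iff_exists_Ico_subset).1 h1
    obtain ⟨u, hu, hub⟩ := exists_lt_of_csInf_lt hne hb
    have h2 : x u < a := hb' ⟨csInf_le (OrderBot.bddBelow _) hu, hub⟩
    exact (iInf₂_le u hu).trans_lt h2
  · have hT' : timeChange ξ t ω = ∞ := by
      rw [hT]
      exact iInf₂_eq_top.2 fun u hu => absurd ⟨u, hu⟩ hS
    rw [if_pos hT']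
    exact (iInf₂_eq_top.2 fun u hu => absurd ⟨u, hu⟩ hS).symm

/-- On `{u : x u < a}`, one may move slightly to the right to a point of a dense sequence. -/
theorem exists_denseSeq_gt (hx : IsMonotoneCadlag x) {U : Set ℝ≥0∞} (hU : IsOpen U) {u : ℝ≥0}
    (hu : x u ∈ U) : ∃ n : ℕ, u < TopologicalSpace.denseSeq ℝ≥0 n ∧
      x (TopologicalSpace.denseSeq ℝ≥0 n) ∈ U := by
  have h1 : ∀ᶠ s in 𝓝[≥] u, x s ∈ U := (hx.right_cont u).eventually (hU.mem_nhds hu)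
  obtain ⟨b, hb, hb'⟩ := (mem_nhdsGE_iff_exists_Ico_subset).1 h1
  obtain ⟨_, ⟨n, rfl⟩, hn⟩ := (TopologicalSpace.denseRange_denseSeq ℝ≥0).exists_between hb
  exact ⟨n, hn.1, hb' ⟨hn.1.le, hn.2⟩⟩

/-- Superlevel sets become countable unions of explicit sets. Measurability, right-continuity in t
and the change of variables all rest on this. The restriction c ≥ 0 excludes the value ∞, where the
exponential is 0. -/
theorem lt_expNeg_areaChanged_iff (hx : IsMonotoneCadlag x) {q : ℝ} (hq : 0 < q) {c : ℝ}
    (hc : 0 ≤ c) (t : ℝ≥0) : c < expNeg q (areaChanged x t) ↔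
      ∃ n : ℕ, (t : ℝ≥0∞) < area x (TopologicalSpace.denseSeq ℝ≥0 n) ∧
        c < expNeg q (x (TopologicalSpace.denseSeq ℝ≥0 n)) := by
  have hU : IsOpen {y | c < expNeg q y} := isOpen_lt continuous_const (continuous_expNeg hq)
  constructor
  · intro h
    have hlt : areaChanged x t < ∞ := by
      refine lt_top_iff_ne_top.2 fun h0 => ?_
      rw [h0, expNeg_top] at h
      exact not_lt.2 hc h
    have h1 : {y | c < expNeg q y} ∈ 𝓝[≥] (areaChanged x t) :=
      mem_nhdsWithin_of_mem_nhds (hU.mem_nhds h)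
    obtain ⟨b, hb, hb'⟩ := (mem_nhdsGE_iff_exists_Ico_subset' hlt).1 h1
    have hb2 : areaChanged x t < b := hb
    simp only [areaChanged, iInf_lt_iff] at hb2
    obtain ⟨u, hu, hub⟩ := hb2
    have h2 : x u ∈ {y | c < expNeg q y} := hb' ⟨iInf₂_le u hu, hub⟩
    obtain ⟨n, hn, hn'⟩ := hx.exists_denseSeq_gt hU h2
    exact ⟨n, hu.trans_le (area_mono x hn.le), hn'⟩
  · rintro ⟨n, hn, hn'⟩
    exact hn'.trans_le (expNeg_antitone hq.le
      (iInf₂_le (f := fun u (_ : (t : ℝ≥0∞) < area x u) => x u) _ hn))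

theorem measurable_toReal (hx : IsMonotoneCadlag x) : Measurable fun s : ℝ => x s.toNNReal :=
  hx.mono.measurable.comp (by fun_prop)

theorem monotoneOn_toReal (hx : IsMonotoneCadlag x) {r : ℝ≥0} (hr : x r ≠ ∞) :
    MonotoneOn (fun s : ℝ => (x s.toNNReal).toReal) (Icc 0 (r : ℝ)) := by
  intro s _ t ht hst
  refine ENNReal.toReal_mono (ne_top_of_le_ne_top hr (hx.mono ?_)) (hx.mono ?_)
  · exact Real.toNNReal_le_iff_le_coe.2 ht.2
  · exact Real.toNNReal_le_toNNReal hst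

theorem intervalIntegrable_toReal (hx : IsMonotoneCadlag x) {r : ℝ≥0} (hr : x r ≠ ∞) :
    IntervalIntegrable (fun s : ℝ => (x s.toNNReal).toReal) volume 0 r := by
  refine MonotoneOn.intervalIntegrable ?_
  rw [uIcc_of_le r.coe_nonneg]
  exact hx.monotoneOn_toReal hr

theorem area_eq (hx : IsMonotoneCadlag x) {r : ℝ≥0} (hr : x r ≠ ∞) :
    area x r = ENNReal.ofReal (∫ s in (0 : ℝ)..r, (x s.toNNReal).toReal) := by
  have hint := (intervalIntegrable_iff_integrableOn_Icc_of_le r.coe_nonneg).1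
    (hx.intervalIntegrable_toReal hr)
  rw [intervalIntegral.integral_of_le r.coe_nonneg, ← integral_Icc_eq_integral_Ioc,
    ofReal_integral_eq_lintegral_ofReal hint (ae_of_all _ fun s => ENNReal.toReal_nonneg), area]
  refine setLIntegral_congr_fun measurableSet_Icc fun s hs => ?_
  refine (ENNReal.ofReal_toReal (ne_top_of_le_ne_top hr (hx.mono ?_))).symm
  exact Real.toNNReal_le_iff_le_coe.2 hs.2

theorem tendsto_riemann_sum_area (hx : IsMonotoneCadlag x) {a : ℝ} {u : ℝ≥0}
    (hu : x u ≠ ∞) :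
    Tendsto (fun n : ℕ => expNeg (a * (u / n : ℝ))
      (∑ j ∈ Finset.range n, x (u / n * j))) atTop (𝓝 (expNeg a (area x u))) := by
  have h1 := tendsto_riemann_sum_of_monotoneOn u.coe_nonneg (hx.monotoneOn_toReal hu)
  have hne : area x u ≠ ∞ := by
    rw [hx.area_eq hu]
    exact ENNReal.ofReal_ne_top
  have hint0 : 0 ≤ ∫ s in (0 : ℝ)..u, (x s.toNNReal).toReal :=
    intervalIntegral.integral_nonneg u.coe_nonneg fun s _ => ENNReal.toReal_nonneg
  rw [expNeg_of_ne_top _ hne, hx.area_eq hu, ENNReal.toReal_ofReal hint0]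
  refine ((Real.continuous_exp.tendsto _).comp (h1.const_mul a).neg).congr fun n => ?_
  have hfin : ∀ j ∈ Finset.range n, x (u / n * j) ≠ ∞ := by
    intro j hj
    refine ne_top_of_le_ne_top hu (hx.mono ?_)
    have hj' : j < n := Finset.mem_range.1 hj
    have hn : (0 : ℝ≥0) < n := by exact_mod_cast (Nat.zero_le j).trans_lt hj'
    rw [div_mul_eq_mul_div, div_le_iff₀ hn]
    gcongr
  rw [Function.comp_apply, expNeg_of_ne_top _ (ENNReal.sum_ne_top.2 hfin), ENNReal.toReal_sum hfin,
    mul_assoc]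
  have e : ∀ j : ℕ, ((u : ℝ) / n * j).toNNReal = u / n * j := by
    intro j
    have : ((u : ℝ) / n * j) = ((u / n * j : ℝ≥0) : ℝ) := by push_cast; rfl
    rw [this, Real.toNNReal_coe]
  simp only [e]

/-- The integrand is the right derivative of -e^{-aA_u}; a one-sided derivative is what
right-continuity of the path provides, and it suffices for the fundamental theorem of calculus. -/
theorem setLIntegral_exp_area (hx : IsMonotoneCadlag x) {a : ℝ} (ha : 0 < a) {r : ℝ≥0}
    (hr : x r ≠ ∞) :
    ∫⁻ u in Ioc (0 : ℝ) r, ENNReal.ofReal (a * (x u.toNNReal).toReal * expNeg a (area x u.toNNReal))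
      = ENNReal.ofReal (1 - expNeg a (area x r)) := by
  set f : ℝ → ℝ := fun s => (x s.toNNReal).toReal with hf
  set A : ℝ → ℝ := fun u => ∫ s in (0 : ℝ)..u, f s with hA
  have hxu : ∀ u ∈ Icc (0 : ℝ) r, x u.toNNReal ≠ ∞ := fun u hu =>
    ne_top_of_le_ne_top hr (hx.mono (Real.toNNReal_le_iff_le_coe.2 hu.2))
  have hfint := hx.intervalIntegrable_toReal hr
  have hAcont : ContinuousOn A (Icc 0 r) := by
    have := intervalIntegral.continuousOn_primitive_interval' hfint left_mem_uIcc
    rwa [uIcc_of_le r.coe_nonneg] at this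
  have hA0 : ∀ u, 0 ≤ u → 0 ≤ A u := fun u hu =>
    intervalIntegral.integral_nonneg hu fun s _ => ENNReal.toReal_nonneg
  have harea : ∀ u ∈ Icc (0 : ℝ) r, expNeg a (area x u.toNNReal) = Real.exp (-(a * A u)) := by
    intro u hu
    have h := hx.area_eq (hxu u hu)
    rw [Real.coe_toNNReal u hu.1] at h
    rw [h, expNeg_of_ne_top _ ENNReal.ofReal_ne_top, ENNReal.toReal_ofReal (hA0 u hu.1)]
  have hderiv : ∀ u ∈ Ioo (0 : ℝ) r, HasDerivWithinAt (fun u => -Real.exp (-(a * A u)))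
      (a * f u * Real.exp (-(a * A u))) (Ioi u) u := by
    intro u hu
    have hcont : ContinuousWithinAt f (Ioi u) u := by
      have h1 : ContinuousWithinAt (fun s : ℝ => x s.toNNReal) (Ici u) u := by
        refine ContinuousWithinAt.comp (t := Ici u.toNNReal) (hx.right_cont _)
          (continuous_real_toNNReal.continuousWithinAt) fun s hs => ?_
        exact Real.toNNReal_le_toNNReal hs
      have h2 : ContinuousWithinAt f (Ici u) u :=
        (ENNReal.tendsto_toReal (hxu u ⟨hu.1.le, hu.2.le⟩)).comp h1
      exact h2.mono Ioi_subset_Ici_self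
    have hmeas : StronglyMeasurableAtFilter f (𝓝[>] u) volume :=
      hx.measurable_toReal.ennreal_toReal.stronglyMeasurable.stronglyMeasurableAtFilter
    have hd : HasDerivWithinAt A (f u) (Ici u) u := by
      refine intervalIntegral.integral_hasDerivWithinAt_right ?_ hmeas hcont
      refine hfint.mono_set ?_
      rw [uIcc_of_le hu.1.le, uIcc_of_le r.coe_nonneg]
      exact Icc_subset_Icc_right hu.2.le
    have hd2 : HasDerivWithinAt (fun u => -Real.exp (-(a * A u)))
        (-(Real.exp (-(a * A u)) * -(a * f u))) (Ioi u) u :=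
      (((hd.mono Ioi_subset_Ici_self).const_mul a).neg.exp).neg
    exact hd2.congr_deriv (by ring)
  have hgcont : ContinuousOn (fun u => -Real.exp (-(a * A u))) (Icc 0 r) :=
    (Real.continuous_exp.comp_continuousOn (hAcont.const_smul a).neg).neg
  have hgint : IntervalIntegrable (fun u => a * f u * Real.exp (-(a * A u))) volume 0 r := by
    refine (hfint.const_mul a).mul_continuousOn ?_
    rw [uIcc_of_le r.coe_nonneg]
    exact Real.continuous_exp.comp_continuousOn (hAcont.const_smul a).neg
  have hftc := intervalIntegral.integral_eq_sub_of_hasDeriv_right_of_le r.coe_nonneg hgcont hderiv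
    hgint
  have hA00 : A 0 = 0 := by simp [A]
  rw [hA00, mul_zero, neg_zero, Real.exp_zero] at hftc
  have hr' := harea r ⟨r.coe_nonneg, le_rfl⟩
  rw [Real.toNNReal_coe] at hr'
  rw [hr', show 1 - Real.exp (-(a * A r)) = -Real.exp (-(a * A r)) - -1 by ring, ← hftc,
    intervalIntegral.integral_of_le r.coe_nonneg, ofReal_integral_eq_lintegral_ofReal]
  · refine setLIntegral_congr_fun measurableSet_Ioc fun u hu => ?_
    rw [harea u ⟨hu.1.le, hu.2⟩]
  · exact (intervalIntegrable_iff_integrableOn_Ioc_of_le r.coe_nonneg).1 hgint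
  · refine ae_of_all _ fun u => ?_
    have : 0 ≤ f u := ENNReal.toReal_nonneg
    positivity

theorem setLIntegral_exp_Ioo {a : ℝ} (ha : 0 < a) {y : ℝ} (hy : 0 ≤ y) :
    ∫⁻ t in Ioo (0 : ℝ) y, ENNReal.ofReal (a * Real.exp (-(a * t))) =
      ENNReal.ofReal (1 - Real.exp (-(a * y))) := by
  have hcont : Continuous fun t : ℝ => a * Real.exp (-(a * t)) := by fun_prop
  have h := intervalIntegral.integral_eq_sub_of_hasDerivAt (a := 0) (b := y)
    (f := fun t => -Real.exp (-(a * t))) (f' := fun t => a * Real.exp (-(a * t)))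
    (fun t _ => by
      have hd : HasDerivAt (fun t => -Real.exp (-(a * t)))
          (-(Real.exp (-(a * t)) * -(a * 1))) t :=
        (((hasDerivAt_id t).const_mul a).neg.exp).neg
      exact hd.congr_deriv (by ring)) (hcont.intervalIntegrable _ _)
  rw [setLIntegral_congr Ioo_ae_eq_Ioc, ← ofReal_integral_eq_lintegral_ofReal
    ((intervalIntegrable_iff_integrableOn_Ioc_of_le hy).1 (hcont.intervalIntegrable _ _))
    (ae_of_all _ fun t => by positivity), ← intervalIntegral.integral_of_le hy, h]
  congr 1
  simp
  ring

/-- Change of variables along the area under a path. -/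
theorem lintegral_expNeg_areaChanged (hx : IsMonotoneCadlag x) {a q : ℝ} (ha : 0 < a)
    (hq : 0 < q) :
    ∫⁻ t in Ioi (0 : ℝ), ENNReal.ofReal (a * Real.exp (-(a * t))) *
        ENNReal.ofReal (expNeg q (areaChanged x t.toNNReal)) =
      ∫⁻ u in Ioi (0 : ℝ),
        ENNReal.ofReal (a * (x u.toNNReal).toReal * expNeg a (area x u.toNNReal)) *
        ENNReal.ofReal (expNeg q (x u.toNNReal)) := by
  have hm1 : Measurable fun t : ℝ => ENNReal.ofReal (a * Real.exp (-(a * t))) := by fun_prop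
  have hmA : Measurable fun u : ℝ => area x u.toNNReal :=
    (area_mono x).measurable.comp (by fun_prop)
  have hm2 : Measurable fun u : ℝ =>
      ENNReal.ofReal (a * (x u.toNNReal).toReal * expNeg a (area x u.toNNReal)) :=
    ENNReal.measurable_ofReal.comp
      ((hx.measurable_toReal.ennreal_toReal.const_mul a).mul ((measurable_expNeg a).comp hmA))
  have hf1 := measurable_expNeg_areaChanged x hq
  have hf2 : Measurable fun u : ℝ => expNeg q (x u.toNNReal) :=
    (measurable_expNeg q).comp hx.measurable_toReal
  have e1 := lintegral_withDensity_eq_lintegral_mul (volume.restrict (Ioi (0 : ℝ))) hm1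
    hf1.ennreal_ofReal
  have e2 := lintegral_withDensity_eq_lintegral_mul (volume.restrict (Ioi (0 : ℝ))) hm2
    hf2.ennreal_ofReal
  simp only [Pi.mul_apply] at e1 e2
  -- Layer-cake formula: it is enough to compare, for each c > 0, the weighted measures of the
  -- superlevel sets, and no inverse of the area function is needed.
  rw [← e1, ← e2, lintegral_eq_lintegral_meas_lt _ (ae_of_all _ fun _ => expNeg_nonneg _ _)
    hf1.aemeasurable, lintegral_eq_lintegral_meas_lt _ (ae_of_all _ fun _ => expNeg_nonneg _ _)
    hf2.aemeasurable]
  refine setLIntegral_congr_fun measurableSet_Ioi fun c hc => ?_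
  have hc0 : 0 < c := hc
  have hU : IsOpen {y | c < expNeg q y} := isOpen_lt continuous_const (continuous_expNeg hq)
  have hm1' : MeasurableSet {t : ℝ | c < expNeg q (areaChanged x t.toNNReal)} :=
    measurableSet_lt measurable_const hf1
  have hm2' : MeasurableSet {u : ℝ | c < expNeg q (x u.toNNReal)} :=
    measurableSet_lt measurable_const hf2
  rw [withDensity_apply _ hm1', withDensity_apply _ hm2', Measure.restrict_restrict hm1',
    Measure.restrict_restrict hm2', ← withDensity_apply _ (hm1'.inter measurableSet_Ioi),
    ← withDensity_apply _ (hm2'.inter measurableSet_Ioi)]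
  let d : ℕ → ℝ≥0 := TopologicalSpace.denseSeq ℝ≥0
  let ι := {n : ℕ // c < expNeg q (x (d n))}
  have hfin : ∀ n : ι, x (d n) ≠ ∞ := by
    intro n hn
    have := n.2
    rw [hn, expNeg_top] at this
    exact hc0.not_gt this
  have hafin : ∀ n : ι, area x (d n) ≠ ∞ := fun n => by
    rw [hx.area_eq (hfin n)]
    exact ENNReal.ofReal_ne_top
  -- The two superlevel sets are directed unions of the intervals (0, A_d) and (0, d], over the same
  -- points d of the dense sequence. Matching intervals both have weight 1 - e^{-aA_d}.
  have hS1 : {t : ℝ | c < expNeg q (areaChanged x t.toNNReal)} ∩ Ioi 0 =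
      ⋃ n : ι, Ioo 0 (area x (d n)).toReal := by
    ext t
    simp only [mem_inter_iff, mem_ofPred_eq, mem_Ioi, mem_iUnion, mem_Ioo]
    rw [hx.lt_expNeg_areaChanged_iff hq hc0.le]
    constructor
    · rintro ⟨⟨n, hn, hn'⟩, ht⟩
      refine ⟨⟨n, hn'⟩, ht, ?_⟩
      rw [← ENNReal.ofReal_lt_iff_lt_toReal ht.le (hafin ⟨n, hn'⟩)]
      exact hn
    · rintro ⟨n, ht, hn⟩
      refine ⟨⟨n, ?_, n.2⟩, ht⟩
      exact (ENNReal.ofReal_lt_iff_lt_toReal ht.le (hafin n)).2 hn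
  have hS2 : {u : ℝ | c < expNeg q (x u.toNNReal)} ∩ Ioi 0 = ⋃ n : ι, Ioc 0 ((d n : ℝ≥0) : ℝ) := by
    ext u
    simp only [mem_inter_iff, mem_ofPred_eq, mem_Ioi, mem_iUnion, mem_Ioc]
    constructor
    · rintro ⟨hu, hu0⟩
      obtain ⟨n, hn, hn'⟩ := hx.exists_denseSeq_gt hU hu
      exact ⟨⟨n, hn'⟩, hu0, (Real.toNNReal_le_iff_le_coe).1 hn.le⟩
    · rintro ⟨n, hu0, hun⟩
      refine ⟨n.2.trans_le (expNeg_antitone hq.le (hx.mono ?_)), hu0⟩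
      exact Real.toNNReal_le_iff_le_coe.2 hun
  have hdir1 : Directed (· ⊆ ·) fun n : ι => Ioo 0 (area x (d n)).toReal := by
    intro i j
    rcases le_total (d i) (d j) with h | h
    · exact ⟨j, Ioo_subset_Ioo_right (ENNReal.toReal_mono (hafin j) (area_mono x h)), Subset.rfl⟩
    · exact ⟨i, Subset.rfl, Ioo_subset_Ioo_right (ENNReal.toReal_mono (hafin i) (area_mono x h))⟩
  have hdir2 : Directed (· ⊆ ·) fun n : ι => Ioc 0 ((d n : ℝ≥0) : ℝ) := by
    intro i j
    rcases le_total (d i) (d j) with h | h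
    · exact ⟨j, Ioc_subset_Ioc_right (by exact_mod_cast h), Subset.rfl⟩
    · exact ⟨i, Subset.rfl, Ioc_subset_Ioc_right (by exact_mod_cast h)⟩
  rw [hS1, hS2, hdir1.measure_iUnion, hdir2.measure_iUnion]
  refine iSup_congr fun n => ?_
  rw [withDensity_apply _ measurableSet_Ioo, withDensity_apply _ measurableSet_Ioc,
    setLIntegral_exp_Ioo ha ENNReal.toReal_nonneg, hx.setLIntegral_exp_area ha (hfin n),
    expNeg_of_ne_top _ (hafin n)]

end IsMonotoneCadlag

/-! ### Joint measurability in ω and t -/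

section Measurability

variable {Ω : Type*} [MeasurableSpace Ω] {η : ℝ≥0 → Ω → ℝ≥0∞}

theorem measurable_uncurry_of_isMonotoneCadlag (hη : ∀ t, Measurable (η t))
    (hp : ∀ ω, IsMonotoneCadlag fun t => η t ω) :
    Measurable fun p : Ω × ℝ≥0 => η p.2 p.1 := by
  refine measurable_of_Iio fun a => ?_
  have : (fun p : Ω × ℝ≥0 => η p.2 p.1) ⁻¹' Iio a =
      ⋃ n : ℕ, {p : Ω × ℝ≥0 | p.2 < TopologicalSpace.denseSeq ℝ≥0 n} ∩
        {p | η (TopologicalSpace.denseSeq ℝ≥0 n) p.1 < a} := by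
    ext p
    simp only [mem_preimage, mem_Iio, mem_iUnion, mem_inter_iff, mem_ofPred_eq]
    constructor
    · exact fun h => (hp p.1).exists_denseSeq_gt isOpen_Iio h
    · rintro ⟨n, hn, hn'⟩
      exact ((hp p.1).mono hn.le).trans_lt hn'
  rw [this]
  refine MeasurableSet.iUnion fun n => ?_
  exact (measurableSet_lt measurable_snd measurable_const).inter
    (measurableSet_lt ((hη _).comp measurable_fst) measurable_const)

theorem measurable_area (hη : ∀ t, Measurable (η t))
    (hp : ∀ ω, IsMonotoneCadlag fun t => η t ω) :
    Measurable fun p : Ω × ℝ≥0 => area (fun t => η t p.1) p.2 := by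
  have hS : MeasurableSet {z : (Ω × ℝ≥0) × ℝ | z.2 ∈ Icc (0 : ℝ) z.1.2} :=
    (measurableSet_le measurable_const measurable_snd).inter
      (measurableSet_le measurable_snd (by fun_prop))
  have hF : Measurable fun z : (Ω × ℝ≥0) × ℝ =>
      {z : (Ω × ℝ≥0) × ℝ | z.2 ∈ Icc (0 : ℝ) z.1.2}.indicator
        (fun z => η z.2.toNNReal z.1.1) z := by
    refine Measurable.indicator ?_ hS
    exact (measurable_uncurry_of_isMonotoneCadlag hη hp).comp
      (f := fun z : (Ω × ℝ≥0) × ℝ => (z.1.1, z.2.toNNReal)) (by fun_prop)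
  have := hF.lintegral_prod_right' (ν := volume)
  convert this using 2 with p
  rw [area, ← lintegral_indicator measurableSet_Icc]
  rfl

theorem measurable_expNeg_areaChanged_uncurry (hη : ∀ t, Measurable (η t))
    (hp : ∀ ω, IsMonotoneCadlag fun t => η t ω) {q : ℝ} (hq : 0 < q) :
    Measurable fun p : Ω × ℝ≥0 => expNeg q (areaChanged (fun t => η t p.1) p.2) := by
  refine measurable_of_Ioi fun c => ?_
  rcases lt_or_ge c 0 with hc | hc
  · convert MeasurableSet.univ
    ext p
    simpa using hc.trans_le (expNeg_nonneg _ _)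
  · have : (fun p : Ω × ℝ≥0 => expNeg q (areaChanged (fun t => η t p.1) p.2)) ⁻¹' Ioi c =
        ⋃ n : ℕ, {p : Ω × ℝ≥0 | (p.2 : ℝ≥0∞) <
          area (fun t => η t p.1) (TopologicalSpace.denseSeq ℝ≥0 n)} ∩
          {p | c < expNeg q (η (TopologicalSpace.denseSeq ℝ≥0 n) p.1)} := by
      ext p
      simp only [mem_preimage, mem_Ioi, mem_iUnion, mem_inter_iff, mem_ofPred_eq]
      exact (hp p.1).lt_expNeg_areaChanged_iff hq hc p.2
    rw [this]
    refine MeasurableSet.iUnion fun n => (measurableSet_lt (by fun_prop) ?_).inter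
      (measurableSet_lt measurable_const
        ((measurable_expNeg q).comp ((hη _).comp measurable_fst)))
    exact (measurable_area hη hp).comp (f := fun p : Ω × ℝ≥0 =>
      (p.1, TopologicalSpace.denseSeq ℝ≥0 n)) (by fun_prop)

end Measurability

/-! ### Joint Laplace transform of the process and its area -/

theorem hasDerivAt_primitive {φ : ℝ → ℝ} (hc : ContinuousOn φ (Ici 0)) {q : ℝ} (hq : 0 < q) :
    HasDerivAt (primitive φ) (φ q) q := by
  have hmeas : StronglyMeasurableAtFilter φ (𝓝 q) :=
    (hc.mono Ioi_subset_Ici_self).stronglyMeasurableAtFilter isOpen_Ioi _ hq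
  refine intervalIntegral.integral_hasDerivAt_right ?_ hmeas (hc.continuousAt (Ici_mem_nhds hq))
  refine ContinuousOn.intervalIntegrable (hc.mono ?_)
  rw [uIcc_of_le hq.le]
  exact fun x hx => hx.1

theorem intervalIntegrable_of_continuousOn_Ici {φ : ℝ → ℝ} (hc : ContinuousOn φ (Ici 0)) {p q : ℝ}
    (hp : 0 ≤ p) (hq : 0 ≤ q) : IntervalIntegrable φ volume p q :=
  ContinuousOn.intervalIntegrable (hc.mono fun _ hx => (le_min hp hq).trans hx.1)

theorem mul_integral_comp_add_mul {φ : ℝ → ℝ} (hc : ContinuousOn φ (Ici 0)) {q a u : ℝ}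
    (hq : 0 ≤ q) (ha : 0 ≤ a) (hu : 0 ≤ u) :
    a * ∫ s in (0 : ℝ)..u, φ (q + a * s) = primitive φ (q + a * u) - primitive φ q := by
  rw [intervalIntegral.mul_integral_comp_add_mul, mul_zero, add_zero, primitive, primitive,
    intervalIntegral.integral_interval_sub_left]
  · exact intervalIntegrable_of_continuousOn_Ici hc le_rfl (by positivity)
  · exact intervalIntegrable_of_continuousOn_Ici hc le_rfl hq

namespace IsSubordinator

variable {Ω : Type*} [MeasurableSpace Ω] {P : Measure Ω} {ξ : ℝ≥0 → Ω → ℝ≥0∞}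

/-- Resetting the process to 0 on a measurable null set makes every path regular, as joint
measurability and the pathwise formulas require. -/
theorem exists_isMonotoneCadlag (hξ : IsSubordinator ξ P) :
    ∃ η : ℝ≥0 → Ω → ℝ≥0∞, (∀ t, Measurable (η t)) ∧ (∀ ω, IsMonotoneCadlag fun t => η t ω) ∧
      ∀ᵐ ω ∂P, ∀ t, η t ω = ξ t ω := by
  classical
  have hgood : ∀ᵐ ω ∂P, IsMonotoneCadlag fun t => ξ t ω := by
    filter_upwards [hξ.mono, hξ.right_cont] with ω h1 h2 using ⟨h1, h2⟩
  set N := toMeasurable P {ω | ¬ IsMonotoneCadlag fun t => ξ t ω} with hN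
  have hN0 : P N = 0 := by
    rw [hN, measure_toMeasurable]
    exact hgood
  refine ⟨fun t ω => if ω ∈ N then 0 else ξ t ω, fun t => ?_, fun ω => ?_, ?_⟩
  · exact Measurable.ite (measurableSet_toMeasurable _ _) measurable_const (hξ.measurable t)
  · by_cases hω : ω ∈ N
    · simp only [hω, if_true]
      exact ⟨monotone_const, fun t => continuousWithinAt_const⟩
    · simp only [hω, if_false]
      by_contra hbad
      exact hω (subset_toMeasurable P _ hbad)
  · have : ∀ᵐ ω ∂P, ω ∉ N := by rw [ae_iff]; simpa using hN0
    filter_upwards [this] with ω hω t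
    simp [hω]

variable [IsProbabilityMeasure P] {η : ℝ≥0 → Ω → ℝ≥0∞}

/-- Limit of the discrete identity `integral_expNeg_sum_mul_expNeg` with mesh u/n and weight a u/n,
under dominated convergence. Paths already killed at u contribute 0. -/
theorem integral_expNeg_area_mul_expNeg (hξ : IsSubordinator ξ P) (hη : ∀ t, Measurable (η t))
    (hp : ∀ ω, IsMonotoneCadlag fun t => η t ω) (hae : ∀ᵐ ω ∂P, ∀ t, η t ω = ξ t ω)
    {a q : ℝ} (ha : 0 ≤ a) (hq : 0 ≤ q) (u : ℝ≥0) :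
    ∫ ω, expNeg a (area (fun t => η t ω) u) * expNeg q (η u ω) ∂P =
      Real.exp (-∫ s in (0 : ℝ)..u, laplaceExponent ξ P (q + a * s)) := by
  have hmono : MonotoneOn (fun s => laplaceExponent ξ P (q + a * s)) (Icc 0 (u : ℝ)) := by
    intro s hs t ht hst
    have hs0 := hs.1
    have ht0 := ht.1
    exact hξ.laplaceExponent_monotoneOn (mem_Ici.2 (by positivity)) (mem_Ici.2 (by positivity))
      (by gcongr)
  have h1 := ((Real.continuous_exp.tendsto _).comp
    (tendsto_riemann_sum_of_monotoneOn u.coe_nonneg hmono).neg)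
  have h2 : Tendsto (fun n : ℕ => ∫ ω, expNeg (a * (u / n : ℝ))
      (∑ j ∈ Finset.range n, η (u / n * j) ω) * expNeg q (η u ω) ∂P) atTop
      (𝓝 (∫ ω, expNeg a (area (fun t => η t ω) u) * expNeg q (η u ω) ∂P)) := by
    refine tendsto_integral_of_dominated_convergence (fun _ => 1) (fun n => ?_)
      (integrable_const _) (fun n => ae_of_all _ fun ω => ?_) (ae_of_all _ fun ω => ?_)
    · refine (Measurable.mul ?_ ((measurable_expNeg q).comp (hη u))).aestronglyMeasurable
      exact (measurable_expNeg _).comp (Finset.measurable_sum _ fun j _ => hη _)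
    · rw [Real.norm_of_nonneg (mul_nonneg (expNeg_nonneg _ _) (expNeg_nonneg _ _))]
      exact mul_le_one₀ (expNeg_le_one (by positivity) _) (expNeg_nonneg _ _) (expNeg_le_one hq _)
    · by_cases hu : η u ω = ∞
      · simp only [hu, expNeg_top, mul_zero]
        exact tendsto_const_nhds
      · exact ((hp ω).tendsto_riemann_sum_area hu).mul_const _
  refine tendsto_nhds_unique h2 (h1.congr' ?_)
  filter_upwards [eventually_gt_atTop 0] with n hn
  have hn' : (n : ℝ≥0) ≠ 0 := by exact_mod_cast hn.ne'
  have h3 := hξ.integral_expNeg_sum_mul_expNeg (a := a * (u / n : ℝ)) (by positivity) (u / n) n hq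
  rw [div_mul_cancel₀ _ hn'] at h3
  have h4 : ∫ ω, expNeg (a * (u / n : ℝ)) (∑ j ∈ Finset.range n, η (u / n * j) ω) *
      expNeg q (η u ω) ∂P = ∫ ω, expNeg (a * (u / n : ℝ))
        (∑ j ∈ Finset.range n, ξ (u / n * j) ω) * expNeg q (ξ u ω) ∂P := by
    refine integral_congr_ae ?_
    filter_upwards [hae] with ω hω
    simp only [hω]
  rw [h4, h3, Function.comp_apply]
  push_cast
  simp only [mul_assoc]

theorem mul_exp_neg_mul_le {p x : ℝ} (hp : 0 < p) : x * Real.exp (-(p * x)) ≤ 1 / p := by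
  rw [Real.exp_neg, ← div_eq_mul_inv, div_le_div_iff₀ (Real.exp_pos _) hp, one_mul]
  linarith [Real.add_one_le_exp (p * x)]

theorem hasDerivAt_expNeg (q : ℝ) (x : ℝ≥0∞) :
    HasDerivAt (fun q => expNeg q x) (-(x.toReal * expNeg q x)) q := by
  by_cases hx : x = ∞
  · simp only [hx, expNeg_top, mul_zero, neg_zero]
    exact hasDerivAt_const _ _
  · simp only [expNeg_of_ne_top _ hx]
    have h : HasDerivAt (fun q : ℝ => Real.exp (-(q * x.toReal)))
        (Real.exp (-(q * x.toReal)) * -(1 * x.toReal)) q :=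
      ((hasDerivAt_id q).mul_const _).neg.exp
    exact h.congr_deriv (by ring)

theorem toReal_mul_expNeg_le {p : ℝ} (hp : 0 < p) (x : ℝ≥0∞) :
    x.toReal * expNeg p x ≤ 1 / p := by
  by_cases hx : x = ∞
  · simp [hx, expNeg_top, hp.le]
  · rw [expNeg_of_ne_top _ hx]
    exact mul_exp_neg_mul_le hp

/-- Differentiate the joint transform in q under the expectation. For p > q/2 the derivative is
dominated by the constant 2/q, since x e^{-px} ≤ 1/p. -/
theorem integral_toReal_mul_expNeg_area (hξ : IsSubordinator ξ P) (hη : ∀ t, Measurable (η t))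
    (hp : ∀ ω, IsMonotoneCadlag fun t => η t ω) (hae : ∀ᵐ ω ∂P, ∀ t, η t ω = ξ t ω)
    {a q : ℝ} (ha : 0 < a) (hq : 0 < q) (u : ℝ≥0) :
    Integrable (fun ω => expNeg a (area (fun t => η t ω) u) *
        ((η u ω).toReal * expNeg q (η u ω))) P ∧
    a * ∫ ω, expNeg a (area (fun t => η t ω) u) * ((η u ω).toReal * expNeg q (η u ω)) ∂P =
      (laplaceExponent ξ P (q + a * u) - laplaceExponent ξ P q) *
        Real.exp (-((primitive (laplaceExponent ξ P) (q + a * u) -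
          primitive (laplaceExponent ξ P) q) / a)) := by
  set φ := laplaceExponent ξ P with hφ
  have hc : ContinuousOn φ (Ici 0) := hξ.laplaceExponent_continuousOn
  have hmA : Measurable fun ω => expNeg a (area (fun t => η t ω) u) :=
    (measurable_expNeg a).comp ((measurable_area hη hp).comp
      (f := fun ω : Ω => (ω, u)) (by fun_prop))
  have hmE : ∀ p, Measurable fun ω => expNeg p (η u ω) := fun p => (measurable_expNeg p).comp (hη u)
  have hG : ∀ p : ℝ, 0 < p → ∫ ω, expNeg a (area (fun t => η t ω) u) * expNeg p (η u ω) ∂P =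
      Real.exp (-((primitive φ (p + a * u) - primitive φ p) / a)) := by
    intro p hp0
    rw [hξ.integral_expNeg_area_mul_expNeg hη hp hae ha.le hp0.le u,
      ← mul_integral_comp_add_mul hc hp0.le ha.le u.coe_nonneg, mul_div_cancel_left₀ _ ha.ne']
  have hd := hasDerivAt_integral_of_dominated_loc_of_deriv_le (μ := P) (𝕜 := ℝ)
    (F := fun p ω => expNeg a (area (fun t => η t ω) u) * expNeg p (η u ω))
    (F' := fun p ω => expNeg a (area (fun t => η t ω) u) * -((η u ω).toReal * expNeg p (η u ω)))
    (x₀ := q) (s := Ioi (q / 2)) (bound := fun _ => 2 / q) (Ioi_mem_nhds (by linarith))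
    (Eventually.of_forall fun p => (hmA.mul (hmE p)).aestronglyMeasurable)
    (Integrable.of_bound (C := 1) (hmA.mul (hmE q)).aestronglyMeasurable (ae_of_all _ fun ω => by
      rw [Real.norm_of_nonneg (mul_nonneg (expNeg_nonneg _ _) (expNeg_nonneg _ _))]
      exact mul_le_one₀ (expNeg_le_one ha.le _) (expNeg_nonneg _ _) (expNeg_le_one hq.le _)))
    (hmA.mul (((hη u).ennreal_toReal).mul (hmE q)).neg).aestronglyMeasurable
    (ae_of_all _ fun ω p hp' => by
      have hp0 : 0 < p := lt_trans (by positivity) hp'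
      rw [norm_mul, norm_neg, Real.norm_of_nonneg (expNeg_nonneg _ _),
        Real.norm_of_nonneg (mul_nonneg ENNReal.toReal_nonneg (expNeg_nonneg _ _))]
      have h1 := toReal_mul_expNeg_le hp0 (η u ω)
      have h2 : 1 / p ≤ 2 / q := by
        rw [div_le_div_iff₀ hp0 hq]
        have : q / 2 < p := hp'
        linarith
      exact (mul_le_of_le_one_left (mul_nonneg ENNReal.toReal_nonneg (expNeg_nonneg _ _))
        (expNeg_le_one ha.le _)).trans (h1.trans h2))
    (integrable_const _)
    (ae_of_all _ fun ω p _ => (hasDerivAt_expNeg p _).const_mul _)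
  have hI : Integrable (fun ω => expNeg a (area (fun t => η t ω) u) *
        ((η u ω).toReal * expNeg q (η u ω))) P := by
    have := hd.1.neg
    refine this.congr (ae_of_all _ fun ω => ?_)
    simp
  refine ⟨hI, ?_⟩
  have hd2 : HasDerivAt (fun p => Real.exp (-((primitive φ (p + a * u) - primitive φ p) / a)))
      (Real.exp (-((primitive φ (q + a * u) - primitive φ q) / a)) *
        -((φ (q + a * u) - φ q) / a)) q := by
    have hA : HasDerivAt (fun p => primitive φ (p + a * u)) (φ (q + a * u)) q :=
      HasDerivAt.comp_add_const q (a * u) (hasDerivAt_primitive hc (by positivity))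
    exact (((hA.sub (hasDerivAt_primitive hc hq)).div_const a).neg).exp
  have heq := hd.2.unique (hd2.congr_of_eventuallyEq (by
    filter_upwards [lt_mem_nhds hq] with p hp0 using hG p hp0))
  have hneg : ∫ ω, expNeg a (area (fun t => η t ω) u) * -((η u ω).toReal * expNeg q (η u ω)) ∂P =
      -∫ ω, expNeg a (area (fun t => η t ω) u) * ((η u ω).toReal * expNeg q (η u ω)) ∂P := by
    rw [← integral_neg]
    simp
  rw [hneg] at heq
  have h3 : ∫ ω, expNeg a (area (fun t => η t ω) u) * ((η u ω).toReal * expNeg q (η u ω)) ∂P =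
      Real.exp (-((primitive φ (q + a * u) - primitive φ q) / a)) *
        ((φ (q + a * u) - φ q) / a) := by linarith
  rw [h3]
  field_simp

/-- The Laplace transform in time of the one-dimensional marginals of the time-changed process. -/
theorem lintegral_integral_expNeg_areaChanged (hξ : IsSubordinator ξ P)
    (hη : ∀ t, Measurable (η t)) (hp : ∀ ω, IsMonotoneCadlag fun t => η t ω)
    (hae : ∀ᵐ ω ∂P, ∀ t, η t ω = ξ t ω) {a q : ℝ} (ha : 0 < a) (hq : 0 < q) :
    ∫⁻ t in Ioi (0 : ℝ), ENNReal.ofReal (a * Real.exp (-(a * t))) *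
        ENNReal.ofReal (∫ ω, expNeg q (areaChanged (fun t => η t ω) t.toNNReal) ∂P) =
      ∫⁻ u in Ioi (0 : ℝ), ENNReal.ofReal
        ((laplaceExponent ξ P (q + a * u) - laplaceExponent ξ P q) *
        Real.exp (-((primitive (laplaceExponent ξ P) (q + a * u) -
          primitive (laplaceExponent ξ P) q) / a))) := by
  have hmX : Measurable fun z : ℝ × Ω => expNeg q (areaChanged (fun t => η t z.2) z.1.toNNReal) :=
    (measurable_expNeg_areaChanged_uncurry hη hp hq).comp
      (f := fun z : ℝ × Ω => (z.2, z.1.toNNReal)) (by fun_prop)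
  have hmη : Measurable fun z : Ω × ℝ => η z.2.toNNReal z.1 :=
    (measurable_uncurry_of_isMonotoneCadlag hη hp).comp
      (f := fun z : Ω × ℝ => (z.1, z.2.toNNReal)) (by fun_prop)
  have hmA : Measurable fun z : Ω × ℝ => area (fun t => η t z.1) z.2.toNNReal :=
    (measurable_area hη hp).comp (f := fun z : Ω × ℝ => (z.1, z.2.toNNReal)) (by fun_prop)
  have e1 : ∀ t : ℝ, ENNReal.ofReal (a * Real.exp (-(a * t))) *
      ENNReal.ofReal (∫ ω, expNeg q (areaChanged (fun t => η t ω) t.toNNReal) ∂P) =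
      ∫⁻ ω, ENNReal.ofReal (a * Real.exp (-(a * t))) *
        ENNReal.ofReal (expNeg q (areaChanged (fun t => η t ω) t.toNNReal)) ∂P := by
    intro t
    have hm : Measurable fun ω => expNeg q (areaChanged (fun t => η t ω) t.toNNReal) :=
      hmX.comp (f := fun ω : Ω => (t, ω)) (by fun_prop)
    rw [lintegral_const_mul _ hm.ennreal_ofReal, ofReal_integral_eq_lintegral_ofReal
      (Integrable.of_bound (C := 1) hm.aestronglyMeasurable (ae_of_all _ fun ω => by
        rw [Real.norm_of_nonneg (expNeg_nonneg _ _)]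
        exact expNeg_le_one hq.le _)) (ae_of_all _ fun ω => expNeg_nonneg _ _)]
  simp only [e1]
  -- Tonelli's theorem is used twice, with the pathwise change of variables in between.
  rw [lintegral_lintegral_swap]
  · simp only [fun ω => (hp ω).lintegral_expNeg_areaChanged ha hq]
    rw [lintegral_lintegral_swap]
    · refine setLIntegral_congr_fun measurableSet_Ioi fun u hu => ?_
      have hu0 : (0 : ℝ) < u := hu
      obtain ⟨hI, h⟩ := hξ.integral_toReal_mul_expNeg_area hη hp hae ha hq u.toNNReal
      rw [Real.coe_toNNReal u hu0.le] at h
      rw [← h, ← integral_const_mul, ofReal_integral_eq_lintegral_ofReal (hI.const_mul a)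
        (ae_of_all _ fun ω => mul_nonneg ha.le (mul_nonneg (expNeg_nonneg _ _)
          (mul_nonneg ENNReal.toReal_nonneg (expNeg_nonneg _ _))))]
      refine lintegral_congr fun ω => ?_
      rw [← ENNReal.ofReal_mul (mul_nonneg (mul_nonneg ha.le ENNReal.toReal_nonneg)
        (expNeg_nonneg _ _))]
      congr 1
      ring
    · refine Measurable.aemeasurable ?_
      exact ((((hmη.ennreal_toReal).const_mul a).mul
        ((measurable_expNeg a).comp hmA)).ennreal_ofReal).mul
        ((measurable_expNeg q).comp hmη).ennreal_ofReal
  · refine Measurable.aemeasurable ?_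
    exact Measurable.mul (by fun_prop) hmX.ennreal_ofReal

end IsSubordinator

/-! ### The primitive Φ and its inverse -/

/-- Continuous, non-decreasing functions on `[0, ∞)` that are positive on `(0, ∞)`. -/
structure IsIncreasingRate (φ : ℝ → ℝ) : Prop where
  continuousOn : ContinuousOn φ (Ici 0)
  monotoneOn : MonotoneOn φ (Ici 0)
  pos : ∀ q, 0 < q → 0 < φ q

/-- The inverse on `[0, ∞)` of the primitive of `φ`. -/
noncomputable def primitiveInv (φ : ℝ → ℝ) : ℝ → ℝ := Function.invFunOn (primitive φ) (Ici 0)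

@[simp]
theorem primitive_zero (φ : ℝ → ℝ) : primitive φ 0 = 0 := intervalIntegral.integral_same

namespace IsIncreasingRate

variable {φ : ℝ → ℝ}

theorem nonneg (h : IsIncreasingRate φ) {q : ℝ} (hq : 0 ≤ q) : 0 ≤ φ q := by
  refine ge_of_tendsto (h.continuousOn q hq |>.mono_left (nhdsWithin_mono q fun x hx => ?_) :
    Tendsto φ (𝓝[>] q) (𝓝 (φ q))) ?_
  · exact hq.trans (le_of_lt hx)
  · filter_upwards [self_mem_nhdsWithin] with x hx using (h.pos x (hq.trans_lt hx)).le

theorem primitive_sub (h : IsIncreasingRate φ) {p q : ℝ} (hp : 0 ≤ p) (hq : 0 ≤ q) :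
    primitive φ q - primitive φ p = ∫ s in p..q, φ s :=
  intervalIntegral.integral_interval_sub_left
    (intervalIntegrable_of_continuousOn_Ici h.continuousOn le_rfl hq)
    (intervalIntegrable_of_continuousOn_Ici h.continuousOn le_rfl hp)

theorem strictMonoOn_primitive (h : IsIncreasingRate φ) : StrictMonoOn (primitive φ) (Ici 0) := by
  intro p hp q hq hpq
  rw [← sub_pos, h.primitive_sub hp hq]
  exact intervalIntegral.intervalIntegral_pos_of_pos_on
    (intervalIntegrable_of_continuousOn_Ici h.continuousOn hp hq)
    (fun x hx => h.pos x (lt_of_le_of_lt hp hx.1)) hpq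

theorem continuousOn_primitive (h : IsIncreasingRate φ) :
    ContinuousOn (primitive φ) (Ici 0) := by
  intro q hq
  have hq0 : (0 : ℝ) ≤ q := hq
  have h1 := intervalIntegral.continuousOn_primitive_interval' (a := 0)
    (intervalIntegrable_of_continuousOn_Ici h.continuousOn le_rfl
      (by linarith : (0 : ℝ) ≤ q + 1)) left_mem_uIcc
  rw [uIcc_of_le (by linarith)] at h1
  refine (h1 q ⟨hq0, by linarith⟩).mono_of_mem_nhdsWithin ?_
  filter_upwards [self_mem_nhdsWithin, mem_nhdsWithin_of_mem_nhds (gt_mem_nhds (lt_add_one q))]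
    with x hx hx' using ⟨hx, hx'.le⟩

theorem mul_le_primitive (h : IsIncreasingRate φ) {q : ℝ} (hq : 1 ≤ q) :
    (q - 1) * φ 1 ≤ primitive φ q := by
  have h0 := h.strictMonoOn_primitive.monotoneOn self_mem_Ici (mem_Ici.2 zero_le_one) zero_le_one
  rw [primitive_zero] at h0
  have h1 := h.primitive_sub zero_le_one (zero_le_one.trans hq)
  have h2 : ∫ s in (1 : ℝ)..q, φ 1 ≤ ∫ s in (1 : ℝ)..q, φ s :=
    intervalIntegral.integral_mono_on hq intervalIntegrable_const
      (intervalIntegrable_of_continuousOn_Ici h.continuousOn zero_le_one (zero_le_one.trans hq))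
      fun x hx => h.monotoneOn (mem_Ici.2 zero_le_one) (zero_le_one.trans hx.1) hx.1
  rw [intervalIntegral.integral_const, smul_eq_mul] at h2
  linarith

theorem bijOn_primitive (h : IsIncreasingRate φ) : BijOn (primitive φ) (Ici 0) (Ici 0) := by
  refine ⟨fun q hq => ?_, h.strictMonoOn_primitive.injOn, fun y hy => ?_⟩
  · have := h.strictMonoOn_primitive.monotoneOn self_mem_Ici hq hq
    rwa [primitive_zero] at this
  · have hy0 : (0 : ℝ) ≤ y := hy
    have h1 := h.pos 1 one_pos
    have hM : (0 : ℝ) ≤ y / φ 1 + 1 := by positivity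
    -- The linear lower bound on Φ equals y at this point, so the intermediate value theorem
    -- applies.
    have h2 := h.mul_le_primitive (q := y / φ 1 + 1) (by linarith [div_nonneg hy0 h1.le])
    rw [add_sub_cancel_right, div_mul_cancel₀ _ h1.ne'] at h2
    obtain ⟨x, hx, hxy⟩ := intermediate_value_Icc hM
      (h.continuousOn_primitive.mono fun x hx => hx.1)
      (show y ∈ Icc (primitive φ 0) (primitive φ (y / φ 1 + 1)) from
        ⟨by rwa [primitive_zero], h2⟩)
    exact ⟨x, hx.1, hxy⟩

theorem primitiveInv_nonneg (h : IsIncreasingRate φ) {w : ℝ} (hw : 0 ≤ w) :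
    0 ≤ primitiveInv φ w :=
  Function.invFunOn_mem (h.bijOn_primitive.surjOn hw)

theorem primitive_primitiveInv (h : IsIncreasingRate φ) {w : ℝ} (hw : 0 ≤ w) :
    primitive φ (primitiveInv φ w) = w :=
  Function.invFunOn_eq (h.bijOn_primitive.surjOn hw)

theorem primitiveInv_primitive (h : IsIncreasingRate φ) {q : ℝ} (hq : 0 ≤ q) :
    primitiveInv φ (primitive φ q) = q :=
  h.strictMonoOn_primitive.injOn (h.primitiveInv_nonneg (h.bijOn_primitive.mapsTo hq)) hq
    (h.primitive_primitiveInv (h.bijOn_primitive.mapsTo hq))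

theorem primitiveInv_zero (h : IsIncreasingRate φ) : primitiveInv φ 0 = 0 := by
  simpa using h.primitiveInv_primitive le_rfl

theorem strictMonoOn_primitiveInv (h : IsIncreasingRate φ) :
    StrictMonoOn (primitiveInv φ) (Ici 0) := by
  intro v hv w hw hvw
  rw [← h.strictMonoOn_primitive.lt_iff_lt (h.primitiveInv_nonneg hv) (h.primitiveInv_nonneg hw),
    h.primitive_primitiveInv hv, h.primitive_primitiveInv hw]
  exact hvw

theorem primitiveInv_pos (h : IsIncreasingRate φ) {w : ℝ} (hw : 0 < w) : 0 < primitiveInv φ w := by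
  have := h.strictMonoOn_primitiveInv self_mem_Ici hw.le hw
  rwa [h.primitiveInv_zero] at this

theorem primitive_pos (h : IsIncreasingRate φ) {q : ℝ} (hq : 0 < q) : 0 < primitive φ q := by
  have := h.strictMonoOn_primitive self_mem_Ici hq.le hq
  rwa [primitive_zero] at this

theorem continuousOn_primitiveInv (h : IsIncreasingRate φ) :
    ContinuousOn (primitiveInv φ) (Ioi 0) := by
  intro w hw
  refine ContinuousAt.continuousWithinAt
    ((h.strictMonoOn_primitiveInv.mono Ioi_subset_Ici_self).continuousAt_of_image_mem_nhds
      (Ioi_mem_nhds hw) ?_)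
  refine mem_of_superset (Ioi_mem_nhds (h.primitiveInv_pos hw)) fun q hq => ?_
  exact ⟨primitive φ q, h.primitive_pos hq, h.primitiveInv_primitive (le_of_lt hq)⟩

/-- For increasing functions, whether a lies above or below the inverse at w is decided by comparing
the primitive at a with w, and this comparison survives pointwise convergence. -/
theorem tendsto_primitiveInv (h : IsIncreasingRate φ) {ψ : ℕ → ℝ → ℝ}
    (hψ : ∀ᶠ n in atTop, IsIncreasingRate (ψ n))
    (hlim : ∀ q, 0 ≤ q → Tendsto (fun n => primitive (ψ n) q) atTop (𝓝 (primitive φ q)))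
    {w : ℝ} (hw : 0 ≤ w) :
    Tendsto (fun n => primitiveInv (ψ n) w) atTop (𝓝 (primitiveInv φ w)) := by
  have hg := h.primitiveInv_nonneg hw
  refine tendsto_order.2 ⟨fun a ha => ?_, fun a ha => ?_⟩
  · rcases lt_or_ge a 0 with h0 | h0
    · filter_upwards [hψ] with n hn using h0.trans_le (hn.primitiveInv_nonneg hw)
    · have h1 := h.strictMonoOn_primitive h0 hg ha
      filter_upwards [hψ, (hlim a h0).eventually (gt_mem_nhds h1)] with n hn h2
      rw [h.primitive_primitiveInv hw] at h2
      rwa [← hn.strictMonoOn_primitive.lt_iff_lt h0 (hn.primitiveInv_nonneg hw),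
        hn.primitive_primitiveInv hw]
  · have h0 : 0 ≤ a := hg.trans ha.le
    have h1 := h.strictMonoOn_primitive hg h0 ha
    filter_upwards [hψ, (hlim a h0).eventually (lt_mem_nhds h1)] with n hn h2
    rw [h.primitive_primitiveInv hw] at h2
    rwa [← hn.strictMonoOn_primitive.lt_iff_lt (hn.primitiveInv_nonneg hw) h0,
      hn.primitive_primitiveInv hw]

/-- The inverse is the limit of the iterates of `y ↦ w / c + (y - Φ y / c)`. -/
theorem isBernstein_primitiveInv_of_le (h : IsIncreasingRate φ) {c : ℝ} (hc : 0 < c)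
    (hφc : ∀ q, 0 ≤ q → φ q ≤ c)
    (hcm : ∀ b : ℝ → ℝ, IsBernstein b → (∀ w, 0 < w → 0 ≤ b w) → ∀ s, 0 ≤ s →
      CompletelyMonotone fun w => 1 - φ (s + b w) / c) :
    IsBernstein (primitiveInv φ) := by
  have hf0 : ∀ s, 0 ≤ s → 0 ≤ 1 - φ s / c := fun s hs =>
    sub_nonneg.2 ((div_le_one hc).2 (hφc s hs))
  have hanti : AntitoneOn (fun s => 1 - φ s / c) (Ici 0) := fun p hp q hq hpq => by
    have := h.monotoneOn hp hq hpq
    simp only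
    gcongr
  have hint : ∀ p q, 0 ≤ p → 0 ≤ q →
      IntervalIntegrable (fun s => 1 - φ s / c) volume p q := fun p q hp hq =>
    intervalIntegrable_const.sub
      ((intervalIntegrable_of_continuousOn_Ici h.continuousOn hp hq).div_const c)
  have hprim : ∀ q, 0 ≤ q → ∫ s in (0 : ℝ)..q, (1 - φ s / c) = q - primitive φ q / c := by
    intro q hq
    rw [intervalIntegral.integral_sub intervalIntegrable_const
      ((intervalIntegrable_of_continuousOn_Ici h.continuousOn le_rfl hq).div_const c),
      intervalIntegral.integral_div, primitive]
    simp
  -- A fixed point y ≥ 0 of `T w` satisfies Φ(y) = w. Since φ ≤ c, the integrand is nonnegative and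
  -- `T w` is monotone.
  let T : ℝ → ℝ → ℝ := fun w y => 1 / c * w + ∫ s in (0 : ℝ)..y, (1 - φ s / c)
  let u : ℕ → ℝ → ℝ := fun n w => (T w)^[n] 0
  have husucc : ∀ n w, u (n + 1) w = T w (u n w) := fun n w => Function.iterate_succ_apply' _ _ _
  have hTmono : ∀ w, MonotoneOn (T w) (Ici 0) := by
    intro w p hp q hq hpq
    have h1 := intervalIntegral.integral_interval_sub_left (hint 0 q le_rfl hq)
      (hint 0 p le_rfl hp)
    have h2 : 0 ≤ ∫ s in p..q, (1 - φ s / c) :=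
      intervalIntegral.integral_nonneg hpq fun s hs => hf0 s (le_trans hp hs.1)
    simp only [T]
    linarith
  have hTnn : ∀ w, 0 ≤ w → ∀ y, 0 ≤ y → 0 ≤ T w y := fun w hw y hy =>
    add_nonneg (by positivity) (intervalIntegral.integral_nonneg hy fun s hs => hf0 s hs.1)
  have hunn : ∀ n w, 0 ≤ w → 0 ≤ u n w := by
    intro n w hw
    induction n with
    | zero => exact le_rfl
    | succ n ih => exact husucc n w ▸ hTnn w hw _ ih
  -- By `primitive_comp`, `T` preserves the Bernstein property; `hcm` is applied to the previous
  -- iterate.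
  have hub : ∀ n, IsBernstein (u n) := by
    intro n
    induction n with
    | zero => exact IsBernstein.zero
    | succ n ih =>
      have h1 := (IsBernstein.id.const_mul (one_div_pos.2 hc).le).add
        (IsBernstein.primitive_comp hanti hf0 ih (fun w hw => hunn n w hw.le)
          (fun s hs => hcm _ ih (fun w hw => hunn n w hw.le) s hs))
      exact h1.congr fun w _ => (husucc n w).symm
  refine IsBernstein.of_tendsto (l := atTop) (Eventually.of_forall hub) fun w hw => ?_
  have hg := h.primitiveInv_nonneg hw.le
  have hTg : T w (primitiveInv φ w) = primitiveInv φ w := by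
    simp only [T]
    rw [hprim _ hg, h.primitive_primitiveInv hw.le]
    ring
  have hle : ∀ n, u n w ≤ primitiveInv φ w := by
    intro n
    induction n with
    | zero => exact hg
    | succ n ih =>
      rw [husucc, ← hTg]
      exact hTmono w (hunn n w hw.le) hg ih
  have hmono : Monotone fun n => u n w := by
    refine monotone_nat_of_le_succ fun n => ?_
    induction n with
    | zero => exact hunn 1 w hw.le
    | succ n ih =>
      rw [husucc, husucc (n + 1)]
      exact hTmono w (hunn n w hw.le) (hunn (n + 1) w hw.le) ih
  have hl := tendsto_atTop_ciSup hmono ⟨_, by rintro _ ⟨n, rfl⟩; exact hle n⟩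
  set l := ⨆ n, u n w with hldef
  have hl0 : 0 ≤ l := ge_of_tendsto hl (Eventually.of_forall fun n => hunn n w hw.le)
  have hTl : Tendsto (fun n => u (n + 1) w) atTop (𝓝 (1 / c * w + (l - primitive φ l / c))) := by
    have h1 : Tendsto (fun n => u n w) atTop (𝓝[Ici 0] l) :=
      tendsto_nhdsWithin_iff.2 ⟨hl, Eventually.of_forall fun n => hunn n w hw.le⟩
    have h2 := (h.continuousOn_primitive l hl0).tendsto.comp h1
    refine ((hl.sub (h2.div_const c)).const_add (1 / c * w)).congr fun n => ?_
    rw [husucc]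
    simp only [T]
    rw [hprim _ (hunn n w hw.le)]
    rfl
  -- The iterates increase and stay below the inverse, so they have a finite limit l, and l = w/c +
  -- l - Φ(l)/c gives Φ(l) = w.
  have heq := tendsto_nhds_unique hTl ((tendsto_add_atTop_iff_nat 1).2 hl)
  have hΦ : primitive φ l = w := by
    field_simp at heq
    linarith
  have hgl : primitiveInv φ w = l := by
    conv_lhs => rw [← hΦ]
    exact h.primitiveInv_primitive hl0
  rwa [hgl]

end IsIncreasingRate

theorem integral_exp_neg_mul_Ioi {c : ℝ} (hc : 0 < c) :
    ∫ t in Ioi (0 : ℝ), Real.exp (-(t * c)) = 1 / c := by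
  have := integral_exp_mul_Ioi (a := -c) (by linarith) 0
  simp only [mul_zero, Real.exp_zero, neg_div_neg_eq] at this
  rw [← this]
  refine integral_congr_ae (ae_of_all _ fun t => ?_)
  simp only
  ring_nf

/-! ### The inverse of Φ is a Bernstein function -/

namespace IsSubordinator

variable {Ω : Type*} [MeasurableSpace Ω] {P : Measure Ω} [IsProbabilityMeasure P]
  {ξ : ℝ≥0 → Ω → ℝ≥0∞}

theorem isIncreasingRate_laplaceExponent (hξ : IsSubordinator ξ P)
    (hne : ¬ ∀ t : ℝ≥0, ∀ᵐ ω ∂P, ξ t ω = 0) : IsIncreasingRate (laplaceExponent ξ P) :=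
  ⟨hξ.laplaceExponent_continuousOn, hξ.laplaceExponent_monotoneOn,
    fun _ hq => hξ.laplaceExponent_pos hne hq⟩

/-- The function is E[e^{-sξ_t} e^{-ξ_t b(w)}], a mixture of the functions e^{-x b(w)}, which are
completely monotone by the definition of a Bernstein function. -/
theorem completelyMonotone_exp_laplaceExponent (hξ : IsSubordinator ξ P) {b : ℝ → ℝ}
    (hb : IsBernstein b) (hb0 : ∀ w, 0 < w → 0 ≤ b w) {s : ℝ} (hs : 0 ≤ s) (t : ℝ≥0) :
    CompletelyMonotone fun w => Real.exp (-(t * laplaceExponent ξ P (s + b w))) := by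
  intro h hh
  refine (CMStep.integral (μ := P) (F := fun ω w => expNeg (s + b w) (ξ t ω)) hh
    (fun ω => ?_) fun w hw => hξ.integrable_expNeg (add_nonneg hs (hb0 w hw)) t).congr hh
    fun w hw => hξ.integral_expNeg_eq (add_nonneg hs (hb0 w hw)) t
  by_cases hx : ξ t ω = ∞
  · simpa only [hx, expNeg_top] using CMStep.const h le_rfl
  · refine ((CMStep.const h (Real.exp_pos (-(s * (ξ t ω).toReal))).le).mul
      (hb (ξ t ω).toReal ENNReal.toReal_nonneg h hh) hh).congr hh fun w _ => ?_
    rw [expNeg_of_ne_top _ hx, ← Real.exp_add]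
    ring_nf

theorem isBernstein_primitiveInv (hξ : IsSubordinator ξ P)
    (hne : ¬ ∀ t : ℝ≥0, ∀ᵐ ω ∂P, ξ t ω = 0) :
    IsBernstein (primitiveInv (laplaceExponent ξ P)) := by
  have h := hξ.isIncreasingRate_laplaceExponent hne
  set φ := laplaceExponent ξ P with hφ
  -- ψ_n is bounded by n, dominated by φ and converges to φ, while 1 - ψ_n/n = e^{-φ/n} is the
  -- transform of ξ at time 1/n, so the bounded case applies.
  let ψ : ℕ → ℝ → ℝ := fun n q => n * (1 - Real.exp (-((n : ℝ)⁻¹ * φ q)))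
  have hψ : ∀ᶠ n in atTop, IsIncreasingRate (ψ n) := by
    filter_upwards [eventually_gt_atTop 0] with n hn
    have hn0 : (0 : ℝ) < n := by exact_mod_cast hn
    refine ⟨?_, ?_, fun q hq => ?_⟩
    · exact continuousOn_const.mul (continuousOn_const.sub
        (Real.continuous_exp.comp_continuousOn (continuousOn_const.mul h.continuousOn).neg))
    · intro p hp q hq hpq
      have := h.monotoneOn hp hq hpq
      simp only [ψ]
      gcongr
    · refine mul_pos hn0 (sub_pos.2 (Real.exp_lt_one_iff.2 ?_))
      have := h.pos q hq
      rw [neg_lt_zero]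
      positivity
  have hlimψ : ∀ q, Tendsto (fun n => ψ n q) atTop (𝓝 (φ q)) := by
    intro q
    have h1 : HasDerivAt (fun x : ℝ => 1 - Real.exp (-(x * φ q))) (φ q) 0 := by
      have : HasDerivAt (fun x : ℝ => 1 - Real.exp (-(x * φ q)))
          (0 - Real.exp (-(0 * φ q)) * -(1 * φ q)) 0 :=
        (hasDerivAt_const _ _).sub ((hasDerivAt_id _).mul_const _).neg.exp
      exact this.congr_deriv (by simp)
    have h2 := hasDerivAt_iff_tendsto_slope_zero.1 h1
    have h3 : Tendsto (fun n : ℕ => (n : ℝ)⁻¹) atTop (𝓝[≠] 0) := by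
      refine tendsto_nhdsWithin_iff.2 ⟨tendsto_inv_atTop_nhds_zero_nat, ?_⟩
      filter_upwards [eventually_gt_atTop 0] with n hn
      have : (n : ℝ) ≠ 0 := by exact_mod_cast hn.ne'
      exact inv_ne_zero this
    refine (h2.comp h3).congr fun n => ?_
    simp [ψ]
  have hψle : ∀ n : ℕ, ∀ q, 0 ≤ q → 0 ≤ ψ n q ∧ ψ n q ≤ φ q := by
    intro n q hq
    have hφ0 := h.nonneg hq
    refine ⟨mul_nonneg (by positivity) (sub_nonneg.2 (Real.exp_le_one_iff.2 ?_)), ?_⟩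
    · rw [neg_nonpos]
      positivity
    · rcases Nat.eq_zero_or_pos n with hn | hn
      · simpa [ψ, hn] using hφ0
      · have hn0 : (0 : ℝ) < n := by exact_mod_cast hn
        have h1 := Real.add_one_le_exp (-((n : ℝ)⁻¹ * φ q))
        calc ψ n q ≤ n * ((n : ℝ)⁻¹ * φ q) := by
              refine mul_le_mul_of_nonneg_left ?_ hn0.le
              linarith
          _ = φ q := by field_simp
  refine IsBernstein.of_tendsto (l := atTop) (F := fun n => primitiveInv (ψ n)) ?_
    fun w hw => h.tendsto_primitiveInv hψ (fun q hq => ?_) hw.le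
  · filter_upwards [hψ, eventually_gt_atTop 0] with n hn hn'
    have hn0 : (0 : ℝ) < n := by exact_mod_cast hn'
    refine hn.isBernstein_primitiveInv_of_le hn0 (fun q _ => ?_) fun b hb hb0 s hs => ?_
    · have := (Real.exp_pos (-((n : ℝ)⁻¹ * φ q)))
      simp only [ψ]
      nlinarith
    · have := hξ.completelyMonotone_exp_laplaceExponent hb hb0 hs (n : ℝ≥0)⁻¹
      convert this using 2 with w
      simp only [ψ]
      rw [mul_div_cancel_left₀ _ hn0.ne']
      simp [hφ]
  · refine intervalIntegral.tendsto_integral_filter_of_dominated_convergence φ ?_ ?_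
      (intervalIntegrable_of_continuousOn_Ici h.continuousOn le_rfl hq) ?_
    · filter_upwards [hψ] with n hn
      exact (intervalIntegrable_of_continuousOn_Ici hn.continuousOn le_rfl hq).def'.aestronglyMeasurable
    · refine Eventually.of_forall fun n => ae_of_all _ fun s hs => ?_
      rw [uIoc_of_le hq] at hs
      obtain ⟨h1, h2⟩ := hψle n s hs.1.le
      rwa [Real.norm_of_nonneg h1]
    · exact ae_of_all _ fun s _ => hlimψ s

/-- Write 1/c = ∫_0^∞ e^{-tc} dt with c = φ(Φ^{-1}(w)); each integrand is completely monotone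
because Φ^{-1} is Bernstein. -/
theorem completelyMonotone_one_div_laplaceExponent (hξ : IsSubordinator ξ P)
    (hne : ¬ ∀ t : ℝ≥0, ∀ᵐ ω ∂P, ξ t ω = 0) :
    CompletelyMonotone fun w => 1 / laplaceExponent ξ P (primitiveInv (laplaceExponent ξ P) w) := by
  intro h hh
  have hr := hξ.isIncreasingRate_laplaceExponent hne
  have hb := hξ.isBernstein_primitiveInv hne
  set φ := laplaceExponent ξ P with hφ
  refine (CMStep.integral (μ := volume.restrict (Ioi (0 : ℝ)))
    (F := fun t w => Real.exp (-(t.toNNReal * φ (0 + primitiveInv φ w)))) hh (fun t => ?_)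
    fun w hw => ?_).congr hh fun w hw => ?_
  · exact hξ.completelyMonotone_exp_laplaceExponent hb
      (fun w hw => hr.primitiveInv_nonneg hw.le) le_rfl _ h hh
  · have hpos := hr.pos _ (hr.primitiveInv_pos hw)
    refine (exp_neg_integrableOn_Ioi 0 hpos).congr_fun (fun t ht => ?_) measurableSet_Ioi
    have ht0 : (0 : ℝ) ≤ t := le_of_lt ht
    simp only [Real.coe_toNNReal t ht0, zero_add]
    ring_nf
  · rw [← integral_exp_neg_mul_Ioi (hr.pos _ (hr.primitiveInv_pos hw))]
    refine setIntegral_congr_fun measurableSet_Ioi fun t ht => ?_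
    have ht0 : (0 : ℝ) ≤ t := le_of_lt ht
    simp only [Real.coe_toNNReal t ht0, zero_add]

end IsSubordinator

/-! ### Lévy-Khintchine representation of the inverse -/

namespace IsIncreasingRate

variable {φ : ℝ → ℝ}

/-- Substituting v = Φ(q) identifies Φ^{-1} as an antiderivative of 1/φ(Φ^{-1}), even when φ(0) = 0
makes the integrand unbounded near 0. -/
theorem setLIntegral_one_div (h : IsIncreasingRate φ) {w : ℝ} (hw : 0 ≤ w) :
    ∫⁻ v in Ioo 0 w, ENNReal.ofReal (1 / φ (primitiveInv φ v)) =
      ENNReal.ofReal (primitiveInv φ w) := by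
  have hg := h.primitiveInv_nonneg hw
  have himg : primitive φ '' Ioo 0 (primitiveInv φ w) = Ioo 0 w := by
    ext v
    constructor
    · rintro ⟨q, hq, rfl⟩
      refine ⟨h.primitive_pos hq.1, ?_⟩
      have := h.strictMonoOn_primitive (le_of_lt hq.1) hg hq.2
      rwa [h.primitive_primitiveInv hw] at this
    · intro hv
      exact ⟨primitiveInv φ v, ⟨h.primitiveInv_pos hv.1,
        h.strictMonoOn_primitiveInv (le_of_lt hv.1) hw hv.2⟩,
        h.primitive_primitiveInv hv.1.le⟩
  rw [← himg, lintegral_image_eq_lintegral_abs_deriv_mul measurableSet_Ioo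
    (fun q hq => (hasDerivAt_primitive h.continuousOn hq.1).hasDerivWithinAt)
    (h.strictMonoOn_primitive.injOn.mono fun q hq => le_of_lt hq.1)]
  have : ∫⁻ q in Ioo 0 (primitiveInv φ w), ENNReal.ofReal |φ q| *
      ENNReal.ofReal (1 / φ (primitiveInv φ (primitive φ q))) =
      ∫⁻ _ in Ioo 0 (primitiveInv φ w), 1 := by
    refine setLIntegral_congr_fun measurableSet_Ioo fun q hq => ?_
    have hpos := h.pos q hq.1
    rw [h.primitiveInv_primitive hq.1.le, abs_of_pos hpos, ← ENNReal.ofReal_mul hpos.le,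
      mul_one_div_cancel hpos.ne', ENNReal.ofReal_one]
  rw [this]
  simp

end IsIncreasingRate

theorem setLIntegral_eq_add_of_Iio_eq_zero {ν : Measure ℝ} (hν : ν (Iio 0) = 0) (F : ℝ → ℝ≥0∞) :
    ∫⁻ x, F x ∂ν = F 0 * ν {0} + ∫⁻ x in Ioi 0, F x ∂ν := by
  rw [← lintegral_add_compl F (measurableSet_Ioi (a := (0 : ℝ))), add_comm]
  congr 1
  have h1 : ν (Iic 0 \ {0}) = 0 := measure_mono_null (fun x hx => lt_of_le_of_ne hx.1 hx.2) hν
  have h2 : ν ({0} \ Iic 0) = 0 := by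
    rw [sdiff_eq_empty.2 (singleton_subset_iff.2 self_mem_Iic), measure_empty]
  rw [compl_Ioi, setLIntegral_congr (ae_eq_set.2 ⟨h1, h2⟩), lintegral_singleton]

/-- An antiderivative of the Laplace transform of a measure on `[0, ∞)` has a
Lévy-Khintchine representation. -/
theorem exists_levyMeasure {f g : ℝ → ℝ} (hf : CompletelyMonotone f) (hfc : ContinuousOn f (Ioi 0))
    (hg0 : ∀ w, 0 ≤ w → 0 ≤ g w)
    (hfg : ∀ w, 0 ≤ w → ∫⁻ v in Ioo 0 w, ENNReal.ofReal (f v) = ENNReal.ofReal (g w)) :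
    ∃ (L : Measure ℝ) (d : ℝ), SFinite L ∧ 0 ≤ d ∧ L (Iic 0) = 0 ∧
      ∫⁻ x in Ioi 0, ENNReal.ofReal (min 1 x) ∂L < ∞ ∧
      (∀ w, 0 < w → ENNReal.ofReal (f w) =
        ENNReal.ofReal d + ∫⁻ x in Ioi 0, ENNReal.ofReal (x * Real.exp (-(x * w))) ∂L) ∧
      ∀ w, 0 ≤ w → g w = d * w + ∫ x in Ioi 0, (1 - Real.exp (-(w * x))) ∂L := by
  obtain ⟨ν, hsf, hν0, hν⟩ := hf.exists_measure hfc
  -- In Bernstein's representation of f, the atom at 0 becomes the drift and the rest, divided by x,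
  -- the Lévy measure.
  set L := (ν.restrict (Ioi 0)).withDensity fun x => ENNReal.ofReal (1 / x) with hLdef
  have hLint : ∀ F : ℝ → ℝ, Measurable F → ∫⁻ x in Ioi 0, ENNReal.ofReal (x * F x) ∂L =
      ∫⁻ x in Ioi 0, ENNReal.ofReal (F x) ∂ν := by
    intro F hF
    rw [hLdef, restrict_withDensity measurableSet_Ioi, Measure.restrict_restrict measurableSet_Ioi,
      inter_self, lintegral_withDensity_eq_lintegral_mul _ (by fun_prop) (by fun_prop)]
    refine setLIntegral_congr_fun measurableSet_Ioi fun x hx => ?_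
    have hx0 : (0 : ℝ) < x := hx
    simp only [Pi.mul_apply]
    rw [← ENNReal.ofReal_mul (by positivity)]
    congr 1
    field_simp
  have hL0 : L (Iic 0) = 0 := by
    rw [hLdef, withDensity_apply _ measurableSet_Iic, Measure.restrict_restrict measurableSet_Iic,
      Iic_inter_Ioi]
    simp
  have hνw : ∀ w, 0 < w → ENNReal.ofReal (f w) =
      ν {0} + ∫⁻ x in Ioi 0, ENNReal.ofReal (x * Real.exp (-(x * w))) ∂L := by
    intro w hw
    rw [hν w hw, setLIntegral_eq_add_of_Iio_eq_zero hν0,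
      hLint (fun x => Real.exp (-(x * w))) (by fun_prop)]
    simp [mul_comm w]
  have hd : ν {0} ≠ ∞ := by
    have h1 := hνw 1 one_pos
    exact (lt_of_le_of_lt (h1 ▸ le_self_add) ENNReal.ofReal_lt_top).ne
  have hdeq : ENNReal.ofReal (ν {0}).toReal = ν {0} := ENNReal.ofReal_toReal hd
  -- Integrate f over (0, w), using ∫_0^w x e^{-xv} dv = 1 - e^{-wx}.
  have hgw : ∀ w, 0 ≤ w → ENNReal.ofReal (g w) = ENNReal.ofReal ((ν {0}).toReal * w) +
      ∫⁻ x in Ioi 0, ENNReal.ofReal (1 - Real.exp (-(w * x))) ∂L := by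
    intro w hw
    rw [← hfg w hw, setLIntegral_congr_fun measurableSet_Ioo fun v hv => hνw v hv.1,
      lintegral_add_left measurable_const, setLIntegral_const, Real.volume_Ioo, sub_zero,
      ENNReal.ofReal_mul ENNReal.toReal_nonneg, hdeq]
    congr 1
    rw [lintegral_lintegral_swap (by fun_prop)]
    refine setLIntegral_congr_fun measurableSet_Ioi fun x hx => ?_
    rw [IsMonotoneCadlag.setLIntegral_exp_Ioo hx hw, mul_comm x w]
  have hmin : ∫⁻ x in Ioi 0, ENNReal.ofReal (min 1 x) ∂L < ∞ := by
    have h1 := hgw 1 zero_le_one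
    have h2 : ∫⁻ x in Ioi 0, ENNReal.ofReal (1 - Real.exp (-(1 * x))) ∂L < ∞ :=
      lt_of_le_of_lt (h1 ▸ le_add_self) ENNReal.ofReal_lt_top
    -- This rests on min(1, x) ≤ 2x/(1+x) ≤ 2(1 - e^{-x}).
    have h3 : ∫⁻ x in Ioi 0, ENNReal.ofReal (min 1 x) ∂L ≤
        ∫⁻ x in Ioi 0, 2 * ENNReal.ofReal (1 - Real.exp (-(1 * x))) ∂L := by
      refine setLIntegral_mono (by fun_prop) fun x hx => ?_
      have hx0 : (0 : ℝ) < x := hx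
      rw [← ENNReal.ofReal_ofNat 2, ← ENNReal.ofReal_mul zero_le_two]
      refine ENNReal.ofReal_le_ofReal ?_
      have he := Real.add_one_le_exp x
      have h4 : Real.exp (-(1 * x)) ≤ 1 / (x + 1) := by
        rw [one_mul, Real.exp_neg, ← one_div]
        gcongr
      have h5 : min 1 x ≤ 2 * (1 - 1 / (x + 1)) := by
        have : 1 - 1 / (x + 1) = x / (x + 1) := by field_simp; ring
        rw [this, ← mul_div_assoc, le_div_iff₀ (by linarith)]
        rcases le_total 1 x with h | h
        · rw [min_eq_left h]
          linarith
        · rw [min_eq_right h]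
          nlinarith
      linarith
    refine h3.trans_lt ?_
    rw [lintegral_const_mul _ (by fun_prop)]
    exact ENNReal.mul_lt_top (by simp) h2
  refine ⟨L, (ν {0}).toReal, inferInstance, ENNReal.toReal_nonneg, hL0, hmin, ?_, ?_⟩
  · rwa [hdeq]
  · intro w hw
    have h1 := hgw w hw
    have hnn := integral_one_sub_exp_nonneg (L := L) hw
    rw [← ofReal_integral_eq_lintegral_ofReal (integrable_one_sub_exp hmin hw) ?_,
      ← ENNReal.ofReal_add (mul_nonneg ENNReal.toReal_nonneg hw) hnn,
      ENNReal.ofReal_eq_ofReal_iff (hg0 w hw)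
        (add_nonneg (mul_nonneg ENNReal.toReal_nonneg hw) hnn)] at h1
    · exact h1
    · filter_upwards [ae_restrict_mem measurableSet_Ioi] with x hx
      exact sub_nonneg.2 (Real.exp_le_one_iff.2 (by have : 0 < x := hx; nlinarith))

theorem IsSubordinator.exists_levyMeasure_primitiveInv {Ω : Type*} [MeasurableSpace Ω]
    {P : Measure Ω} [IsProbabilityMeasure P] {ξ : ℝ≥0 → Ω → ℝ≥0∞} (hξ : IsSubordinator ξ P)
    (hne : ¬ ∀ t : ℝ≥0, ∀ᵐ ω ∂P, ξ t ω = 0) :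
    ∃ (L : Measure ℝ) (d : ℝ), SFinite L ∧ 0 ≤ d ∧ L (Iic 0) = 0 ∧
      ∫⁻ x in Ioi 0, ENNReal.ofReal (min 1 x) ∂L < ∞ ∧
      (∀ q, 0 < q → ENNReal.ofReal (1 / laplaceExponent ξ P q) = ENNReal.ofReal d +
        ∫⁻ x in Ioi 0, ENNReal.ofReal
          (x * Real.exp (-(x * primitive (laplaceExponent ξ P) q))) ∂L) ∧
      ∀ w, 0 ≤ w → primitiveInv (laplaceExponent ξ P) w =
        d * w + ∫ x in Ioi 0, (1 - Real.exp (-(w * x))) ∂L := by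
  have h := hξ.isIncreasingRate_laplaceExponent hne
  obtain ⟨L, d, h1, h2, h3, h4, h5, h6⟩ := exists_levyMeasure
    (hξ.completelyMonotone_one_div_laplaceExponent hne)
    (continuousOn_const.div ((h.continuousOn.mono Ioi_subset_Ici_self).comp
      h.continuousOn_primitiveInv fun w hw => h.primitiveInv_pos hw)
      fun w hw => (h.pos _ (h.primitiveInv_pos hw)).ne')
    (fun w hw => h.primitiveInv_nonneg hw) (fun w hw => h.setLIntegral_one_div hw)
  refine ⟨L, d, h1, h2, h3, h4, fun q hq => ?_, h6⟩
  rw [← h5 _ (h.primitive_pos hq), h.primitiveInv_primitive hq.le]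

/-! ### Uniqueness of Laplace transforms and right-continuity in t -/

theorem lintegral_exp_neg_mul_Ioi {c : ℝ} (hc : 0 < c) :
    ∫⁻ t in Ioi (0 : ℝ), ENNReal.ofReal (Real.exp (-(t * c))) = ENNReal.ofReal (1 / c) := by
  rw [← integral_exp_neg_mul_Ioi hc, ofReal_integral_eq_lintegral_ofReal _
    (ae_of_all _ fun t => (Real.exp_pos _).le)]
  refine (exp_neg_integrableOn_Ioi 0 hc).congr (ae_of_all _ fun t => ?_)
  simp only
  ring_nf

theorem lintegral_exp_neg_mul_one_sub_Ioi {c : ℝ} (hc : 0 < c) :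
    ∫⁻ t in Ioi (0 : ℝ), ENNReal.ofReal (Real.exp (-t) * (1 - Real.exp (-(c * t)))) =
      ENNReal.ofReal (c / (1 + c)) := by
  have h1 : IntegrableOn (fun t => Real.exp (-(t * 1))) (Ioi 0) :=
    (exp_neg_integrableOn_Ioi 0 one_pos).congr (ae_of_all _ fun t => by simp)
  have h2 : IntegrableOn (fun t => Real.exp (-(t * (1 + c)))) (Ioi 0) :=
    (exp_neg_integrableOn_Ioi 0 (b := 1 + c) (by linarith)).congr
      (ae_of_all _ fun t => by simp only; ring_nf)
  have e : ∀ t : ℝ, Real.exp (-t) * (1 - Real.exp (-(c * t))) =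
      Real.exp (-(t * 1)) - Real.exp (-(t * (1 + c))) := by
    intro t
    rw [mul_sub, ← Real.exp_add]
    ring_nf
  rw [← ofReal_integral_eq_lintegral_ofReal]
  · simp only [e]
    rw [integral_sub h1 h2, integral_exp_neg_mul_Ioi one_pos, integral_exp_neg_mul_Ioi (by linarith)]
    congr 1
    field_simp
    ring
  · simp only [e]
    exact h1.sub h2
  · filter_upwards [ae_restrict_mem measurableSet_Ioi] with t ht
    have ht0 : (0 : ℝ) < t := ht
    refine mul_nonneg (Real.exp_pos _).le (sub_nonneg.2 (Real.exp_le_one_iff.2 ?_))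
    nlinarith

section Uniqueness

/-- Uniqueness of Laplace transforms of nonnegative functions, from the positive integers. -/
theorem ae_eq_of_lintegral_exp_eq {F G : ℝ → ℝ≥0∞} (hF : Measurable F) (hG : Measurable G)
    (hfin : ∫⁻ t in Ioi (0 : ℝ), ENNReal.ofReal (Real.exp (-t)) * F t ≠ ∞)
    (h : ∀ n : ℕ, ∫⁻ t in Ioi (0 : ℝ), ENNReal.ofReal (Real.exp (-((n + 1) * t))) * F t =
      ∫⁻ t in Ioi (0 : ℝ), ENNReal.ofReal (Real.exp (-((n + 1) * t))) * G t) :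
    F =ᵐ[volume.restrict (Ioi 0)] G := by
  -- The weight e^{-t} makes the measures finite, and the remaining factor e^{-nt} is the n-th power
  -- of the unit exponential on [0, ∞].
  set μ : (ℝ → ℝ≥0∞) → Measure ℝ := fun F =>
    (volume.restrict (Ioi (0 : ℝ))).withDensity fun t => ENNReal.ofReal (Real.exp (-t)) * F t with hμ
  have hmE : Measurable fun t : ℝ => ENNReal.ofReal (Real.exp (-t)) := by fun_prop
  have hfin' : ∫⁻ t in Ioi (0 : ℝ), ENNReal.ofReal (Real.exp (-t)) * G t ≠ ∞ := by
    have h0 := h 0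
    simp only [Nat.cast_zero, zero_add, one_mul] at h0
    rwa [← h0]
  have : IsFiniteMeasure (μ F) := isFiniteMeasure_withDensity hfin
  have : IsFiniteMeasure (μ G) := isFiniteMeasure_withDensity hfin'
  have hpos : ∀ F, ∀ᵐ t ∂(μ F), t ∈ Ioi (0 : ℝ) := fun F =>
    (withDensity_absolutelyContinuous _ _).ae_le (ae_restrict_mem measurableSet_Ioi)
  have key : ∀ F : ℝ → ℝ≥0∞, Measurable F → ∀ n : ℕ,
      ∫ x, expNeg 1 x ^ n ∂((μ F).map ENNReal.ofReal) =
        (∫⁻ t in Ioi (0 : ℝ), ENNReal.ofReal (Real.exp (-((n + 1) * t))) * F t).toReal := by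
    intro F hF n
    have hm : Measurable fun x => expNeg 1 x ^ n := (measurable_expNeg 1).pow_const n
    rw [integral_map (by fun_prop) hm.aestronglyMeasurable, integral_eq_lintegral_of_nonneg_ae
      (ae_of_all _ fun t => pow_nonneg (expNeg_nonneg _ _) _)
      (hm.comp ENNReal.measurable_ofReal).aestronglyMeasurable]
    have hw := lintegral_withDensity_eq_lintegral_mul (volume.restrict (Ioi (0 : ℝ)))
      (f := fun t => ENNReal.ofReal (Real.exp (-t)) * F t) (hmE.mul hF)
      (g := fun t => ENNReal.ofReal (expNeg 1 (ENNReal.ofReal t) ^ n))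
      ((hm.comp ENNReal.measurable_ofReal).ennreal_ofReal)
    refine congrArg ENNReal.toReal (hw.trans ?_)
    refine setLIntegral_congr_fun measurableSet_Ioi fun t ht => ?_
    have ht0 : (0 : ℝ) < t := ht
    simp only [Pi.mul_apply]
    rw [expNeg_of_ne_top _ ENNReal.ofReal_ne_top, ENNReal.toReal_ofReal ht0.le, ← Real.exp_nat_mul,
      mul_right_comm, ← ENNReal.ofReal_mul (Real.exp_pos _).le, ← Real.exp_add]
    ring_nf
  have hmap : (μ F).map ENNReal.ofReal = (μ G).map ENNReal.ofReal :=
    ennreal_measure_ext fun n => by rw [key F hF, key G hG, h n]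
  have hback : ∀ F, ((μ F).map ENNReal.ofReal).map ENNReal.toReal = μ F := by
    intro F
    rw [Measure.map_map ENNReal.measurable_toReal ENNReal.measurable_ofReal]
    have : (ENNReal.toReal ∘ ENNReal.ofReal) =ᵐ[μ F] id := by
      filter_upwards [hpos F] with t ht
      exact ENNReal.toReal_ofReal (le_of_lt ht)
    rw [Measure.map_congr this, Measure.map_id]
  have heq : μ F = μ G := by rw [← hback F, hmap, hback G]
  have hae := (withDensity_eq_iff (hmE.mul hF).aemeasurable (hmE.mul hG).aemeasurable hfin).1 heq
  filter_upwards [hae] with t ht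
  have h0 : ENNReal.ofReal (Real.exp (-t)) ≠ 0 := by
    rw [ne_eq, ENNReal.ofReal_eq_zero, not_le]
    exact Real.exp_pos _
  exact (ENNReal.mul_right_inj h0 ENNReal.ofReal_ne_top).1 ht

/-- If the functions were not equal at points arbitrarily close to t on its right, they would differ
on a whole interval (t, b) of positive measure. -/
theorem eq_of_ae_eq_of_tendsto_nhdsGT {F G : ℝ → ℝ} (h : F =ᵐ[volume.restrict (Ioi 0)] G) {t : ℝ}
    (ht : 0 ≤ t) (hF : Tendsto F (𝓝[>] t) (𝓝 (F t))) (hG : Tendsto G (𝓝[>] t) (𝓝 (G t))) :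
    F t = G t := by
  refine tendsto_nhds_unique_of_frequently_eq hF hG fun hcon => ?_
  obtain ⟨b, hb, hsub⟩ := mem_nhdsGT_iff_exists_Ioo_subset.1 hcon
  have h1 : volume.restrict (Ioi 0) {s | ¬ F s = G s} = 0 := h
  have h2 : volume.restrict (Ioi 0) (Ioo t b) = 0 := measure_mono_null hsub h1
  rw [Measure.restrict_apply measurableSet_Ioo,
    inter_eq_left.2 (show Ioo t b ⊆ Ioi 0 from fun s hs => ht.trans_lt hs.1), Real.volume_Ioo, ENNReal.ofReal_eq_zero] at h2
  have : t < b := hb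
  linarith

end Uniqueness

/-- The condition t < A_u is open in t, which gives the lower bound; monotonicity in t gives the
upper one. -/
theorem IsMonotoneCadlag.tendsto_expNeg_areaChanged {x : ℝ≥0 → ℝ≥0∞} (hx : IsMonotoneCadlag x)
    {q : ℝ} (hq : 0 < q) (t : ℝ) :
    Tendsto (fun s : ℝ => expNeg q (areaChanged x s.toNNReal)) (𝓝[>] t)
      (𝓝 (expNeg q (areaChanged x t.toNNReal))) := by
  refine tendsto_order.2 ⟨fun c hc => ?_, fun c hc => ?_⟩
  · rcases lt_or_ge c 0 with h0 | h0
    · exact Eventually.of_forall fun s => h0.trans_le (expNeg_nonneg _ _)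
    · obtain ⟨n, hn, hn'⟩ := (hx.lt_expNeg_areaChanged_iff hq h0 _).1 hc
      have hcont : Continuous fun s : ℝ => (s.toNNReal : ℝ≥0∞) := by fun_prop
      have h1 : ∀ᶠ s : ℝ in 𝓝[>] t, (s.toNNReal : ℝ≥0∞) <
          area x (TopologicalSpace.denseSeq ℝ≥0 n) :=
        mem_nhdsWithin_of_mem_nhds (hcont.continuousAt.eventually (gt_mem_nhds hn))
      filter_upwards [h1] with s hs
      exact (hx.lt_expNeg_areaChanged_iff hq h0 _).2 ⟨n, hs, hn'⟩
  · filter_upwards [self_mem_nhdsWithin] with s hs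
    refine (expNeg_antitone hq.le ?_).trans_lt hc
    refine iInf_mono fun u => iInf_mono' fun hu => ⟨lt_of_le_of_lt ?_ hu, le_rfl⟩
    exact_mod_cast Real.toNNReal_le_toNNReal (le_of_lt hs)

/-! ### The two Laplace transforms in t -/

section Kernel

variable {L : Measure ℝ} {w : ℝ}

theorem integrableOn_exp_mul_self
    (hL : ∫⁻ x in Ioi 0, ENNReal.ofReal (x * Real.exp (-(x * w))) ∂L ≠ ∞) :
    IntegrableOn (fun x : ℝ => x * Real.exp (-(x * w))) (Ioi 0) L := by
  refine ⟨by fun_prop, ?_⟩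
  rw [hasFiniteIntegral_iff_ofReal]
  · exact hL.lt_top
  · filter_upwards [ae_restrict_mem measurableSet_Ioi] with x hx
    exact mul_nonneg (le_of_lt hx) (Real.exp_pos _).le

theorem norm_exp_sub_div_mul_self_le {t x : ℝ} (ht : 0 ≤ t) (hx : 0 < x) :
    ‖Real.exp (-(w * x) - t / x) * x‖ ≤ x * Real.exp (-(x * w)) := by
  rw [Real.norm_of_nonneg (by positivity), mul_comm, mul_comm x w]
  have : 0 ≤ t / x := by positivity
  gcongr
  linarith

theorem integrableOn_exp_sub_div_mul_self
    (hL : ∫⁻ x in Ioi 0, ENNReal.ofReal (x * Real.exp (-(x * w))) ∂L ≠ ∞) {t : ℝ} (ht : 0 ≤ t) :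
    IntegrableOn (fun x : ℝ => Real.exp (-(w * x) - t / x) * x) (Ioi 0) L := by
  refine (integrableOn_exp_mul_self hL).mono'
    (Measurable.aestronglyMeasurable (by fun_prop)) ?_
  filter_upwards [ae_restrict_mem measurableSet_Ioi] with x hx
  exact norm_exp_sub_div_mul_self_le ht hx

theorem tendsto_integral_exp_sub_div_mul_self
    (hL : ∫⁻ x in Ioi 0, ENNReal.ofReal (x * Real.exp (-(x * w))) ∂L ≠ ∞) {t : ℝ} (ht : 0 ≤ t) :
    Tendsto (fun s : ℝ => ∫ x in Ioi 0, Real.exp (-(w * x) - s / x) * x ∂L) (𝓝[>] t)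
      (𝓝 (∫ x in Ioi 0, Real.exp (-(w * x) - t / x) * x ∂L)) := by
  refine tendsto_integral_filter_of_dominated_convergence _ ?_ ?_ (integrableOn_exp_mul_self hL) ?_
  · exact Eventually.of_forall fun s => Measurable.aestronglyMeasurable (by fun_prop)
  · filter_upwards [self_mem_nhdsWithin] with s hs
    filter_upwards [ae_restrict_mem measurableSet_Ioi] with x hx
    exact norm_exp_sub_div_mul_self_le (ht.trans (le_of_lt hs)) hx
  · refine ae_of_all _ fun x => tendsto_nhdsWithin_of_tendsto_nhds ?_
    exact Continuous.tendsto (by fun_prop) t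

/-- After Tonelli's theorem, ∫ a e^{-at} e^{-t/x} dt = a/(a + 1/x) = ax/(1 + ax). -/
theorem lintegral_exp_mul_integral_exp_sub_div [SFinite L]
    (hL : ∫⁻ x in Ioi 0, ENNReal.ofReal (x * Real.exp (-(x * w))) ∂L ≠ ∞) {a : ℝ} (ha : 0 < a) :
    ∫⁻ t in Ioi (0 : ℝ), ENNReal.ofReal (a * Real.exp (-(a * t))) *
        ENNReal.ofReal (∫ x in Ioi 0, Real.exp (-(w * x) - t / x) * x ∂L) =
      ∫⁻ x in Ioi 0, ENNReal.ofReal (x * Real.exp (-(x * w))) *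
        ENNReal.ofReal (a * x / (1 + a * x)) ∂L := by
  have h1 : ∀ t ∈ Ioi (0 : ℝ), ENNReal.ofReal (a * Real.exp (-(a * t))) *
      ENNReal.ofReal (∫ x in Ioi 0, Real.exp (-(w * x) - t / x) * x ∂L) =
      ∫⁻ x in Ioi 0, ENNReal.ofReal (a * Real.exp (-(a * t))) *
        ENNReal.ofReal (Real.exp (-(w * x) - t / x) * x) ∂L := by
    intro t ht
    rw [lintegral_const_mul _ (by fun_prop), ofReal_integral_eq_lintegral_ofReal
      (integrableOn_exp_sub_div_mul_self hL (le_of_lt ht))]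
    filter_upwards [ae_restrict_mem measurableSet_Ioi] with x hx
    exact mul_nonneg (Real.exp_pos _).le (le_of_lt hx)
  rw [setLIntegral_congr_fun measurableSet_Ioi h1, lintegral_lintegral_swap (by fun_prop)]
  refine setLIntegral_congr_fun measurableSet_Ioi fun x hx => ?_
  have hx0 : (0 : ℝ) < x := hx
  have h2 : ∀ t : ℝ, ENNReal.ofReal (a * Real.exp (-(a * t))) *
      ENNReal.ofReal (Real.exp (-(w * x) - t / x) * x) =
      ENNReal.ofReal (x * Real.exp (-(x * w))) * ENNReal.ofReal a *
        ENNReal.ofReal (Real.exp (-(t * (a + 1 / x)))) := by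
    intro t
    rw [← ENNReal.ofReal_mul (by positivity), ← ENNReal.ofReal_mul (by positivity),
      ← ENNReal.ofReal_mul (by positivity)]
    congr 1
    rw [show -(w * x) - t / x = -(x * w) + -(t / x) by ring,
      show -(t * (a + 1 / x)) = -(a * t) + -(t / x) by ring, Real.exp_add, Real.exp_add]
    ring
  simp only [h2]
  rw [lintegral_const_mul _ (by fun_prop), lintegral_exp_neg_mul_Ioi (by positivity), mul_assoc,
    ← ENNReal.ofReal_mul ha.le]
  congr 2
  field_simp
  ring

end Kernel

namespace IsIncreasingRate

variable {φ : ℝ → ℝ}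

/-- The map u ↦ (Φ(q+au) - Φ(q))/a is an increasing bijection of (0, ∞) with derivative φ(q+au). -/
theorem lintegral_exp_neg_primitive (h : IsIncreasingRate φ) {q a : ℝ} (hq : 0 < q) (ha : 0 < a)
    (F : ℝ → ℝ≥0∞) :
    ∫⁻ u in Ioi (0 : ℝ), ENNReal.ofReal (φ (q + a * u)) *
        F ((primitive φ (q + a * u) - primitive φ q) / a) = ∫⁻ s in Ioi 0, F s := by
  set S : ℝ → ℝ := fun u => (primitive φ (q + a * u) - primitive φ q) / a with hS
  have hmono : StrictMonoOn S (Ici 0) := by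
    intro u hu v hv huv
    have hu0 : (0 : ℝ) ≤ u := hu
    have hv0 : (0 : ℝ) ≤ v := hv
    have : primitive φ (q + a * u) < primitive φ (q + a * v) :=
      h.strictMonoOn_primitive (mem_Ici.2 (by positivity)) (mem_Ici.2 (by positivity)) (by gcongr)
    simp only [hS]
    gcongr
  have hS0 : S 0 = 0 := by simp [hS]
  have himg : S '' Ioi 0 = Ioi 0 := by
    ext s
    constructor
    · rintro ⟨u, hu, rfl⟩
      have hu0 : (0 : ℝ) < u := hu
      have := hmono self_mem_Ici hu0.le hu0
      rwa [hS0] at this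
    · intro hs
      have hs0 : (0 : ℝ) < s := hs
      have hq' := h.primitive_pos hq
      have h1 : primitive φ q < primitive φ q + a * s := by
        have := mul_pos ha hs0
        linarith
      have h2 := h.strictMonoOn_primitiveInv hq'.le (hq'.le.trans h1.le) h1
      rw [h.primitiveInv_primitive hq.le] at h2
      refine ⟨(primitiveInv φ (primitive φ q + a * s) - q) / a, div_pos (sub_pos.2 h2) ha, ?_⟩
      simp only [hS]
      rw [mul_div_cancel₀ _ ha.ne', add_sub_cancel, h.primitive_primitiveInv (hq'.le.trans h1.le)]
      field_simp
      ring
  have hderiv : ∀ u ∈ Ioi (0 : ℝ), HasDerivWithinAt S (φ (q + a * u)) (Ioi 0) u := by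
    intro u hu
    have hu0 : (0 : ℝ) < u := hu
    have h1 : HasDerivAt (fun u => q + a * u) a u := by
      simpa using ((hasDerivAt_id u).const_mul a).const_add q
    have h2 := (hasDerivAt_primitive h.continuousOn (q := q + a * u) (by positivity)).comp u h1
    refine (((h2.sub_const (primitive φ q)).div_const a).congr_deriv ?_).hasDerivWithinAt
    field_simp
  have hsubst := lintegral_image_eq_lintegral_abs_deriv_mul measurableSet_Ioi hderiv
    (hmono.injOn.mono Ioi_subset_Ici_self) F
  rw [himg] at hsubst
  rw [hsubst]
  refine setLIntegral_congr_fun measurableSet_Ioi fun u hu => ?_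
  have hu0 : (0 : ℝ) < u := hu
  rw [abs_of_pos (h.pos _ (by positivity))]

theorem lintegral_sub_mul_exp_neg_primitive (h : IsIncreasingRate φ) {L : Measure ℝ} [SFinite L]
    {d : ℝ} (hL : ∀ q, 0 < q → ENNReal.ofReal (1 / φ q) = ENNReal.ofReal d +
      ∫⁻ x in Ioi 0, ENNReal.ofReal (x * Real.exp (-(x * primitive φ q))) ∂L)
    {q a : ℝ} (hq : 0 < q) (ha : 0 < a) :
    ∫⁻ u in Ioi (0 : ℝ), ENNReal.ofReal ((φ (q + a * u) - φ q) *
        Real.exp (-((primitive φ (q + a * u) - primitive φ q) / a))) =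
      ENNReal.ofReal (φ q) * ∫⁻ x in Ioi 0, ENNReal.ofReal (x * Real.exp (-(x * primitive φ q))) *
        ENNReal.ofReal (a * x / (1 + a * x)) ∂L := by
  -- K expresses 1/φ(q) - 1/φ(q+au) as a function of s = (Φ(q+au) - Φ(q))/a; the drift cancels in
  -- the difference.
  let K : ℝ → ℝ≥0∞ := fun s => ∫⁻ x in Ioi 0, ENNReal.ofReal (x * Real.exp (-(x * primitive φ q))) *
    ENNReal.ofReal (1 - Real.exp (-(a * x * s))) ∂L
  have hK : ∀ u, 0 < u → ENNReal.ofReal (1 / φ q - 1 / φ (q + a * u)) =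
      K ((primitive φ (q + a * u) - primitive φ q) / a) := by
    intro u hu
    have hqu : 0 < q + a * u := by positivity
    have hpos := h.pos _ hqu
    rw [ENNReal.ofReal_sub _ (by positivity)]
    symm
    refine ENNReal.eq_sub_of_add_eq ENNReal.ofReal_ne_top ?_
    rw [hL q hq, hL _ hqu, ← add_assoc, add_comm (K _), add_assoc]
    congr 1
    rw [← lintegral_add_left (by fun_prop)]
    refine setLIntegral_congr_fun measurableSet_Ioi fun x hx => ?_
    have hx0 : (0 : ℝ) < x := hx
    have hle : primitive φ q ≤ primitive φ (q + a * u) :=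
      h.strictMonoOn_primitive.monotoneOn hq.le hqu.le (by linarith [mul_pos ha hu])
    have e1 : a * x * ((primitive φ (q + a * u) - primitive φ q) / a) =
        x * (primitive φ (q + a * u) - primitive φ q) := by field_simp
    have hexp : Real.exp (-(x * (primitive φ (q + a * u) - primitive φ q))) ≤ 1 :=
      Real.exp_le_one_iff.2 (neg_nonpos.2 (mul_nonneg hx0.le (sub_nonneg.2 hle)))
    rw [e1, ← ENNReal.ofReal_mul (by positivity), ← ENNReal.ofReal_add
      (mul_nonneg (by positivity) (sub_nonneg.2 hexp)) (by positivity)]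
    congr 1
    rw [mul_sub, mul_assoc, mul_assoc, ← Real.exp_add]
    ring_nf
  -- Factor φ(q+au) - φ(q) = φ(q) φ(q+au) (1/φ(q) - 1/φ(q+au)); the middle factor is the Jacobian of
  -- the substitution.
  have h1 : ∀ u ∈ Ioi (0 : ℝ), ENNReal.ofReal ((φ (q + a * u) - φ q) *
      Real.exp (-((primitive φ (q + a * u) - primitive φ q) / a))) =
      ENNReal.ofReal (φ q) * (ENNReal.ofReal (φ (q + a * u)) *
        (fun s => ENNReal.ofReal (Real.exp (-s)) * K s)
          ((primitive φ (q + a * u) - primitive φ q) / a)) := by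
    intro u hu
    have hu0 : (0 : ℝ) < u := hu
    have hqu : 0 < q + a * u := by positivity
    have hp1 := h.pos _ hq
    have hp2 := h.pos _ hqu
    simp only
    rw [← hK u hu, ← ENNReal.ofReal_mul (Real.exp_pos _).le, ← ENNReal.ofReal_mul hp2.le,
      ← ENNReal.ofReal_mul hp1.le]
    congr 1
    field_simp
  rw [setLIntegral_congr_fun measurableSet_Ioi h1, lintegral_const_mul' _ _ ENNReal.ofReal_ne_top,
    h.lintegral_exp_neg_primitive hq ha (fun s => ENNReal.ofReal (Real.exp (-s)) * K s)]
  congr 1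
  have h2 : ∀ s : ℝ, ENNReal.ofReal (Real.exp (-s)) * K s =
      ∫⁻ x in Ioi 0, ENNReal.ofReal (Real.exp (-s)) *
        (ENNReal.ofReal (x * Real.exp (-(x * primitive φ q))) *
          ENNReal.ofReal (1 - Real.exp (-(a * x * s)))) ∂L := fun s =>
    (lintegral_const_mul _ (by fun_prop)).symm
  simp only [h2]
  rw [lintegral_lintegral_swap (by fun_prop)]
  refine setLIntegral_congr_fun measurableSet_Ioi fun x hx => ?_
  have hx0 : (0 : ℝ) < x := hx
  rw [← lintegral_exp_neg_mul_one_sub_Ioi (c := a * x) (by positivity),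
    ← lintegral_const_mul _ (by fun_prop)]
  refine lintegral_congr fun s => ?_
  rw [ENNReal.ofReal_mul (Real.exp_pos _).le]
  ring

end IsIncreasingRate

/-! ### Conclusion -/

theorem IsSubordinator.integral_expNeg_areaChanged {Ω : Type*} [MeasurableSpace Ω]
    {P : Measure Ω} [IsProbabilityMeasure P] {ξ η : ℝ≥0 → Ω → ℝ≥0∞} (hξ : IsSubordinator ξ P)
    (hne : ¬ ∀ t : ℝ≥0, ∀ᵐ ω ∂P, ξ t ω = 0) (hη : ∀ t, Measurable (η t))
    (hp : ∀ ω, IsMonotoneCadlag fun t => η t ω) (hae : ∀ᵐ ω ∂P, ∀ t, η t ω = ξ t ω)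
    {L : Measure ℝ} [SFinite L] {d : ℝ}
    (hL : ∀ q, 0 < q → ENNReal.ofReal (1 / laplaceExponent ξ P q) = ENNReal.ofReal d +
      ∫⁻ x in Ioi 0, ENNReal.ofReal
        (x * Real.exp (-(x * primitive (laplaceExponent ξ P) q))) ∂L)
    {q : ℝ} (hq : 0 < q) {t : ℝ} (ht : 0 ≤ t) :
    ∫ ω, expNeg q (areaChanged (fun t => η t ω) t.toNNReal) ∂P = laplaceExponent ξ P q *
      ∫ x in Ioi 0, Real.exp (-(primitive (laplaceExponent ξ P) q * x) - t / x) * x ∂L := by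
  have h := hξ.isIncreasingRate_laplaceExponent hne
  set φ := laplaceExponent ξ P with hφ
  have hφq := h.pos q hq
  have hfin : ∫⁻ x in Ioi 0, ENNReal.ofReal (x * Real.exp (-(x * primitive φ q))) ∂L ≠ ∞ :=
    (lt_of_le_of_lt (hL q hq ▸ le_add_self) ENNReal.ofReal_lt_top).ne
  have hmX : Measurable fun z : ℝ × Ω => expNeg q (areaChanged (fun t => η t z.2) z.1.toNNReal) :=
    (measurable_expNeg_areaChanged_uncurry hη hp hq).comp
      (f := fun z : ℝ × Ω => (z.2, z.1.toNNReal)) (by fun_prop)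
  have hmω : ∀ s : ℝ, Measurable fun ω => expNeg q (areaChanged (fun t => η t ω) s.toNNReal) :=
    fun s => hmX.comp (f := fun ω : Ω => (s, ω)) (by fun_prop)
  set F : ℝ → ℝ := fun t => ∫ ω, expNeg q (areaChanged (fun t => η t ω) t.toNNReal) ∂P with hF
  set G : ℝ → ℝ := fun t => φ q *
    ∫ x in Ioi 0, Real.exp (-(primitive φ q * x) - t / x) * x ∂L with hG
  have hFm : Measurable F := (hmX.stronglyMeasurable.integral_prod_right' (ν := P)).measurable
  have hGm : Measurable G := by
    have hm : Measurable fun z : ℝ × ℝ => Real.exp (-(primitive φ q * z.2) - z.1 / z.2) * z.2 := by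
      fun_prop
    exact ((hm.stronglyMeasurable.integral_prod_right'
      (ν := L.restrict (Ioi 0))).measurable).const_mul _
  have hF0 : ∀ t, 0 ≤ F t := fun t => integral_nonneg fun ω => expNeg_nonneg _ _
  have hG0 : ∀ t, 0 ≤ G t := fun t => mul_nonneg hφq.le
    (setIntegral_nonneg measurableSet_Ioi fun x hx => mul_nonneg (Real.exp_pos _).le (le_of_lt hx))
  have hF1 : ∀ t, F t ≤ 1 := by
    intro t
    calc F t ≤ ∫ _, (1 : ℝ) ∂P :=
          integral_mono (Integrable.of_bound (C := 1) (hmω t).aestronglyMeasurable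
            (ae_of_all _ fun ω => by
              rw [Real.norm_of_nonneg (expNeg_nonneg _ _)]
              exact expNeg_le_one hq.le _)) (integrable_const _) fun ω => expNeg_le_one hq.le _
      _ = 1 := by simp
  -- Both transforms reduce to φ(q) ∫ x e^{-xΦ(q)} (ax/(1+ax)) L(dx).
  have hlap : ∀ a : ℝ, 0 < a →
      ∫⁻ t in Ioi (0 : ℝ), ENNReal.ofReal (a * Real.exp (-(a * t))) * ENNReal.ofReal (F t) =
        ∫⁻ t in Ioi (0 : ℝ), ENNReal.ofReal (a * Real.exp (-(a * t))) * ENNReal.ofReal (G t) := by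
    intro a ha
    rw [hξ.lintegral_integral_expNeg_areaChanged hη hp hae ha hq,
      h.lintegral_sub_mul_exp_neg_primitive hL hq ha,
      ← lintegral_exp_mul_integral_exp_sub_div hfin ha,
      ← lintegral_const_mul' _ _ ENNReal.ofReal_ne_top]
    refine lintegral_congr fun t => ?_
    simp only [hG]
    rw [ENNReal.ofReal_mul hφq.le]
    ring
  have hae' : F =ᵐ[volume.restrict (Ioi 0)] G := by
    have h1 := ae_eq_of_lintegral_exp_eq hFm.ennreal_ofReal hGm.ennreal_ofReal ?_ fun n => ?_
    · filter_upwards [h1] with t ht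
      exact (ENNReal.ofReal_eq_ofReal_iff (hF0 t) (hG0 t)).1 ht
    · refine (lt_of_le_of_lt (lintegral_mono (g := fun t : ℝ =>
        ENNReal.ofReal (Real.exp (-(t * 1)))) fun t => ?_) ?_).ne
      · simp only [mul_one]
        exact mul_le_of_le_one_right' (by simpa using hF1 t)
      · rw [lintegral_exp_neg_mul_Ioi one_pos]
        exact ENNReal.ofReal_lt_top
    · have hn : (0 : ℝ) < n + 1 := by positivity
      have h2 := hlap (n + 1) hn
      have h3 : ∀ H : ℝ → ℝ, ∫⁻ t in Ioi (0 : ℝ),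
          ENNReal.ofReal ((n + 1) * Real.exp (-((n + 1) * t))) * ENNReal.ofReal (H t) =
          ENNReal.ofReal (n + 1) * ∫⁻ t in Ioi (0 : ℝ),
            ENNReal.ofReal (Real.exp (-((n + 1) * t))) * ENNReal.ofReal (H t) := by
        intro H
        rw [← lintegral_const_mul' _ _ ENNReal.ofReal_ne_top]
        refine lintegral_congr fun t => ?_
        rw [ENNReal.ofReal_mul hn.le, mul_assoc]
      rw [h3, h3] at h2
      exact (ENNReal.mul_right_inj (by rwa [ne_eq, ENNReal.ofReal_eq_zero, not_le])
        ENNReal.ofReal_ne_top).1 h2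
  refine eq_of_ae_eq_of_tendsto_nhdsGT hae' ht ?_
    ((tendsto_integral_exp_sub_div_mul_self hfin ht).const_mul _)
  refine tendsto_integral_filter_of_dominated_convergence (fun _ => 1)
    (Eventually.of_forall fun s => (hmω s).aestronglyMeasurable)
    (Eventually.of_forall fun s => ae_of_all _ fun ω => ?_) (integrable_const _)
    (ae_of_all _ fun ω => (hp ω).tendsto_expNeg_areaChanged hq t)
  rw [Real.norm_of_nonneg (expNeg_nonneg _ _)]
  exact expNeg_le_one hq.le _

theorem theorem1 {Ω : Type*} [MeasurableSpace Ω] (P : Measure Ω) [IsProbabilityMeasure P]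
    (ξ : ℝ≥0 → Ω → ℝ≥0∞) (hξ : IsSubordinator ξ P)
    (hne : ¬ ∀ t : ℝ≥0, ∀ᵐ ω ∂P, ξ t ω = 0)
    (φ Φ : ℝ → ℝ) (hφ : φ = laplaceExponent ξ P) (hΦ : Φ = primitive φ) :
    (∀ q : ℝ, 0 ≤ q → IntervalIntegrable φ volume 0 q) ∧
    BijOn Φ (Ici 0) (Ici 0) ∧
    ∃ (Ω' : Type) (_ : MeasurableSpace Ω') (P' : Measure Ω') (σ : ℝ≥0 → Ω' → ℝ≥0∞)
      (L : Measure ℝ),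
      IsProbabilityMeasure P' ∧ IsSubordinator σ P' ∧
      (∀ q : ℝ, 0 ≤ q → laplaceExponent σ P' q = Function.invFunOn Φ (Ici 0) q) ∧
      HasLevyMeasure σ P' L ∧
      ∀ (q : ℝ) (t : ℝ≥0), 0 < q →
        Integrable (fun ω => expNeg q (timeChanged ξ t ω)) P ∧
        IntegrableOn (fun x : ℝ => Real.exp (-(Φ q * x) - t / x) * x) (Ioi 0) L ∧
        ∫ ω, expNeg q (timeChanged ξ t ω) ∂P =
          φ q * ∫ x in Ioi (0 : ℝ), Real.exp (-(Φ q * x) - t / x) * x ∂L := by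
  subst hφ hΦ
  have h := hξ.isIncreasingRate_laplaceExponent hne
  obtain ⟨L, d, hsf, hd, hL0, hmin, hL, hg⟩ := hξ.exists_levyMeasure_primitiveInv hne
  obtain ⟨Ω', hΩ', P', σ, hP', hσ, hexp⟩ := exists_subordinator hd hL0 hmin
  obtain ⟨η, hη, hp, hae⟩ := hξ.exists_isMonotoneCadlag
  refine ⟨fun q hq => intervalIntegrable_of_continuousOn_Ici h.continuousOn le_rfl hq,
    h.bijOn_primitive, Ω', hΩ', P', σ, L, hP', hσ, fun q hq => (hexp q hq).trans (hg q hq).symm,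
    -- The killing rate is 0, in accordance with Φ^{-1}(0) = 0.
    ⟨hL0, hmin, 0, d, le_rfl, hd, fun q hq => by rw [hexp q hq, zero_add]⟩, fun q t hq => ?_⟩
  have htc : ∀ᵐ ω ∂P, expNeg q (timeChanged ξ t ω) =
      expNeg q (areaChanged (fun t => η t ω) t) := by
    filter_upwards [hae] with ω hω
    have hpath : (fun t => ξ t ω) = fun t => η t ω := funext fun t => (hω t).symm
    have hx : IsMonotoneCadlag fun t => ξ t ω := hpath ▸ hp ω
    rw [hx.timeChanged_eq, hpath]
  have hm : Measurable fun ω => expNeg q (areaChanged (fun t => η t ω) t) :=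
    (measurable_expNeg_areaChanged_uncurry hη hp hq).comp (f := fun ω : Ω => (ω, t)) (by fun_prop)
  have hfin : ∫⁻ x in Ioi 0, ENNReal.ofReal
      (x * Real.exp (-(x * primitive (laplaceExponent ξ P) q))) ∂L ≠ ∞ :=
    (lt_of_le_of_lt (hL q hq ▸ le_add_self) ENNReal.ofReal_lt_top).ne
  refine ⟨?_, integrableOn_exp_sub_div_mul_self hfin t.coe_nonneg, ?_⟩
  · refine Integrable.congr (f := fun ω => expNeg q (areaChanged (fun t => η t ω) t))
      (Integrable.of_bound (C := 1) hm.aestronglyMeasurable (ae_of_all _ fun ω => ?_))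
      (htc.mono fun ω hω => hω.symm)
    rw [Real.norm_of_nonneg (expNeg_nonneg _ _)]
    exact expNeg_le_one hq.le _
  · rw [integral_congr_ae htc]
    have := hξ.integral_expNeg_areaChanged hne hη hp hae hL hq t.coe_nonneg
    rwa [Real.toNNReal_coe] at this
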